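/- \textbf{Setting.} Let $(\Omega,\mathbb P_0)$ be a probability space carrying covariates $X\in\mathcal X$, a treatment $A$ with values in a measurable set $\mathcal A\subset\mathbb R$, and a random potential-outcome function $a\mapsto Y(a)$ with $0\le Y(a)\le M$ for $a\in\mathcal A$ (that is, $Y(a)=y(a,U)$ with $y$ jointly measurable and $U$ a random element). The observed outcome is $Y=Y(A)$. Given $X$, the potential-outcome function $Y(\cdot)$ (that is, $U$) is independent of $A$. The conditional law of $A$ given $X=x$ has a density $f_0(a|x)$ and there is $\epsilon>0$ such that, for every $a\in\mathcal A$, $f_0(a|x)\ge\epsilon$ for almost every $x$. For almost every $x$ and all $a\in\mathcal A$, the conditional law of $Y(a)$ given $X=x$ has a density $f_0(y|a,x)$, $y\in[0,M]$, which is three times differentiable in $a$ on the interior of $\mathcal A$, with derivatives of orders $0,\dots,3$ bounded uniformly in $(y,a,x)$. Let $K\ge 0$ be a symmetric kernel with $\int K=1$, $\int uK(u)\,du=0$, $\int u^2K(u)\,du<\infty$, $|K|\le M_K$ and $|K(u)-K(v)|\le L_K|u-v|$, $L_K>0$, and let $K_h(u)=K(u/h)/h$. Let $\rho>0$ and let $\Pi$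 be a class of measurable policies $\pi:\mathcal X\to\mathcal A$ which contains a countable subclass such that every $\pi\in\Pi$ is a pointwise limit of a sequence in the subclass. Suppose that $[\pi(x)-\rho,\pi(x)+\rho]\subset\mathcal A$ for all $\pi\in\Pi$ and $x\in\mathcal X$, and that the law of $Y(\pi(X))$ has density at least $\epsilon$ on $[0,M]$ for every $\pi\in\Pi$. For $\eta\ge 0$ let $Q_{\mathrm{DRO}}(\pi)=\inf\{\mathbb E_{\mathbb P}[Y(\pi(X))]:\mathrm{KL}(\mathbb P\|\mathbb P_0)\le\eta\}$ and $R_{\mathrm{DRO}}(\pi)=\sup_{\tilde\pi\in\Pi}Q_{\mathrm{DRO}}(\tilde\pi)-Q_{\mathrm{DRO}}(\pi)$. Given $N\geq 1$ i.i.d. observations $(X_i,A_i,Y_i)$ of $(X,A,Y)$, let $w_i(\pi)=K_h(\pi(X_i)-A_i)/f_0(A_i|X_i)$, $\hat W_N^h(\pi,\alpha)=\sum_i w_i(\pi)e^{-Y_i/\alpha}/\sum_i w_i(\pi)$, $\hat Q^h_{\mathrm{DRO}}(\pi)=\sup_{\alpha>0}\{-\alpha\log\hat W_N^h(\pi,\alpha)-\alpha\eta\}$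 (read as $0$ if all the $w_i(\pi)$ vanish), and let $\hat\pi^h_{\mathrm{DRO}}\in\Pi$ be a maximizer of $\hat Q^h_{\mathrm{DRO}}$ over $\Pi$ for almost every sample. Let $$\kappa_{N,h}=\mathbb E\Big[\int_0^{2M_Kh/L_K}\sqrt{\log\mathfrak N(t,\Pi,\|\cdot\|_{L_2(\mathbb P_N)})}\,dt\Big],\qquad \|f\|_{L_2(\mathbb P_N)}^2=\tfrac1N\sum_i f(X_i)^2,$$ where $\mathfrak N(t,\Pi,\|\cdot\|)$ is the smallest size of a set $\mathcal C\subset\Pi$ such that every element of $\Pi$ is within distance $t$ of $\mathcal C$. \textbf{Claim.} There is a universal constant $\mathcal K\ge1$, and a constant $C$ that does not depend on $N,h,\delta,\eta,\Pi$, such that the following holds. \begin{enumerate} \item For all $\eta\ge0$, all $\Pi$ as above, all $N\ge1$, $h>0$, $\delta>0$ with $\kappa=\kappa_{N,h}<\infty$, with probability at least $1-\delta$, $$R_{\mathrm{DRO}}(\hat\pi^h_{\mathrm{DRO}})\le\frac{288L_K\kappa}{\sqrt N h^2\epsilon^2}+\frac{192M_K(\sqrt{\log\mathcal K}+2\sqrt2)}{\sqrt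 N h\epsilon^2}+\frac{4M_K\sqrt{2\log(2/\delta)}}{\sqrt N h\epsilon^2}+C h^2,$$ where $\sqrt{2\log(2/\delta)}$ is read as $0$ for $\delta>2$. \item If $h=h_N$ is of exact order $N^{-1/5}$ and $\kappa_{N,h_N}$ is bounded in $N$, then $R_{\mathrm{DRO}}(\hat\pi^{h_N}_{\mathrm{DRO}})\to0$ in probability as $N\to\infty$. \end{enumerate} -/

import Mathlib

open MeasureTheory ProbabilityTheory Filter Topology Set

noncomputable section

/-- The data of a potential-outcome model with a continuous treatment: a probability space
`(Ω, P0)`, covariates `X`, a treatment `A`, and a random element `U` that carries the whole random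
potential-outcome function `a ↦ Y(a) = outcome a U`.  The set of treatments is `actions`, outcomes
lie in `[0, M]`, `fA a x` is the conditional density `f₀(a | x)` and `fY y a x` is the conditional
density `f₀(y | a, x)`.  What these objects have to satisfy is in `CausalModel.Assumptions`. -/
structure CausalModel (Ω 𝒳 𝒰 : Type*) [MeasurableSpace Ω] [MeasurableSpace 𝒳]
    [MeasurableSpace 𝒰] where
  P0 : Measure Ω
  isProb : IsProbabilityMeasure P0
  X : Ω → 𝒳
  A : Ω → ℝ
  U : Ω → 𝒰
  outcome : ℝ → 𝒰 → ℝ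
  actions : Set ℝ
  M : ℝ
  fA : ℝ → 𝒳 → ℝ
  fY : ℝ → ℝ → 𝒳 → ℝ

attribute [instance] CausalModel.isProb

namespace CausalModel

variable {Ω 𝒳 𝒰 : Type*} [MeasurableSpace Ω] [MeasurableSpace 𝒳] [MeasurableSpace 𝒰]

/-- The potential outcome `Y(a)`. -/
def Ypot (m : CausalModel Ω 𝒳 𝒰) (a : ℝ) (ω : Ω) : ℝ := m.outcome a (m.U ω)

/-- The observed outcome; consistency: `Y = Y(a)` when `A = a`. -/
def Y (m : CausalModel Ω 𝒳 𝒰) (ω : Ω) : ℝ := m.Ypot (m.A ω) ω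

/-- The outcome `Y(π(X))` under the policy `π`. -/
def Ypolicy (m : CausalModel Ω 𝒳 𝒰) (π : 𝒳 → ℝ) (ω : Ω) : ℝ := m.Ypot (π (m.X ω)) ω

/-- The standing assumptions, with positivity constant `ε` and a bound `B` on the `a`-derivatives of
`f₀(y | a, x)`. -/
structure Assumptions [StandardBorelSpace Ω] [StandardBorelSpace 𝒰] [Nonempty 𝒰]
    (m : CausalModel Ω 𝒳 𝒰) (ε B : ℝ) : Prop where
  measurable_X : Measurable m.X
  measurable_A : Measurable m.A
  measurable_U : Measurable m.U
  measurable_outcome : Measurable (fun p : ℝ × 𝒰 => m.outcome p.1 p.2)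
  measurableSet_actions : MeasurableSet m.actions
  measurable_fA : Measurable (fun p : ℝ × 𝒳 => m.fA p.1 p.2)
  measurable_fY : Measurable (fun p : ℝ × ℝ × 𝒳 => m.fY p.1 p.2.1 p.2.2)
  /-- treatments lie in the treatment set -/
  A_mem : ∀ᵐ ω ∂m.P0, m.A ω ∈ m.actions
  /-- potential outcomes are bounded and nonnegative -/
  M_pos : 0 < m.M
  outcome_mem : ∀ a ∈ m.actions, ∀ u, m.outcome a u ∈ Icc 0 m.M
  /-- unconfoundedness: the potential-outcome function is independent of `A` given `X` -/
  unconfounded : CondIndepFun (MeasurableSpace.comap m.X inferInstance) measurable_X.comap_le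
    m.U m.A m.P0
  /-- `f₀(a | x)` is the conditional density of `A` given `X = x` -/
  fA_nonneg : ∀ a x, 0 ≤ m.fA a x
  fA_density : m.P0.map (fun ω => (m.X ω, m.A ω)) =
    ((m.P0.map m.X).prod volume).withDensity (fun p => ENNReal.ofReal (m.fA p.2 p.1))
  /-- positivity -/
  ε_pos : 0 < ε
  positivity : ∀ a ∈ m.actions, ∀ᵐ x ∂(m.P0.map m.X), ε ≤ m.fA a x
  /-- `f₀(y | a, x)`, `y ∈ [0, M]`, is the conditional density of `Y(a)` given `X = x` -/
  fY_nonneg : ∀ y a x, 0 ≤ m.fY y a x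
  fY_density : ∀ᵐ x ∂(m.P0.map m.X), ∀ a ∈ m.actions,
    (condDistrib m.U m.X m.P0 x).map (m.outcome a) =
      (volume.restrict (Icc 0 m.M)).withDensity (fun y => ENNReal.ofReal (m.fY y a x))
  /-- `f₀(y | a, x)` is three times differentiable in `a` ... -/
  fY_diff : ∀ᵐ x ∂(m.P0.map m.X), ∀ y ∈ Icc 0 m.M, ∀ k < 3,
    DifferentiableOn ℝ (iteratedDeriv k (fun a => m.fY y a x)) (interior m.actions)
  /-- ... with uniformly bounded derivatives of orders `0, 1, 2, 3` -/
  fY_bound : ∀ᵐ x ∂(m.P0.map m.X), ∀ y ∈ Icc 0 m.M, ∀ a ∈ interior m.actions, ∀ k ≤ 3,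
    |iteratedDeriv k (fun a => m.fY y a x) a| ≤ B

/-- `Q_DRO(π)`: the infimum of `E_P[Y(π(X))]` over all probability measures `P` with
`KL(P ‖ P0) ≤ η`. -/
def QDRO (m : CausalModel Ω 𝒳 𝒰) (η : ℝ) (π : 𝒳 → ℝ) : ℝ :=
  sInf ((fun P : Measure Ω => ∫ ω, m.Ypolicy π ω ∂P) ''
    {P | IsProbabilityMeasure P ∧ InformationTheory.klDiv P m.P0 ≤ ENNReal.ofReal η})

/-- The distributionally robust regret of `π` relative to the policy class `Pol`. -/
def regret (m : CausalModel Ω 𝒳 𝒰) (η : ℝ) (Pol : Set (𝒳 → ℝ)) (π : 𝒳 → ℝ) : ℝ :=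
  sSup (m.QDRO η '' Pol) - m.QDRO η π

/-- The law of an i.i.d. sample `(X_i, A_i, Y_i)`, `i < N`. -/
def sampleLaw (m : CausalModel Ω 𝒳 𝒰) (N : ℕ) : Measure (Fin N → 𝒳 × ℝ × ℝ) :=
  Measure.pi (fun _ => m.P0.map (fun ω => (m.X ω, m.A ω, m.Y ω)))

/-- The weight `K_h(π(x) - a) / f₀(a | x)` of an observation, where `K_h(u) = K(u / h) / h`. -/
def weight (m : CausalModel Ω 𝒳 𝒰) (K : ℝ → ℝ) (h : ℝ) (π : 𝒳 → ℝ) (z : 𝒳 × ℝ × ℝ) : ℝ :=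
  (1 / h * K ((π z.1 - z.2.1) / h)) / m.fA z.2.1 z.1

/-- The normalizing factor `S_N^h`. -/
def SN (m : CausalModel Ω 𝒳 𝒰) (K : ℝ → ℝ) (h : ℝ) {N : ℕ} (s : Fin N → 𝒳 × ℝ × ℝ)
    (π : 𝒳 → ℝ) : ℝ :=
  1 / (N : ℝ) * ∑ i, m.weight K h π (s i)

/-- The unnormalized estimator `W̄_N^h(π, α)`. -/
def Wbar (m : CausalModel Ω 𝒳 𝒰) (K : ℝ → ℝ) (h : ℝ) {N : ℕ} (s : Fin N → 𝒳 × ℝ × ℝ)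
    (π : 𝒳 → ℝ) (α : ℝ) : ℝ :=
  1 / (N : ℝ) * ∑ i, m.weight K h π (s i) * Real.exp (-(s i).2.2 / α)

/-- The normalized estimator `Ŵ_N^h(π, α)`. -/
def What (m : CausalModel Ω 𝒳 𝒰) (K : ℝ → ℝ) (h : ℝ) {N : ℕ} (s : Fin N → 𝒳 × ℝ × ℝ)
    (π : 𝒳 → ℝ) (α : ℝ) : ℝ :=
  m.Wbar K h s π α / m.SN K h s π

/-- The estimated robust value `Q̂_DRO^h(π)`.  The value of the objective at `α = 0` is its limit
as `α ↓ 0`, so the supremum over `α ≥ 0` is the supremum over `α > 0`. -/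
def Qhat (m : CausalModel Ω 𝒳 𝒰) (K : ℝ → ℝ) (h η : ℝ) {N : ℕ} (s : Fin N → 𝒳 × ℝ × ℝ)
    (π : 𝒳 → ℝ) : ℝ :=
  sSup ((fun α : ℝ => -α * Real.log (m.What K h s π α) - α * η) '' Ioi 0)

/-- `πhat` is a learned policy: for almost every sample it maximizes the estimated robust value
over the policy class. -/
def IsLearnedPolicy (m : CausalModel Ω 𝒳 𝒰) (K : ℝ → ℝ) (h η : ℝ) (Pol : Set (𝒳 → ℝ)) {N : ℕ}
    (πhat : (Fin N → 𝒳 × ℝ × ℝ) → 𝒳 → ℝ) : Prop :=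
  ∀ᵐ s ∂(m.sampleLaw N), πhat s ∈ Pol ∧ ∀ π ∈ Pol, m.Qhat K h η s π ≤ m.Qhat K h η s (πhat s)

end CausalModel

/-- A nonnegative second-order kernel, bounded by `MK` and Lipschitz with constant `LK`. -/
structure IsLipschitzKernel (K : ℝ → ℝ) (MK LK : ℝ) : Prop where
  nonneg : ∀ u, 0 ≤ K u
  bounded : ∀ u, |K u| ≤ MK
  symmetric : ∀ u, K (-u) = K u
  integrable : Integrable K
  integral_eq_one : ∫ u, K u = 1
  integral_mul_eq_zero : ∫ u, u * K u = 0
  integrable_sq_mul : Integrable (fun u => u ^ 2 * K u)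
  lipschitz_pos : 0 < LK
  lipschitz : ∀ u v, |K u - K v| ≤ LK * |u - v|

/-- The empirical `L²(P_N)` distance of two functions at the points `x_1, …, x_N`. -/
def empiricalL2 {𝒳 : Type*} {N : ℕ} (x : Fin N → 𝒳) (f g : 𝒳 → ℝ) : ℝ :=
  √(1 / (N : ℝ) * ∑ i, (f (x i) - g (x i)) ^ 2)

/-- The `t`-covering number of the class `F` in empirical `L²` (with the cover inside `F`);
it is `⊤` if there is no finite cover. -/
def coveringNumberL2 {𝒳 : Type*} {N : ℕ} (t : ℝ) (F : Set (𝒳 → ℝ)) (x : Fin N → 𝒳) : ℕ∞ :=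
  ⨅ (C : Finset (𝒳 → ℝ)) (_ : (C : Set (𝒳 → ℝ)) ⊆ F ∧ ∀ f ∈ F, ∃ g ∈ C, empiricalL2 x f g ≤ t),
    (C.card : ℕ∞)

/-- `√(log n)`, with value `∞` at `n = ∞`. -/
def sqrtLog (n : ℕ∞) : ENNReal :=
  if n = ⊤ then ⊤ else ENNReal.ofReal √(Real.log n.toNat)

/-- The expected entropy integral `E[∫_0^r √(log 𝔑(t, Pol(X_1, …, X_N), L²(P_N))) dt]`. -/
def CausalModel.entropyIntegral {Ω 𝒳 𝒰 : Type*} [MeasurableSpace Ω] [MeasurableSpace 𝒳]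
    [MeasurableSpace 𝒰] (m : CausalModel Ω 𝒳 𝒰) (Pol : Set (𝒳 → ℝ)) (N : ℕ) (r : ℝ) : ENNReal :=
  ∫⁻ s, (∫⁻ t in Ioc 0 r, sqrtLog (coveringNumberL2 t Pol (fun i => (s i).1))) ∂(m.sampleLaw N)

/-- The conditions on a policy class: measurable policies that stay at distance at least `ρ` from
the complement of the treatment set; a countable subclass that is dense under pointwise limits of
sequences (so that suprema over the class are measurable); and `Y(π(X))` has a density that is at
least `ε` on `[0, M]`, for every policy. -/
structure CausalModel.IsPolicyClass {Ω 𝒳 𝒰 : Type*} [MeasurableSpace Ω] [MeasurableSpace 𝒳]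
    [MeasurableSpace 𝒰] (m : CausalModel Ω 𝒳 𝒰) (ε ρ : ℝ) (Pol : Set (𝒳 → ℝ)) : Prop where
  measurable : ∀ π ∈ Pol, Measurable π
  margin : ∀ π ∈ Pol, ∀ x, Icc (π x - ρ) (π x + ρ) ⊆ m.actions
  separable : ∃ Pol₀ ⊆ Pol, Pol₀.Countable ∧ ∀ π ∈ Pol, ∃ u : ℕ → 𝒳 → ℝ,
    (∀ n, u n ∈ Pol₀) ∧ ∀ x, Tendsto (fun n => u n x) atTop (𝓝 (π x))
  density_ge : ∀ π ∈ Pol,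
    ENNReal.ofReal ε • volume.restrict (Icc 0 m.M) ≤ m.P0.map (m.Ypolicy π)

end

/-!
The regret of the learned policy is at most twice the uniform error of the estimated robust values,
`sup_π |Q̂(π) - Q(π)|`, so everything rests on controlling this error.

**Reduction to distribution functions.**  The weights `w_i(π)` make
`t ↦ 1 / N * ∑ i, w_i(π) * 1{Y_i ≤ t}` an estimate of the distribution function of `Y(π(X))`.
Suppose its error is at most `Δ` for all `t`.  Normalizing the weights costs a factor `2`
(`abs_weightedLaw_sub_le`).  Since the law of `Y(π(X))` has density at least `ε` on `[0, M]`, a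
distance `2 Δ` between distribution functions is a distance `d = 2 Δ / ε` between quantile functions
(`Iic_le_Iic_add_of_cdf_close`): each law stochastically dominates the other one shifted by `d`.
Hence the dual objectives `-α log E e^(-Y / α) - α η` of the two laws differ by at most `d`,
uniformly in `α > 0` (`neg_mul_log_le_of_Iic_le`).  The estimated value is the supremum of the
empirical dual objective, and `Q(π)` is the supremum of the population one: weak duality is the
Donsker-Varadhan inequality (`neg_mul_log_sub_le_integral`), and for `η > 0` the bound is attained
by the exponential tilt whose divergence is exactly `η`; it exists because the law of `Y(π(X))` has
a bounded density, so that the divergence of the tilts is unbounded (`exists_integral_le_dual`).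
So `|Q̂(π) - Q(π)| ≤ 2 Δ / ε` (`CausalModel.Assumptions.abs_Qhat_sub_QDRO_le`).

**Stochastic error.**  With high probability, the deviation of the weighted distribution function
from its mean, uniform over policies and thresholds, is at most its expectation plus a term from the
bounded differences inequality.  The expectation is bounded by symmetrization and chaining over
products of a cover of the policy class and a net of thresholds.  The weights are Lipschitz in the
policy, with constant `L_K / (h² ε)`, which produces the entropy integral of the class; thresholds
have covers of size `4 ^ k + 1` at relative scale `2 ^ (-k)` and contribute only a constant multiple
of the bound `M_K / (h ε)` on the weights (`radSup_le_entropy`,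
`measure_not_forall_cdfDeviation_le`).

**Bias.**  By unconfoundedness the mean of the weighted distribution function is the kernel
smoothing, in the treatment, of the conditional distribution function of `Y(a)`.  The kernel is
symmetric, so only symmetric second differences matter.  They are quadratic within the margin `ρ` by
the bound on the second derivative of the density, and beyond it the second moment of the kernel
takes over (`abs_kernel_smoothing_sub_le`).  The bias is therefore at most a multiple of `h²` that
depends neither on the policy nor on the threshold.

The constants leave enough room for `𝒦 = 1`, and for bandwidths of order `N ^ (-1 / 5)` all terms of
the bound tend to zero.
-/

/-! ### The bounded differences inequality -/

/-- Changing all coordinates one at a time moves a function with differences bounded by `c` by at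
most `N * c`. -/
lemma abs_sub_le_of_bounded_differences {Z : Type*} : ∀ {n : ℕ} {f : (Fin n → Z) → ℝ} {c : ℝ},
    (∀ s i z, |f (Function.update s i z) - f s| ≤ c) → ∀ s s', |f s - f s'| ≤ n * c := by
  intro n
  induction n with
  | zero => intro f c _ s s'; simp [Subsingleton.elim s s']
  | succ n ih =>
    intro f c hf s s'
    have h1 : |f (Fin.cons (s 0) (Fin.tail s)) - f (Fin.cons (s 0) (Fin.tail s'))| ≤ n * c := by
      refine ih (f := fun q => f (Fin.cons (s 0) q)) (fun q i z => ?_) _ _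
      have := hf (Fin.cons (s 0) q) i.succ z
      rwa [← Fin.cons_update] at this
    have h2 : |f (Fin.cons (s 0) (Fin.tail s')) - f s'| ≤ c := by
      have := hf s' 0 (s 0)
      rwa [← Fin.cons_self_tail s', Fin.update_cons_zero, Fin.cons_self_tail] at this
    rw [Fin.cons_self_tail] at h1
    calc |f s - f s'| ≤ _ + _ := abs_sub_le _ (f (Fin.cons (s 0) (Fin.tail s'))) _
      _ ≤ n * c + c := add_le_add h1 h2
      _ = (n + 1 : ℕ) * c := by push_cast; ring

lemma integrable_of_abs_sub_le {Ω : Type*} [MeasurableSpace Ω] {μ : Measure Ω}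
    [IsProbabilityMeasure μ] {f : Ω → ℝ} (hf : Measurable f) {c : ℝ}
    (h : ∀ s s', |f s - f s'| ≤ c) : Integrable f μ := by
  obtain ⟨s₀⟩ := nonempty_of_isProbabilityMeasure μ
  refine Integrable.of_mem_Icc (f s₀ - c) (f s₀ + c) hf.aemeasurable (ae_of_all _ fun s => ?_)
  have := abs_le.1 (h s s₀)
  constructor <;> linarith

/-- Moment generating function of a bounded function, from Hoeffding's lemma. -/
lemma integral_exp_le_of_abs_sub_le {Ω : Type*} [MeasurableSpace Ω] {μ : Measure Ω}
    [IsProbabilityMeasure μ] {f : Ω → ℝ} (hf : Measurable f) {c : ℝ}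
    (h : ∀ s s', |f s - f s'| ≤ c) (l : ℝ) :
    ∫ s, Real.exp (l * f s) ∂μ ≤ Real.exp (l * ∫ s, f s ∂μ + c ^ 2 * l ^ 2 / 2) := by
  obtain ⟨s₀⟩ := nonempty_of_isProbabilityMeasure μ
  have hc : 0 ≤ c := (abs_nonneg _).trans (h s₀ s₀)
  have hb : ∀ᵐ s ∂μ, f s ∈ Icc (f s₀ - c) (f s₀ + c) := ae_of_all _ fun s => by
    have := abs_le.1 (h s s₀)
    constructor <;> linarith
  have key := (hasSubgaussianMGF_of_mem_Icc hf.aemeasurable hb).mgf_le l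
  have e : ((((‖f s₀ + c - (f s₀ - c)‖₊ / 2) ^ 2 : NNReal)) : ℝ) = c ^ 2 := by
    push_cast
    rw [Real.norm_eq_abs, div_pow, sq_abs]; ring
  rw [e, mgf] at key
  have e2 : ∀ s, Real.exp (l * (f s - ∫ s, f s ∂μ))
      = Real.exp (-(l * ∫ s, f s ∂μ)) * Real.exp (l * f s) := fun s => by
    rw [← Real.exp_add]; ring_nf
  simp_rw [e2] at key
  rw [integral_const_mul, Real.exp_neg, inv_mul_le_iff₀ (Real.exp_pos _), ← Real.exp_add] at key
  exact key

lemma integrable_exp_of_abs_sub_le {Ω : Type*} [MeasurableSpace Ω] {μ : Measure Ω}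
    [IsProbabilityMeasure μ] {f : Ω → ℝ} (hf : Measurable f) {c : ℝ}
    (h : ∀ s s', |f s - f s'| ≤ c) (l : ℝ) : Integrable (fun s => Real.exp (l * f s)) μ := by
  obtain ⟨s₀⟩ := nonempty_of_isProbabilityMeasure μ
  refine integrable_exp_mul_of_mem_Icc (a := f s₀ - c) (b := f s₀ + c) hf.aemeasurable
    (ae_of_all _ fun s => ?_)
  have := abs_le.1 (h s s₀)
  constructor <;> linarith

/-- The moment generating function in the bounded differences inequality.  The coordinates are
integrated out one at a time, each costing a factor `exp (c ^ 2 * l ^ 2 / 2)`. -/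
lemma integral_exp_le_of_bounded_differences {Z : Type*} [MeasurableSpace Z] (μ : Measure Z)
    [IsProbabilityMeasure μ] {c : ℝ} (l : ℝ) : ∀ {n : ℕ} {f : (Fin n → Z) → ℝ}, Measurable f →
    (∀ s i z, |f (Function.update s i z) - f s| ≤ c) →
    ∫ s, Real.exp (l * f s) ∂(Measure.pi fun _ => μ) ≤
      Real.exp (l * ∫ s, f s ∂(Measure.pi fun _ => μ) + n * c ^ 2 * l ^ 2 / 2) := by
  intro n
  induction n with
  | zero =>
    intro f _ _
    have hc : ∀ s, f s = f Fin.elim0 := fun s => by rw [Subsingleton.elim s Fin.elim0]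
    simp [hc]
  | succ n ih =>
    intro f hf hd
    have mp := (measurePreserving_piFinSuccAbove (fun _ : Fin (n + 1) => μ) 0).symm
    have eqv : ∀ q : Z × (Fin n → Z),
        (MeasurableEquiv.piFinSuccAbove (fun _ : Fin (n + 1) => Z) 0).symm q
          = Fin.cons q.1 q.2 := fun q => by
      simp [MeasurableEquiv.piFinSuccAbove, Fin.insertNthEquiv]
    have mcons : Measurable fun q : Z × (Fin n → Z) => (Fin.cons q.1 q.2 : Fin (n + 1) → Z) := by
      have := (MeasurableEquiv.piFinSuccAbove (fun _ : Fin (n + 1) => Z) 0).symm.measurable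
      rwa [show ⇑(MeasurableEquiv.piFinSuccAbove (fun _ : Fin (n + 1) => Z) 0).symm = _ from
        funext eqv] at this
    set F : Z × (Fin n → Z) → ℝ := fun q => f (Fin.cons q.1 q.2) with hF
    have mF : Measurable F := hf.comp mcons
    have hosc := abs_sub_le_of_bounded_differences hd
    have hoscF : ∀ q q', |F q - F q'| ≤ (n + 1 : ℕ) * c := fun q q' => hosc _ _
    have hFint : Integrable F (μ.prod (Measure.pi fun _ => μ)) :=
      integrable_of_abs_sub_le mF hoscF
    have hFexp : Integrable (fun q => Real.exp (l * F q)) (μ.prod (Measure.pi fun _ => μ)) :=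
      integrable_exp_of_abs_sub_le mF hoscF l
    set g : (Fin n → Z) → ℝ := fun q => ∫ z, F (z, q) ∂μ with hg
    have mg : Measurable g := mF.stronglyMeasurable.integral_prod_left'.measurable
    have hz : ∀ q z z', |F (z, q) - F (z', q)| ≤ c := fun q z z' => by
      have := hd (Fin.cons z' q) 0 z
      rwa [Fin.update_cons_zero] at this
    have hslice : ∀ q, Integrable (fun z => F (z, q)) μ := fun q =>
      integrable_of_abs_sub_le (mF.comp measurable_prodMk_right) (hz q)
    have gd : ∀ s i z, |g (Function.update s i z) - g s| ≤ c := by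
      intro s i z
      rw [hg]
      simp only
      rw [← integral_sub (hslice _) (hslice _)]
      refine (abs_integral_le_integral_abs).trans ?_
      calc ∫ a, |F (a, Function.update s i z) - F (a, s)| ∂μ ≤ ∫ _, c ∂μ := by
            refine integral_mono ((hslice _).sub (hslice _)).abs (integrable_const _) fun a => ?_
            have := hd (Fin.cons a s) i.succ z
            rwa [← Fin.cons_update] at this
        _ = c := by simp
    have e1 : ∫ s, Real.exp (l * f s) ∂(Measure.pi fun _ : Fin (n + 1) => μ)
        = ∫ q, ∫ z, Real.exp (l * F (z, q)) ∂μ ∂(Measure.pi fun _ => μ) := by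
      rw [← mp.integral_comp' (fun s => Real.exp (l * f s))]
      simp_rw [eqv]
      exact integral_prod_symm _ hFexp
    have e2 : ∫ s, f s ∂(Measure.pi fun _ : Fin (n + 1) => μ)
        = ∫ q, g q ∂(Measure.pi fun _ => μ) := by
      rw [← mp.integral_comp' f]
      simp_rw [eqv]
      exact integral_prod_symm _ hFint
    rw [e1, e2]
    have hgexp : Integrable (fun q => Real.exp (l * g q)) (Measure.pi fun _ : Fin n => μ) :=
      integrable_exp_of_abs_sub_le mg (abs_sub_le_of_bounded_differences gd) l
    calc ∫ q, ∫ z, Real.exp (l * F (z, q)) ∂μ ∂(Measure.pi fun _ => μ)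
        ≤ ∫ q, Real.exp (l * g q) * Real.exp (c ^ 2 * l ^ 2 / 2) ∂(Measure.pi fun _ => μ) := by
          refine integral_mono hFexp.integral_prod_right (hgexp.mul_const _) fun q => ?_
          rw [← Real.exp_add]
          exact integral_exp_le_of_abs_sub_le (mF.comp measurable_prodMk_right) (hz q) l
      _ = (∫ q, Real.exp (l * g q) ∂(Measure.pi fun _ => μ)) * Real.exp (c ^ 2 * l ^ 2 / 2) :=
          integral_mul_const _ _
      _ ≤ _ := mul_le_mul_of_nonneg_right (ih mg gd) (Real.exp_nonneg _)
      _ = _ := by rw [← Real.exp_add]; push_cast; ring_nf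

/-- **Bounded differences inequality** (McDiarmid), with the exponent off by a factor `4` from the
optimal one. -/
theorem measureReal_ge_le_of_bounded_differences {Z : Type*} [MeasurableSpace Z] (μ : Measure Z)
    [IsProbabilityMeasure μ] {c : ℝ} {n : ℕ} {f : (Fin n → Z) → ℝ} (hf : Measurable f)
    (hd : ∀ s i z, |f (Function.update s i z) - f s| ≤ c) {t : ℝ} (ht : 0 ≤ t) :
    (Measure.pi fun _ => μ).real {s | (∫ s, f s ∂(Measure.pi fun _ => μ)) + t ≤ f s} ≤
      Real.exp (-t ^ 2 / (2 * (n * c ^ 2))) := by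
  set E := ∫ s, f s ∂(Measure.pi fun _ => μ) with hE
  have hsub : HasSubgaussianMGF (fun s => f s - E) ⟨n * c ^ 2, by positivity⟩
      (Measure.pi fun _ => μ) := by
    have e2 : ∀ l s, Real.exp (l * (f s - E)) = Real.exp (-(l * E)) * Real.exp (l * f s) :=
      fun l s => by rw [← Real.exp_add]; ring_nf
    constructor
    · intro l
      simp_rw [e2]
      exact (integrable_exp_of_abs_sub_le hf (abs_sub_le_of_bounded_differences hd) l).const_mul _
    · intro l
      rw [mgf]
      simp_rw [e2]
      rw [integral_const_mul, Real.exp_neg, inv_mul_le_iff₀ (Real.exp_pos _), ← Real.exp_add]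
      exact integral_exp_le_of_bounded_differences μ l hf hd
  have := hsub.measure_ge_le ht
  simp only [le_sub_iff_add_le'] at this
  exact this

/-! ### Rademacher averages and symmetrization -/

/-- The sign `1` or `-1` encoded by a Boolean. -/
noncomputable def signOf (b : Bool) : ℝ := if b then 1 else -1

/-- The (unnormalized) Rademacher average `E_σ sup_j |∑ i, σ i * v j i|` of a family of vectors;
the expectation over the random signs `σ` is a plain average over all sign patterns. -/
noncomputable def radSup {J : Type*} {N : ℕ} (v : J → Fin N → ℝ) : ℝ :=
  (∑ σ : Fin N → Bool, ⨆ j, |∑ i, signOf (σ i) * v j i|) / 2 ^ N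

lemma abs_signOf (b : Bool) : |signOf b| = 1 := by cases b <;> simp [signOf]

lemma le_iSup_of_finite {J : Type*} [Finite J] (f : J → ℝ) (j : J) : f j ≤ ⨆ j, f j :=
  le_ciSup (Set.finite_range f).bddAbove j

lemma signAverage_const {N : ℕ} (c : ℝ) : (∑ _σ : Fin N → Bool, c) / 2 ^ N = c := by
  simp

/-- The map that exchanges the coordinates `i` with `σ i = false` between a sample and an
independent copy of it preserves the joint law. -/
lemma measurePreserving_swap_coordinates {Z : Type*} [MeasurableSpace Z] (μ : Measure Z)
    [IsProbabilityMeasure μ] {N : ℕ} (σ : Fin N → Bool) :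
    MeasurePreserving (fun p : (Fin N → Z) × (Fin N → Z) =>
        ((fun i => if σ i then p.1 i else p.2 i, fun i => if σ i then p.2 i else p.1 i) :
          (Fin N → Z) × (Fin N → Z)))
      ((Measure.pi fun _ => μ).prod (Measure.pi fun _ => μ))
      ((Measure.pi fun _ => μ).prod (Measure.pi fun _ => μ)) := by
  have h1 := measurePreserving_arrowProdEquivProdArrow Z Z (Fin N) (fun _ => μ) (fun _ => μ)
  have h2 : MeasurePreserving (fun (a : Fin N → Z × Z) i => (if σ i then id else Prod.swap) (a i))
      (Measure.pi fun _ => μ.prod μ) (Measure.pi fun _ => μ.prod μ) := by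
    refine measurePreserving_pi _ _ (f := fun i => if σ i then id else Prod.swap) fun i => ?_
    cases σ i
    · exact Measure.measurePreserving_swap
    · exact MeasurePreserving.id _
  have h3 := (h1.comp h2).comp h1.symm
  convert h3 using 1
  funext p
  refine Prod.ext ?_ ?_ <;> funext i
  · change _ = ((if σ i then id else Prod.swap) ((p.1 i, p.2 i) : Z × Z)).1
    cases h : σ i <;> simp [h]
  · change _ = ((if σ i then id else Prod.swap) ((p.1 i, p.2 i) : Z × Z)).2
    cases h : σ i <;> simp [h]

/-- **Symmetrization**: the expected uniform deviation of empirical means over a finite family of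
bounded functions is at most twice the expected Rademacher average. -/
theorem integral_iSup_abs_le_radSup {Z : Type*} [MeasurableSpace Z] (μ : Measure Z)
    [IsProbabilityMeasure μ] {N : ℕ} (hN : 0 < N) {J : Type*} [Finite J] [Nonempty J]
    {g : J → Z → ℝ} (hg : ∀ j, Measurable (g j)) {b : ℝ} (hb : ∀ j z, |g j z| ≤ b) :
    ∫ s : Fin N → Z, (⨆ j, |1 / (N : ℝ) * ∑ i, g j (s i) - ∫ z, g j z ∂μ|)
        ∂(Measure.pi fun _ => μ) ≤
      2 / N * ∫ s : Fin N → Z, radSup (fun j i => g j (s i)) ∂(Measure.pi fun _ => μ) := by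
  set P : Measure (Fin N → Z) := Measure.pi fun _ => μ with hP
  have hN' : (0 : ℝ) < N := by exact_mod_cast hN
  have hmeas : ∀ j (i : Fin N), Measurable fun s : Fin N → Z => g j (s i) := fun j i =>
    (hg j).comp (measurable_pi_apply i)
  have hb0 : 0 ≤ b := by
    obtain ⟨z⟩ := nonempty_of_isProbabilityMeasure μ
    obtain ⟨j⟩ := ‹Nonempty J›
    exact (abs_nonneg _).trans (hb j z)
  have hmean : ∀ j, ∫ s, 1 / (N : ℝ) * ∑ i, g j (s i) ∂P = ∫ z, g j z ∂μ := by
    intro j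
    rw [integral_const_mul, integral_finsetSum]
    · have : ∀ i : Fin N, ∫ s, g j (s i) ∂P = ∫ z, g j z ∂μ := fun i =>
        integral_comp_eval (μ := fun _ : Fin N => μ) (i := i) (f := g j)
          (hg j).aestronglyMeasurable
      simp only [this, Finset.sum_const, Finset.card_univ, Fintype.card_fin, nsmul_eq_mul]
      field_simp
    · intro i _
      exact Integrable.of_bound (hmeas j i).aestronglyMeasurable b (ae_of_all _ fun s => hb _ _)
  -- a bound on signed sums, for the integrability of everything below
  have hsum : ∀ (ε : Fin N → ℝ), (∀ i, |ε i| ≤ 1) → ∀ j (s : Fin N → Z),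
      |∑ i, ε i * g j (s i)| ≤ N * b := by
    intro ε hε j s
    calc |∑ i, ε i * g j (s i)| ≤ ∑ i, |ε i * g j (s i)| := Finset.abs_sum_le_sum_abs _ _
      _ ≤ ∑ _i : Fin N, b := Finset.sum_le_sum fun i _ => by
          rw [abs_mul]
          exact (mul_le_of_le_one_left (abs_nonneg _) (hε i)).trans (hb _ _)
      _ = N * b := by simp
  have hσ1 : ∀ σ : Fin N → Bool, ∀ i, |signOf (σ i)| ≤ 1 := fun σ i => (abs_signOf _).le
  let R : (Fin N → Bool) → (Fin N → Z) → ℝ := fun σ s => ⨆ j, |∑ i, signOf (σ i) * g j (s i)|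
  let Ψ : (Fin N → Bool) → (Fin N → Z) × (Fin N → Z) → ℝ := fun σ p =>
    ⨆ j, |∑ i, signOf (σ i) * (g j (p.1 i) - g j (p.2 i))|
  have mR : ∀ σ, Measurable (R σ) := fun σ => Measurable.iSup fun j =>
    (Finset.measurable_sum _ fun i _ => (hmeas j i).const_mul _).abs
  have mΨ : ∀ σ, Measurable (Ψ σ) := fun σ => Measurable.iSup fun j =>
    (Finset.measurable_sum _ fun i _ => (((hmeas j i).comp measurable_fst).sub
      ((hmeas j i).comp measurable_snd)).const_mul _).abs
  have R0 : ∀ σ s, 0 ≤ R σ s := fun σ s => Real.iSup_nonneg fun j => abs_nonneg _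
  have Rb : ∀ σ s, R σ s ≤ N * b := fun σ s => ciSup_le fun j => hsum _ (hσ1 σ) j s
  have Ψ0 : ∀ σ s, 0 ≤ Ψ σ s := fun σ s => Real.iSup_nonneg fun j => abs_nonneg _
  have ΨR : ∀ σ p, Ψ σ p ≤ R σ p.1 + R σ p.2 := by
    intro σ p
    refine ciSup_le fun j => ?_
    simp_rw [mul_sub, Finset.sum_sub_distrib]
    exact (abs_sub _ _).trans (add_le_add
      (le_iSup_of_finite (fun j => |∑ i, signOf (σ i) * g j (p.1 i)|) j)
      (le_iSup_of_finite (fun j => |∑ i, signOf (σ i) * g j (p.2 i)|) j))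
  have iR : ∀ σ, Integrable (R σ) P := fun σ =>
    Integrable.of_bound (mR σ).aestronglyMeasurable (N * b) (ae_of_all _ fun s => by
      rw [Real.norm_eq_abs, abs_of_nonneg (R0 σ s)]; exact Rb σ s)
  have iΨ : ∀ σ, Integrable (Ψ σ) (P.prod P) := fun σ =>
    Integrable.of_bound (mΨ σ).aestronglyMeasurable (N * b + N * b) (ae_of_all _ fun s => by
      rw [Real.norm_eq_abs, abs_of_nonneg (Ψ0 σ s)]
      exact (ΨR σ s).trans (add_le_add (Rb _ _) (Rb _ _)))
  let one : Fin N → Bool := fun _ => true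
  have hstep1 : ∫ s, (⨆ j, |1 / (N : ℝ) * ∑ i, g j (s i) - ∫ z, g j z ∂μ|) ∂P
      ≤ 1 / N * ∫ p, Ψ one p ∂(P.prod P) := by
    rw [integral_prod _ (iΨ one), ← integral_const_mul]
    refine integral_mono_of_nonneg (ae_of_all _ fun s => Real.iSup_nonneg fun j => abs_nonneg _)
      ((iΨ one).integral_prod_left.const_mul _) ?_
    filter_upwards [(iΨ one).prod_right_ae] with s hs
    refine ciSup_le fun j => ?_
    rw [← hmean j]
    have i1 : Integrable (fun s' : Fin N → Z => 1 / (N : ℝ) * ∑ i, g j (s' i)) P :=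
      (integrable_finsetSum _ fun i _ => Integrable.of_bound (hmeas j i).aestronglyMeasurable b
        (ae_of_all _ fun s => hb _ _)).const_mul _
    have e : 1 / (N : ℝ) * ∑ i, g j (s i) - ∫ s', 1 / (N : ℝ) * ∑ i, g j (s' i) ∂P
        = ∫ s', (1 / (N : ℝ) * ∑ i, g j (s i) - 1 / (N : ℝ) * ∑ i, g j (s' i)) ∂P := by
      rw [integral_sub (integrable_const _) i1]; simp
    rw [e, ← integral_const_mul]
    refine abs_integral_le_integral_abs.trans ?_
    refine integral_mono_of_nonneg (ae_of_all _ fun _ => abs_nonneg _) (hs.const_mul _)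
      (ae_of_all _ fun s' => ?_)
    simp only
    rw [← mul_sub, ← Finset.sum_sub_distrib, abs_mul, abs_of_pos (by positivity : 0 < 1 / (N : ℝ))]
    refine mul_le_mul_of_nonneg_left ?_ (by positivity)
    have := le_iSup_of_finite
      (fun j => |∑ i, signOf (one i) * (g j (s i) - g j (s' i))|) j
    simpa [one, signOf, Ψ] using this
  have hstep2 : ∀ σ, ∫ p, Ψ one p ∂(P.prod P) ≤ 2 * ∫ s, R σ s ∂P := by
    intro σ
    have mp := measurePreserving_swap_coordinates μ σ
    have e : ∫ p, Ψ one p ∂(P.prod P) = ∫ p, Ψ σ p ∂(P.prod P) := by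
      have := integral_map (μ := P.prod P) (f := Ψ one) mp.measurable.aemeasurable
        (mΨ one).aestronglyMeasurable
      rw [mp.map_eq] at this
      rw [this]
      refine integral_congr_ae (ae_of_all _ fun p => ?_)
      refine iSup_congr fun j => ?_
      congr 1
      refine Finset.sum_congr rfl fun i _ => ?_
      cases h : σ i <;> simp [one, signOf, h]
    rw [e]
    calc ∫ p, Ψ σ p ∂(P.prod P) ≤ ∫ p, (R σ p.1 + R σ p.2) ∂(P.prod P) :=
          integral_mono (iΨ σ) ((iR σ).comp_fst P |>.add ((iR σ).comp_snd P)) (ΨR σ)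
      _ = 2 * ∫ s, R σ s ∂P := by
          rw [integral_add ((iR σ).comp_fst P) ((iR σ).comp_snd P), integral_fun_fst,
            integral_fun_snd]
          simp; ring
  have hR : ∫ s, radSup (fun j i => g j (s i)) ∂P = (∑ σ, ∫ s, R σ s ∂P) / 2 ^ N := by
    unfold radSup
    rw [integral_div, integral_finsetSum _ fun σ _ => iR σ]
  calc _ ≤ 1 / N * ∫ p, Ψ one p ∂(P.prod P) := hstep1
    _ = 1 / N * ((∑ _σ : Fin N → Bool, ∫ p, Ψ one p ∂(P.prod P)) / 2 ^ N) := by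
        rw [signAverage_const]
    _ ≤ 1 / N * ((∑ σ, 2 * ∫ s, R σ s ∂P) / 2 ^ N) := by
        gcongr with σ _
        exact hstep2 σ
    _ = _ := by rw [hR, ← Finset.mul_sum]; ring

/-! ### Chaining -/

/-- The moment generating function of a Rademacher sum. -/
lemma signAverage_exp_le {N : ℕ} (v : Fin N → ℝ) (l : ℝ) :
    (∑ σ : Fin N → Bool, Real.exp (l * ∑ i, signOf (σ i) * v i)) / 2 ^ N
      ≤ Real.exp (l ^ 2 * (∑ i, v i ^ 2) / 2) := by
  have e : ∑ σ : Fin N → Bool, Real.exp (l * ∑ i, signOf (σ i) * v i)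
      = ∏ i, (Real.exp (l * v i) + Real.exp (-(l * v i))) := by
    have := Fintype.prod_sum (fun (i : Fin N) (b : Bool) => Real.exp (l * (signOf b * v i)))
    simp only [Fintype.sum_bool, signOf] at this
    simp only [Finset.mul_sum, Real.exp_sum, signOf]
    rw [← this]
    refine Finset.prod_congr rfl fun i _ => ?_
    simp
  rw [e]
  have e2 : (2 : ℝ) ^ N = ∏ _i : Fin N, (2 : ℝ) := by simp
  rw [e2, ← Finset.prod_div_distrib]
  calc ∏ i, (Real.exp (l * v i) + Real.exp (-(l * v i))) / 2
      ≤ ∏ i, Real.exp ((l * v i) ^ 2 / 2) := by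
        refine Finset.prod_le_prod (fun i _ => by positivity) fun i _ => ?_
        rw [← Real.cosh_eq]
        exact Real.cosh_le_exp_half_sq _
    _ = Real.exp (l ^ 2 * (∑ i, v i ^ 2) / 2) := by
        rw [← Real.exp_sum]
        congr 1
        rw [Finset.mul_sum, Finset.sum_div]
        exact Finset.sum_congr rfl fun i _ => by ring

/-- **Massart's finite class lemma**. -/
lemma radSup_le_of_card_le {J : Type*} [Fintype J] [Nonempty J] {N : ℕ} (v : J → Fin N → ℝ)
    {m : ℝ} (hm : (Fintype.card J : ℝ) ≤ m) {d : ℝ} (hd : 0 < d)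
    (hv : ∀ j, ∑ i, v j i ^ 2 ≤ d ^ 2) :
    radSup v ≤ d * √(2 * Real.log (2 * m)) := by
  have hm1 : 1 ≤ m := le_trans (by exact_mod_cast Fintype.card_pos (α := J)) hm
  have hlog : 0 < Real.log (2 * m) := Real.log_pos (by linarith)
  set q := √(2 * Real.log (2 * m)) with hq
  have hq2 : q ^ 2 = 2 * Real.log (2 * m) := Real.sq_sqrt (by positivity)
  have hq0 : 0 < q := Real.sqrt_pos.2 (by positivity)
  set l := q / d with hl
  have hl0 : 0 < l := by positivity
  set A := 2 * m * Real.exp (l ^ 2 * d ^ 2 / 2) with hA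
  have hA0 : 0 < A := by positivity
  have hlogA : Real.log A = Real.log (2 * m) + l ^ 2 * d ^ 2 / 2 := by
    rw [hA, Real.log_mul (by positivity) (Real.exp_pos _).ne', Real.log_exp]
  -- `x ≤ (log A + exp (l * x) / A - 1) / l` replaces Jensen's inequality
  have hpt : ∀ σ : Fin N → Bool, ⨆ j, |∑ i, signOf (σ i) * v j i| ≤
      (Real.log A - 1 + (∑ j, (Real.exp (l * ∑ i, signOf (σ i) * v j i) +
        Real.exp (-l * ∑ i, signOf (σ i) * v j i))) / A) / l := by
    intro σ
    refine ciSup_le fun j => ?_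
    set x := ∑ i, signOf (σ i) * v j i
    have h1 : Real.exp (l * |x|) ≤ ∑ j, (Real.exp (l * ∑ i, signOf (σ i) * v j i) +
        Real.exp (-l * ∑ i, signOf (σ i) * v j i)) := by
      refine le_trans ?_ (Finset.single_le_sum (f := fun j =>
        (Real.exp (l * ∑ i, signOf (σ i) * v j i) + Real.exp (-l * ∑ i, signOf (σ i) * v j i)))
        (fun j _ => by positivity) (Finset.mem_univ j))
      rcases abs_choice x with h | h <;> rw [h]
      · exact le_add_of_nonneg_right (Real.exp_nonneg _)
      · rw [show l * -x = -l * x by ring]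
        exact le_add_of_nonneg_left (Real.exp_nonneg _)
    have h2 := Real.add_one_le_exp (l * |x| - Real.log A)
    rw [Real.exp_sub, Real.exp_log hA0] at h2
    rw [le_div_iff₀ hl0]
    have h3 := div_le_div_of_nonneg_right h1 hA0.le
    linarith
  have hsum : (∑ σ : Fin N → Bool, ∑ j, (Real.exp (l * ∑ i, signOf (σ i) * v j i) +
      Real.exp (-l * ∑ i, signOf (σ i) * v j i))) / 2 ^ N ≤ A := by
    rw [Finset.sum_comm, Finset.sum_div]
    calc ∑ j, (∑ σ : Fin N → Bool, (Real.exp (l * ∑ i, signOf (σ i) * v j i) +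
          Real.exp (-l * ∑ i, signOf (σ i) * v j i))) / 2 ^ N
        ≤ ∑ _j : J, 2 * Real.exp (l ^ 2 * d ^ 2 / 2) := by
          refine Finset.sum_le_sum fun j _ => ?_
          rw [Finset.sum_add_distrib, add_div, two_mul]
          have hle : Real.exp (l ^ 2 * (∑ i, v j i ^ 2) / 2) ≤ Real.exp (l ^ 2 * d ^ 2 / 2) := by
            gcongr; exact hv j
          refine add_le_add ((signAverage_exp_le (v j) l).trans hle)
            ((signAverage_exp_le (v j) (-l)).trans ?_)
          rwa [neg_sq]
      _ = Fintype.card J * (2 * Real.exp (l ^ 2 * d ^ 2 / 2)) := by simp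
      _ ≤ m * (2 * Real.exp (l ^ 2 * d ^ 2 / 2)) := by gcongr
      _ = A := by rw [hA]; ring
  calc radSup v ≤ (∑ σ : Fin N → Bool, (Real.log A - 1 +
        (∑ j, (Real.exp (l * ∑ i, signOf (σ i) * v j i) +
        Real.exp (-l * ∑ i, signOf (σ i) * v j i))) / A) / l) / 2 ^ N := by
        unfold radSup
        gcongr with σ _
        exact hpt σ
    _ = (Real.log A - 1 + ((∑ σ : Fin N → Bool,
        ∑ j, (Real.exp (l * ∑ i, signOf (σ i) * v j i) +
        Real.exp (-l * ∑ i, signOf (σ i) * v j i))) / 2 ^ N) / A) / l := by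
        rw [← Finset.sum_div, Finset.sum_add_distrib, ← Finset.sum_div, div_right_comm, add_div,
          signAverage_const]
        ring
    _ ≤ (Real.log A - 1 + A / A) / l := by gcongr
    _ = d * q := by
        rw [div_self hA0.ne', hlogA, hl]
        have : Real.log (2 * m) = q ^ 2 / 2 := by linarith
        rw [this]
        field_simp
        ring

/-- One link of a chain: pass from a finite family to a `d`-net of it. -/
lemma radSup_le_add_of_net {J J' : Type*} [Fintype J] [Nonempty J] [Finite J'] {N : ℕ}
    {v : J → Fin N → ℝ} {v' : J' → Fin N → ℝ} {m : ℝ} (hm : (Fintype.card J : ℝ) ≤ m) {d : ℝ}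
    (hd : 0 < d) (h : ∀ j, ∃ j', ∑ i, (v j i - v' j' i) ^ 2 ≤ d ^ 2) :
    radSup v ≤ radSup v' + d * √(2 * Real.log (2 * m)) := by
  choose φ hφ using h
  refine le_trans ?_ (add_le_add_right
    (radSup_le_of_card_le (fun j i => v j i - v' (φ j) i) hm hd hφ) _)
  unfold radSup
  rw [← add_div, ← Finset.sum_add_distrib]
  gcongr with σ _
  refine ciSup_le fun j => ?_
  have h1 := le_iSup_of_finite (fun j' => |∑ i, signOf (σ i) * v' j' i|) (φ j)
  have h2 := le_iSup_of_finite (fun j => |∑ i, signOf (σ i) * (v j i - v' (φ j) i)|) j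
  have e : ∑ i, signOf (σ i) * v j i = ∑ i, signOf (σ i) * v' (φ j) i +
      ∑ i, signOf (σ i) * (v j i - v' (φ j) i) := by
    rw [← Finset.sum_add_distrib]
    exact Finset.sum_congr rfl fun i _ => by ring
  rw [e]
  exact (abs_add_le _ _).trans (add_le_add h1 h2)

/-- The end of a chain, where the distance to the net is handled by Cauchy-Schwarz. -/
lemma radSup_le_add_sqrt_mul {J J' : Type*} [Nonempty J] [Finite J'] {N : ℕ}
    {v : J → Fin N → ℝ} {v' : J' → Fin N → ℝ} {d : ℝ} (hd : 0 ≤ d)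
    (h : ∀ j, ∃ j', ∑ i, (v j i - v' j' i) ^ 2 ≤ d ^ 2) :
    radSup v ≤ radSup v' + √N * d := by
  choose φ hφ using h
  unfold radSup
  rw [← signAverage_const (N := N) (√N * d), ← add_div, ← Finset.sum_add_distrib]
  gcongr with σ _
  refine ciSup_le fun j => ?_
  have h1 := le_iSup_of_finite (fun j' => |∑ i, signOf (σ i) * v' j' i|) (φ j)
  have e : ∑ i, signOf (σ i) * v j i = ∑ i, signOf (σ i) * v' (φ j) i +
      ∑ i, signOf (σ i) * (v j i - v' (φ j) i) := by
    rw [← Finset.sum_add_distrib]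
    exact Finset.sum_congr rfl fun i _ => by ring
  rw [e]
  refine (abs_add_le _ _).trans (add_le_add h1 ?_)
  refine abs_le_of_sq_le_sq ?_ (by positivity)
  refine (Finset.sum_mul_sq_le_sq_mul_sq _ _ _).trans ?_
  rw [mul_pow, Real.sq_sqrt (Nat.cast_nonneg N)]
  have : ∑ i, signOf (σ i) ^ 2 = (N : ℝ) := by
    simp [← sq_abs (signOf _), abs_signOf]
  rw [this]
  exact mul_le_mul_of_nonneg_left (hφ j) (Nat.cast_nonneg N)

/-- The indicator of `y ≤ t`. -/
noncomputable def indLE (t y : ℝ) : ℝ := if y ≤ t then 1 else 0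

lemma indLE_nonneg (t y : ℝ) : 0 ≤ indLE t y := by unfold indLE; split_ifs <;> simp

lemma indLE_le_one (t y : ℝ) : indLE t y ≤ 1 := by unfold indLE; split_ifs <;> simp

/-- Half-lines have small covers in empirical `L²`: thresholds that cut off about the same number
of the `N` points are identified. -/
lemma exists_threshold_net {N : ℕ} (hN : 0 < N) (y : Fin N → ℝ) {m : ℕ} (hm : 0 < m) :
    ∃ T : Finset ℝ, T.card ≤ m + 1 ∧
      ∀ t, ∃ t' ∈ T, ∑ i, (indLE t (y i) - indLE t' (y i)) ^ 2 ≤ (N : ℝ) / m := by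
  classical
  have hN' : (0 : ℝ) < N := by exact_mod_cast hN
  have hm' : (0 : ℝ) < m := by exact_mod_cast hm
  set c : ℝ → ℝ := fun t => ∑ i, indLE t (y i) with hc
  have cmono : Monotone c := fun t t' htt => Finset.sum_le_sum fun i _ => by
    unfold indLE
    split_ifs <;> linarith
  have c0 : ∀ t, 0 ≤ c t := fun t => Finset.sum_nonneg fun i _ => indLE_nonneg _ _
  have cN : ∀ t, c t ≤ N := fun t => by
    calc c t ≤ ∑ _i : Fin N, (1 : ℝ) := Finset.sum_le_sum fun i _ => indLE_le_one _ _
      _ = N := by simp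
  -- the class of a threshold
  set k : ℝ → ℕ := fun t => ⌊m * c t / N⌋₊ with hk
  have hkm : ∀ t, k t ≤ m := fun t => by
    refine Nat.floor_le_of_le ?_
    rw [div_le_iff₀ hN']
    exact mul_le_mul_of_nonneg_left (cN t) hm'.le
  refine ⟨(Finset.range (m + 1)).image (Function.invFun k), ?_, fun t => ?_⟩
  · exact Finset.card_image_le.trans (by simp)
  refine ⟨Function.invFun k (k t), Finset.mem_image_of_mem _
    (Finset.mem_range.2 (Nat.lt_succ_of_le (hkm t))), ?_⟩
  have hkt : k (Function.invFun k (k t)) = k t := Function.invFun_eq ⟨t, rfl⟩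
  set t' := Function.invFun k (k t)
  have sq : ∀ {a a' : ℝ}, a ≤ a' → ∑ i, (indLE a' (y i) - indLE a (y i)) ^ 2 = c a' - c a := by
    intro a a' h
    rw [hc, ← Finset.sum_sub_distrib]
    refine Finset.sum_congr rfl fun i _ => ?_
    unfold indLE
    split_ifs <;> linarith
  have close : ∀ a a', k a = k a' → c a' - c a ≤ N / m := by
    intro a a' h
    have h1 : m * c a' / N < k a' + 1 := Nat.lt_floor_add_one _
    have h2 : (k a : ℝ) ≤ m * c a / N := Nat.floor_le (by have := c0 a; positivity)
    have h3 : (k a : ℝ) = k a' := by exact_mod_cast h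
    have h4 : m * (c a' - c a) / N < 1 := by
      rw [mul_sub, sub_div]; linarith
    rw [div_lt_one hN'] at h4
    rw [le_div_iff₀ hm']
    linarith
  rcases le_total t' t with h | h
  · rw [sq h]; exact close _ _ hkt
  · simp_rw [← neg_sub (indLE t' _) (indLE t _), neg_sq]
    rw [sq h]; exact close _ _ hkt.symm

lemma sum_add_sq_le {ι : Type*} [Fintype ι] {u v : ι → ℝ} {a b : ℝ} (ha : 0 ≤ a) (hb : 0 ≤ b)
    (hu : ∑ i, u i ^ 2 ≤ a ^ 2) (hv : ∑ i, v i ^ 2 ≤ b ^ 2) :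
    ∑ i, (u i + v i) ^ 2 ≤ (a + b) ^ 2 := by
  have h1 : ∑ i, u i * v i ≤ a * b := by
    refine le_of_sq_le_sq ?_ (by positivity)
    refine (Finset.sum_mul_sq_le_sq_mul_sq _ _ _).trans ?_
    rw [mul_pow]
    exact mul_le_mul hu hv (Finset.sum_nonneg fun i _ => sq_nonneg _) (sq_nonneg _)
  have e : ∑ i, (u i + v i) ^ 2 = ∑ i, u i ^ 2 + 2 * ∑ i, u i * v i + ∑ i, v i ^ 2 := by
    rw [Finset.mul_sum, ← Finset.sum_add_distrib, ← Finset.sum_add_distrib]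
    exact Finset.sum_congr rfl fun i _ => by ring
  rw [e]; nlinarith

/-! ### The entropy integral -/

lemma sqrtLog_mono : Monotone sqrtLog := by
  intro m n h
  unfold sqrtLog
  split_ifs with h1 h2 h2
  · exact le_rfl
  · exact absurd (top_le_iff.1 (h1 ▸ h)) h2
  · exact le_top
  · have h3 : m.toNat ≤ n.toNat := ENat.toNat_le_toNat h h2
    refine ENNReal.ofReal_le_ofReal (Real.sqrt_le_sqrt ?_)
    rcases Nat.eq_zero_or_pos m.toNat with h0 | h0
    · rw [h0]; simpa using Real.log_natCast_nonneg _
    · exact Real.log_le_log (by exact_mod_cast h0) (by exact_mod_cast h3)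

lemma coveringNumberL2_anti {𝒳 : Type*} {N : ℕ} (F : Set (𝒳 → ℝ)) (x : Fin N → 𝒳) :
    Antitone fun t => coveringNumberL2 t F x := by
  intro t t' h
  unfold coveringNumberL2
  refine iInf_mono fun C => ?_
  refine iInf_mono' fun hC => ⟨⟨hC.1, fun f hf => ?_⟩, le_rfl⟩
  obtain ⟨g, hg, hd⟩ := hC.2 f hf
  exact ⟨g, hg, hd.trans h⟩

lemma exists_cover_of_ne_top {𝒳 : Type*} {N : ℕ} {t : ℝ} {F : Set (𝒳 → ℝ)} {x : Fin N → 𝒳}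
    (h : coveringNumberL2 t F x ≠ ⊤) :
    ∃ C : Finset (𝒳 → ℝ), (C : Set (𝒳 → ℝ)) ⊆ F ∧ (∀ f ∈ F, ∃ g ∈ C, empiricalL2 x f g ≤ t) ∧
      (C.card : ℕ∞) ≤ coveringNumberL2 t F x := by
  have h1 : coveringNumberL2 t F x < coveringNumberL2 t F x + 1 :=
    (ENat.lt_add_one_iff h).2 le_rfl
  unfold coveringNumberL2 at h1
  simp only [iInf_lt_iff] at h1
  obtain ⟨C, hC, hlt⟩ := h1
  exact ⟨C, hC.1, hC.2, (ENat.lt_add_one_iff h).1 hlt⟩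

/-- A finite entropy integral forces finite covering numbers, by monotonicity. -/
lemma coveringNumberL2_ne_top {𝒳 : Type*} {N : ℕ} {F : Set (𝒳 → ℝ)} {x : Fin N → 𝒳} {r t : ℝ}
    (hI : ∫⁻ t in Ioc 0 r, sqrtLog (coveringNumberL2 t F x) ≠ ⊤) (ht : 0 < t) (htr : t ≤ r) :
    coveringNumberL2 t F x ≠ ⊤ := by
  intro htop
  apply hI
  rw [eq_top_iff]
  calc (⊤ : ENNReal) = ∫⁻ _ in Ioc 0 t, ⊤ := by
        simp [ENNReal.top_mul, ht]
    _ ≤ ∫⁻ s in Ioc 0 t, sqrtLog (coveringNumberL2 s F x) := by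
        refine setLIntegral_mono' measurableSet_Ioc fun s hs => ?_
        have := coveringNumberL2_anti F x hs.2
        simp only [htop, top_le_iff] at this
        simp [sqrtLog, this]
    _ ≤ _ := lintegral_mono_set (Ioc_subset_Ioc_right htr)

/-- Dyadic sums of `√(log covering number)` are bounded by the entropy integral. -/
lemma sum_dyadic_le_entropy {𝒳 : Type*} {N : ℕ} {F : Set (𝒳 → ℝ)} {x : Fin N → 𝒳} {r : ℝ}
    (hr : 0 < r) (n : ℕ) :
    ∑ k ∈ Finset.range n, ENNReal.ofReal (r / 2 ^ (k + 2)) *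
        sqrtLog (coveringNumberL2 (r / 2 ^ (k + 1)) F x)
      ≤ ∫⁻ t in Ioc 0 r, sqrtLog (coveringNumberL2 t F x) := by
  have hpos : ∀ k : ℕ, 0 < r / 2 ^ k := fun k => by positivity
  have hle : ∀ k : ℕ, r / 2 ^ (k + 1) ≤ r / 2 ^ k := fun k =>
    div_le_div_of_nonneg_left hr.le (by positivity) (pow_le_pow_right₀ (by norm_num) (Nat.le_succ k))
  have key : ∀ n : ℕ, ∑ k ∈ Finset.range n, ENNReal.ofReal (r / 2 ^ (k + 2)) *
        sqrtLog (coveringNumberL2 (r / 2 ^ (k + 1)) F x)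
      ≤ ∫⁻ t in Ioc (r / 2 ^ (n + 1)) r, sqrtLog (coveringNumberL2 t F x) := by
    intro n
    induction n with
    | zero => simp
    | succ n ih =>
      have h1 : r / 2 ^ (n + 1) ≤ r := div_le_self hr.le (one_le_pow₀ (by norm_num))
      rw [Finset.sum_range_succ, ← Ioc_union_Ioc_eq_Ioc (hle (n + 1)) h1,
        lintegral_union measurableSet_Ioc
          (Ioc_disjoint_Ioc_of_le le_rfl), add_comm]
      refine add_le_add ?_ ih
      calc ENNReal.ofReal (r / 2 ^ (n + 2)) * sqrtLog (coveringNumberL2 (r / 2 ^ (n + 1)) F x)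
          = ∫⁻ _ in Ioc (r / 2 ^ (n + 1 + 1)) (r / 2 ^ (n + 1)),
              sqrtLog (coveringNumberL2 (r / 2 ^ (n + 1)) F x) := by
            rw [setLIntegral_const, Real.volume_Ioc, mul_comm]
            congr 2
            field_simp
            ring
        _ ≤ _ := setLIntegral_mono' measurableSet_Ioc fun s hs =>
            sqrtLog_mono (coveringNumberL2_anti F x hs.2)
  exact (key n).trans (lintegral_mono_set (Ioc_subset_Ioc_left (hpos _).le))

lemma sum_succ_div_two_pow_le (n : ℕ) :
    ∑ k ∈ Finset.range n, ((k : ℝ) + 2) / 2 ^ (k + 1) ≤ 3 := by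
  have : ∑ k ∈ Finset.range n, ((k : ℝ) + 2) / 2 ^ (k + 1) = 3 - (n + 3) / 2 ^ n := by
    induction n with
    | zero => simp
    | succ n ih =>
      rw [Finset.sum_range_succ, ih, pow_succ]
      push_cast
      field_simp
      ring
  rw [this]
  have : (0 : ℝ) ≤ (n + 3) / 2 ^ n := by positivity
  linarith

/-- The contribution of the thresholds to the entropy of a product cover. -/
lemma sqrt_log_product_le {c : ℝ} (hc : 1 ≤ c) (k : ℕ) :
    √(2 * Real.log (2 * (c * (4 ^ (k + 1) + 1)))) ≤ √2 * √(Real.log c) + 1.7 * (k + 2) := by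
  have h4 : (1 : ℝ) ≤ 4 ^ (k + 1) := one_le_pow₀ (by norm_num)
  have hlogc : 0 ≤ Real.log c := Real.log_nonneg hc
  have h1 : Real.log (2 * (c * (4 ^ (k + 1) + 1))) ≤ Real.log c + (k + 2) * (2 * Real.log 2) := by
    have : Real.log c + (k + 2) * (2 * Real.log 2) = Real.log (c * 4 ^ (k + 2)) := by
      rw [Real.log_mul (by positivity) (by positivity), Real.log_pow,
        show (4 : ℝ) = 2 ^ 2 by norm_num, Real.log_pow]
      push_cast; ring
    rw [this]
    refine Real.log_le_log (by positivity) ?_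
    rw [pow_succ _ (k + 1)]
    nlinarith
  have hlog2 := Real.log_two_lt_d9
  refine Real.sqrt_le_iff.2 ⟨by positivity, ?_⟩
  have s1 : √2 ^ 2 = 2 := Real.sq_sqrt (by norm_num)
  have s2 : √(Real.log c) ^ 2 = Real.log c := Real.sq_sqrt hlogc
  have e : (√2 * √(Real.log c) + 1.7 * ((k : ℝ) + 2)) ^ 2
      = 2 * Real.log c + 2 * (√2 * √(Real.log c)) * (1.7 * (k + 2)) + 2.89 * (k + 2) ^ 2 := by
    rw [add_sq, mul_pow, s1, s2]; ring
  rw [e]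
  have h2 : 0 ≤ 2 * (√2 * √(Real.log c)) * (1.7 * ((k : ℝ) + 2)) := by positivity
  have hk : (0 : ℝ) ≤ k := Nat.cast_nonneg k
  nlinarith

/-- **Dudley's entropy bound** for the vectors `i ↦ W f i * 1{y i ≤ t}`, where the weights `W f`
are `[0, b]`-valued and Lipschitz in `f`.  Chaining goes over products of a cover of `F` at scale
`2 b / (L 2 ^ k)` and of a net of thresholds at scale `2 ^ (-k)`; the thresholds contribute only a
multiple of `b`. -/
theorem radSup_le_entropy {𝒳 : Type*} {N : ℕ} (hN : 0 < N) {F : Set (𝒳 → ℝ)} {x : Fin N → 𝒳}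
    (y : Fin N → ℝ) {W : (𝒳 → ℝ) → Fin N → ℝ} {b L : ℝ} (hb : 0 < b) (hL : 0 < L)
    (hW0 : ∀ f ∈ F, ∀ i, 0 ≤ W f i) (hWb : ∀ f ∈ F, ∀ i, W f i ≤ b)
    (hWL : ∀ f ∈ F, ∀ g ∈ F, ∀ i, |W f i - W g i| ≤ L * |f (x i) - g (x i)|)
    (hI : ∫⁻ t in Ioc 0 (2 * b / L), sqrtLog (coveringNumberL2 t F x) ≠ ⊤)
    {J : Type*} [Finite J] [Nonempty J] (φ : J → 𝒳 → ℝ) (hφ : ∀ j, φ j ∈ F) (τ : J → ℝ) :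
    radSup (fun j i => W (φ j) i * indLE (τ j) (y i)) ≤
      √N * (9 * L * (∫⁻ t in Ioc 0 (2 * b / L), sqrtLog (coveringNumberL2 t F x)).toReal
        + 31 * b) := by
  classical
  set I := ∫⁻ t in Ioc 0 (2 * b / L), sqrtLog (coveringNumberL2 t F x) with hIdef
  have hN' : (0 : ℝ) < N := by exact_mod_cast hN
  have hsN : 0 < √(N : ℝ) := Real.sqrt_pos.2 hN'
  have hsN2 : √(N : ℝ) ^ 2 = N := Real.sq_sqrt hN'.le
  set r := 2 * b / L with hr
  have hr0 : 0 < r := by positivity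
  have hfin : ∀ k : ℕ, coveringNumberL2 (r / 2 ^ k) F x ≠ ⊤ := fun k =>
    coveringNumberL2_ne_top hI (by positivity) (div_le_self hr0.le (one_le_pow₀ (by norm_num)))
  choose C hCF hC hCcard using fun k => exists_cover_of_ne_top (hfin k)
  choose T hTcard hT using fun k : ℕ => exists_threshold_net hN y (m := 4 ^ k) (by positivity)
  obtain ⟨j₀⟩ := ‹Nonempty J›
  have hCne : ∀ k, Nonempty (C k) := fun k => by
    obtain ⟨g, hg, _⟩ := hC k (φ j₀) (hφ j₀); exact ⟨g, hg⟩
  have hTne : ∀ k, Nonempty (T k) := fun k => by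
    obtain ⟨g, hg, _⟩ := hT k 0; exact ⟨g, hg⟩
  -- approximation of an arbitrary vector of the class at level `k`
  have approx : ∀ k : ℕ, ∀ f ∈ F, ∀ t, ∃ q : C k × T k,
      ∑ i, (W f i * indLE t (y i) - W q.1 i * indLE q.2 (y i)) ^ 2 ≤ (√N * (3 * b / 2 ^ k)) ^ 2 := by
    intro k f hf t
    obtain ⟨g, hg, hd⟩ := hC k f hf
    obtain ⟨t', ht', hd'⟩ := hT k t
    refine ⟨(⟨g, hg⟩, ⟨t', ht'⟩), ?_⟩
    have hgF : g ∈ F := hCF k hg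
    have h1 : ∑ i, ((W f i - W g i) * indLE t (y i)) ^ 2 ≤ (√N * (2 * b / 2 ^ k)) ^ 2 := by
      have hd2 : ∑ i, (f (x i) - g (x i)) ^ 2 ≤ N * (r / 2 ^ k) ^ 2 := by
        unfold empiricalL2 at hd
        rw [Real.sqrt_le_iff] at hd
        have := hd.2
        rwa [one_div, inv_mul_le_iff₀ hN'] at this
      calc ∑ i, ((W f i - W g i) * indLE t (y i)) ^ 2
          ≤ ∑ i, L ^ 2 * (f (x i) - g (x i)) ^ 2 := by
            refine Finset.sum_le_sum fun i _ => ?_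
            rw [← mul_pow]
            refine sq_le_sq.2 ?_
            rw [abs_mul, abs_mul, abs_of_pos hL, abs_of_nonneg (indLE_nonneg _ _)]
            exact (mul_le_of_le_one_right (abs_nonneg _) (indLE_le_one _ _)).trans (hWL f hf g hgF i)
        _ = L ^ 2 * ∑ i, (f (x i) - g (x i)) ^ 2 := by rw [Finset.mul_sum]
        _ ≤ L ^ 2 * (N * (r / 2 ^ k) ^ 2) := by gcongr
        _ = (√N * (2 * b / 2 ^ k)) ^ 2 := by
            rw [mul_pow (√(N : ℝ)), hsN2, hr]; field_simp
    have h2 : ∑ i, (W g i * (indLE t (y i) - indLE t' (y i))) ^ 2 ≤ (√N * (b / 2 ^ k)) ^ 2 := by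
      calc ∑ i, (W g i * (indLE t (y i) - indLE t' (y i))) ^ 2
          ≤ ∑ i, b ^ 2 * (indLE t (y i) - indLE t' (y i)) ^ 2 := by
            refine Finset.sum_le_sum fun i _ => ?_
            rw [mul_pow]
            gcongr
            · exact hW0 g hgF i
            · exact hWb g hgF i
        _ = b ^ 2 * ∑ i, (indLE t (y i) - indLE t' (y i)) ^ 2 := by rw [Finset.mul_sum]
        _ ≤ b ^ 2 * (N / (4 ^ k : ℕ)) := by gcongr
        _ = (√N * (b / 2 ^ k)) ^ 2 := by
            rw [mul_pow, hsN2, div_pow, ← pow_mul, mul_comm k 2, pow_mul]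
            push_cast
            norm_num
            ring
    have h3 := sum_add_sq_le (by positivity) (by positivity) h1 h2
    have e : √(N : ℝ) * (2 * b / 2 ^ k) + √N * (b / 2 ^ k) = √N * (3 * b / 2 ^ k) := by ring
    rw [e] at h3
    refine le_trans (le_of_eq ?_) h3
    exact Finset.sum_congr rfl fun i _ => by ring
  let V : (k : ℕ) → C k × T k → Fin N → ℝ := fun k q i => W q.1 i * indLE q.2 (y i)
  have hcardV : ∀ k, (Fintype.card (C k × T k) : ℝ) ≤ (C k).card * (4 ^ k + 1) := by
    intro k
    rw [Fintype.card_prod, Fintype.card_coe, Fintype.card_coe]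
    push_cast
    gcongr
    exact_mod_cast hTcard k
  have hC1 : ∀ k, (1 : ℝ) ≤ (C k).card := fun k => by
    have := Fintype.card_pos (α := C k)
    rw [Fintype.card_coe] at this
    exact_mod_cast this
  -- the chain, down to the zero vector
  have chain : ∀ n : ℕ, radSup (V (n + 1)) ≤ ∑ k ∈ Finset.range (n + 1), √N * (3 * b / 2 ^ k) *
      √(2 * Real.log (2 * ((C (k + 1)).card * (4 ^ (k + 1) + 1)))) := by
    intro n
    induction n with
    | zero =>
      have h0 := radSup_le_add_of_net (v := V 1) (v' := fun (_ : Unit) (_ : Fin N) => (0 : ℝ))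
        (hcardV 1) (d := √N * (3 * b)) (by positivity) (fun q => ⟨(), by
          have hq : (q.1 : 𝒳 → ℝ) ∈ F := hCF _ q.1.2
          calc ∑ i, (V 1 q i - 0) ^ 2 ≤ ∑ _i : Fin N, b ^ 2 := by
                refine Finset.sum_le_sum fun i _ => ?_
                rw [sub_zero]
                refine pow_le_pow_left₀ (mul_nonneg (hW0 _ hq i) (indLE_nonneg _ _)) ?_ 2
                exact (mul_le_of_le_one_right (hW0 _ hq i) (indLE_le_one _ _)).trans (hWb _ hq i)
            _ = N * b ^ 2 := by simp
            _ ≤ (√N * (3 * b)) ^ 2 := by rw [mul_pow, hsN2]; nlinarith [sq_nonneg b]⟩)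
      have z : radSup (fun (_ : Unit) (_ : Fin N) => (0 : ℝ)) = 0 := by simp [radSup]
      rw [z] at h0
      simpa using h0
    | succ n ih =>
      rw [Finset.sum_range_succ]
      refine (radSup_le_add_of_net (v := V (n + 2)) (v' := V (n + 1)) (hcardV (n + 2))
        (d := √N * (3 * b / 2 ^ (n + 1))) (by positivity) fun q => ?_).trans
          (add_le_add_left ih _)
      exact approx (n + 1) q.1 (hCF _ q.1.2) q.2
  have hsum : ∀ n : ℕ, ∑ k ∈ Finset.range n, √N * (3 * b / 2 ^ k) *
      √(2 * Real.log (2 * ((C (k + 1)).card * (4 ^ (k + 1) + 1)))) ≤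
      √N * (9 * L * I.toReal + 31 * b) := by
    intro n
    have hent : ∑ k ∈ Finset.range n, r / 2 ^ (k + 2) * √(Real.log (C (k + 1)).card) ≤
        I.toReal := by
      rw [← ENNReal.ofReal_le_iff_le_toReal hI]
      rw [ENNReal.ofReal_sum_of_nonneg fun k _ => by positivity]
      refine le_trans (Finset.sum_le_sum fun k _ => ?_) (sum_dyadic_le_entropy hr0 n)
      rw [ENNReal.ofReal_mul (by positivity)]
      gcongr
      have := sqrtLog_mono (hCcard (k + 1))
      refine le_trans (le_of_eq ?_) this
      simp [sqrtLog]
    calc ∑ k ∈ Finset.range n, √N * (3 * b / 2 ^ k) *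
          √(2 * Real.log (2 * ((C (k + 1)).card * (4 ^ (k + 1) + 1))))
        ≤ ∑ k ∈ Finset.range n, √N * ((6 * √2 * L) *
            (r / 2 ^ (k + 2) * √(Real.log (C (k + 1)).card))
            + 10.2 * b * (((k : ℝ) + 2) / 2 ^ (k + 1))) := by
          refine Finset.sum_le_sum fun k _ => ?_
          rw [mul_assoc]
          refine mul_le_mul_of_nonneg_left ?_ hsN.le
          calc 3 * b / 2 ^ k * √(2 * Real.log (2 * ((C (k + 1)).card * (4 ^ (k + 1) + 1))))
              ≤ 3 * b / 2 ^ k * (√2 * √(Real.log (C (k + 1)).card) + 1.7 * (k + 2)) := by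
                gcongr
                exact sqrt_log_product_le (hC1 _) k
            _ = _ := by
                rw [hr, pow_succ _ (k + 1), pow_succ]
                field_simp
                ring
      _ = √N * ((6 * √2 * L) * (∑ k ∈ Finset.range n,
            r / 2 ^ (k + 2) * √(Real.log (C (k + 1)).card))
            + 10.2 * b * ∑ k ∈ Finset.range n, (((k : ℝ) + 2) / 2 ^ (k + 1))) := by
          rw [← Finset.mul_sum, Finset.sum_add_distrib, ← Finset.mul_sum, ← Finset.mul_sum]
      _ ≤ √N * ((6 * √2 * L) * I.toReal + 10.2 * b * 3) := by
          gcongr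
          exact sum_succ_div_two_pow_le n
      _ ≤ √N * (9 * L * I.toReal + 31 * b) := by
          have h2 : √2 ≤ 1.5 := Real.sqrt_le_iff.2 ⟨by norm_num, by norm_num⟩
          have hI0 : 0 ≤ I.toReal := ENNReal.toReal_nonneg
          refine mul_le_mul_of_nonneg_left (add_le_add ?_ (by linarith)) hsN.le
          gcongr
          linarith
  have hlim : Tendsto (fun n : ℕ => √N * (9 * L * I.toReal + 31 * b) +
      √N * (√N * (3 * b / 2 ^ (n + 1)))) atTop
      (𝓝 (√N * (9 * L * I.toReal + 31 * b) + √N * (√N * 0))) := by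
    refine tendsto_const_nhds.add (Tendsto.const_mul _ (Tendsto.const_mul _ ?_))
    refine Tendsto.const_div_atTop ?_ _
    exact (tendsto_pow_atTop_atTop_of_one_lt (by norm_num : (1 : ℝ) < 2)).comp
      (tendsto_add_atTop_nat 1)
  rw [mul_zero, mul_zero, add_zero] at hlim
  refine ge_of_tendsto' hlim fun n => ?_
  refine (radSup_le_add_sqrt_mul (v' := V (n + 1)) (d := √N * (3 * b / 2 ^ (n + 1)))
    (by positivity) fun j => approx (n + 1) (φ j) (hφ j) (τ j)).trans ?_
  exact add_le_add_left ((chain n).trans (hsum _)) _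

/-! ### Uniform deviations of weighted empirical distribution functions -/

lemma measurable_indLE (t : ℝ) : Measurable (indLE t) :=
  Measurable.ite measurableSet_Iic measurable_const measurable_const

section UniformDeviation

variable {Z 𝒳 : Type*} [MeasurableSpace Z] {μ : Measure Z} [IsProbabilityMeasure μ]
  {ξ : Z → 𝒳} {y : Z → ℝ} {F : Set (𝒳 → ℝ)} {W : (𝒳 → ℝ) → Z → ℝ} {b L : ℝ}

/-- The deviation between the weighted empirical and the weighted population distribution function
at `t`. -/
noncomputable def cdfDeviation (μ : Measure Z) (y : Z → ℝ) (W : (𝒳 → ℝ) → Z → ℝ) {N : ℕ}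
    (f : 𝒳 → ℝ) (t : ℝ) (s : Fin N → Z) : ℝ :=
  |1 / (N : ℝ) * ∑ i, W f (s i) * indLE t (y (s i)) - ∫ z, W f z * indLE t (y z) ∂μ|

/-- Expectation of the uniform deviation over a finite subfamily: symmetrization and Dudley's
bound. -/
lemma integral_iSup_cdfDeviation_le (hy : Measurable y) (hb : 0 < b) (hL : 0 < L)
    (hWm : ∀ f ∈ F, Measurable (W f)) (hW0 : ∀ f ∈ F, ∀ z, 0 ≤ W f z)
    (hWb : ∀ f ∈ F, ∀ z, W f z ≤ b)
    (hWL : ∀ f ∈ F, ∀ g ∈ F, ∀ z, |W f z - W g z| ≤ L * |f (ξ z) - g (ξ z)|)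
    {N : ℕ} (hN : 0 < N) {κ : ℝ} (hκ0 : 0 ≤ κ)
    (hκ : ∫⁻ s : Fin N → Z, (∫⁻ t in Ioc 0 (2 * b / L),
      sqrtLog (coveringNumberL2 t F fun i => ξ (s i))) ∂(Measure.pi fun _ => μ)
        ≤ ENNReal.ofReal κ)
    {J : Type*} [Finite J] [Nonempty J] (φ : J → 𝒳 → ℝ) (hφ : ∀ j, φ j ∈ F) (τ : J → ℝ) :
    ∫ s : Fin N → Z, (⨆ j, cdfDeviation μ y W (φ j) (τ j) s) ∂(Measure.pi fun _ => μ)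
      ≤ 2 * (9 * L * κ + 31 * b) / √N := by
  have hN' : (0 : ℝ) < N := by exact_mod_cast hN
  have hsN : 0 < √(N : ℝ) := Real.sqrt_pos.2 hN'
  set P : Measure (Fin N → Z) := Measure.pi fun _ => μ with hP
  have hmeas : ∀ j, Measurable fun z => W (φ j) z * indLE (τ j) (y z) := fun j =>
    (hWm _ (hφ j)).mul ((measurable_indLE _).comp hy)
  have hbd : ∀ j z, |W (φ j) z * indLE (τ j) (y z)| ≤ b := fun j z => by
    rw [abs_of_nonneg (mul_nonneg (hW0 _ (hφ j) z) (indLE_nonneg _ _))]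
    exact (mul_le_of_le_one_right (hW0 _ (hφ j) z) (indLE_le_one _ _)).trans (hWb _ (hφ j) z)
  refine (integral_iSup_abs_le_radSup μ hN hmeas hbd).trans ?_
  have hrad0 : ∀ s : Fin N → Z,
      0 ≤ radSup fun j i => W (φ j) (s i) * indLE (τ j) (y (s i)) := fun s =>
    div_nonneg (Finset.sum_nonneg fun σ _ => Real.iSup_nonneg fun j => abs_nonneg _)
      (by positivity)
  have hradm : Measurable fun s : Fin N → Z =>
      radSup fun j i => W (φ j) (s i) * indLE (τ j) (y (s i)) :=
    (Finset.measurable_sum _ fun σ _ => Measurable.iSup fun j =>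
      (Finset.measurable_sum _ fun i _ =>
        ((hmeas j).comp (measurable_pi_apply i)).const_mul _).abs).div_const _
  have key : ∫ s : Fin N → Z, radSup (fun j i => W (φ j) (s i) * indLE (τ j) (y (s i))) ∂P
      ≤ √N * (9 * L * κ + 31 * b) := by
    rw [integral_eq_lintegral_of_nonneg_ae (ae_of_all _ hrad0) hradm.aestronglyMeasurable]
    refine ENNReal.toReal_le_of_le_ofReal (by positivity) ?_
    calc ∫⁻ s, ENNReal.ofReal (radSup fun j i => W (φ j) (s i) * indLE (τ j) (y (s i))) ∂P
        ≤ ∫⁻ s, ENNReal.ofReal √N * (ENNReal.ofReal (9 * L) *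
            (∫⁻ t in Ioc 0 (2 * b / L), sqrtLog (coveringNumberL2 t F fun i => ξ (s i)))
            + ENNReal.ofReal (31 * b)) ∂P := by
          refine lintegral_mono fun s => ?_
          simp only
          set I := ∫⁻ t in Ioc 0 (2 * b / L), sqrtLog (coveringNumberL2 t F fun i => ξ (s i))
            with hI
          by_cases htop : I = ⊤
          · have h9 : ENNReal.ofReal (9 * L) ≠ 0 := by simpa using hL
            have hs9 : ENNReal.ofReal √N ≠ 0 := by simpa using hsN
            rw [htop, ENNReal.mul_top h9, top_add, ENNReal.mul_top hs9]
            exact le_top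
          · have := radSup_le_entropy hN (F := F) (x := fun i => ξ (s i)) (fun i => y (s i))
              (W := fun f i => W f (s i)) hb hL (fun f hf i => hW0 f hf _)
              (fun f hf i => hWb f hf _) (fun f hf g hg i => hWL f hf g hg _) htop φ hφ τ
            refine (ENNReal.ofReal_le_ofReal this).trans (le_of_eq ?_)
            rw [ENNReal.ofReal_mul hsN.le, ENNReal.ofReal_add (by positivity) (by positivity),
              ENNReal.ofReal_mul (by positivity), ENNReal.ofReal_toReal htop]
      _ = ENNReal.ofReal √N * (ENNReal.ofReal (9 * L) * (∫⁻ s, (∫⁻ t in Ioc 0 (2 * b / L),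
            sqrtLog (coveringNumberL2 t F fun i => ξ (s i))) ∂P) + ENNReal.ofReal (31 * b)) := by
          rw [lintegral_const_mul' _ _ ENNReal.ofReal_ne_top,
            lintegral_add_right _ measurable_const,
            lintegral_const_mul' _ _ ENNReal.ofReal_ne_top]
          simp
      _ ≤ ENNReal.ofReal √N * (ENNReal.ofReal (9 * L) * ENNReal.ofReal κ
            + ENNReal.ofReal (31 * b)) := by gcongr
      _ = ENNReal.ofReal (√N * (9 * L * κ + 31 * b)) := by
          rw [ENNReal.ofReal_mul hsN.le, ENNReal.ofReal_add (by positivity) (by positivity),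
            ENNReal.ofReal_mul (by positivity : 0 ≤ 9 * L)]
  calc 2 / (N : ℝ) * ∫ s : Fin N → Z, radSup (fun j i => W (φ j) (s i) * indLE (τ j) (y (s i))) ∂P
      ≤ 2 / N * (√N * (9 * L * κ + 31 * b)) := by gcongr
    _ = 2 * (9 * L * κ + 31 * b) / √N := by
        have : (N : ℝ) = √N * √N := (Real.mul_self_sqrt hN'.le).symm
        field_simp
        rw [sq, ← this]

/-- A high probability bound for the uniform deviation over a finite subfamily. -/
lemma measure_iSup_cdfDeviation_gt_le (hy : Measurable y) (hb : 0 < b) (hL : 0 < L)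
    (hWm : ∀ f ∈ F, Measurable (W f)) (hW0 : ∀ f ∈ F, ∀ z, 0 ≤ W f z)
    (hWb : ∀ f ∈ F, ∀ z, W f z ≤ b)
    (hWL : ∀ f ∈ F, ∀ g ∈ F, ∀ z, |W f z - W g z| ≤ L * |f (ξ z) - g (ξ z)|)
    {N : ℕ} (hN : 0 < N) {κ : ℝ} (hκ0 : 0 ≤ κ)
    (hκ : ∫⁻ s : Fin N → Z, (∫⁻ t in Ioc 0 (2 * b / L),
      sqrtLog (coveringNumberL2 t F fun i => ξ (s i))) ∂(Measure.pi fun _ => μ)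
        ≤ ENNReal.ofReal κ) {δ : ℝ} (hδ : 0 < δ) (hδ1 : δ ≤ 1)
    {J : Type*} [Finite J] [Nonempty J] (φ : J → 𝒳 → ℝ) (hφ : ∀ j, φ j ∈ F) (τ : J → ℝ) :
    (Measure.pi fun _ => μ) {s : Fin N → Z |
      2 * (9 * L * κ + 31 * b) / √N + b * √(2 * Real.log (1 / δ) / N)
        < ⨆ j, cdfDeviation μ y W (φ j) (τ j) s} ≤ ENNReal.ofReal δ := by
  have hN' : (0 : ℝ) < N := by exact_mod_cast hN
  have hmeas : ∀ j, Measurable fun z => W (φ j) z * indLE (τ j) (y z) := fun j =>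
    (hWm _ (hφ j)).mul ((measurable_indLE _).comp hy)
  set Φ : (Fin N → Z) → ℝ := fun s => ⨆ j, cdfDeviation μ y W (φ j) (τ j) s with hΦ
  have mΦ : Measurable Φ := Measurable.iSup fun j =>
    (((Finset.measurable_sum _ fun i _ => (hmeas j).comp (measurable_pi_apply i)).const_mul
      _).sub_const _).abs
  have one : ∀ (s s' : Fin N → Z) (i : Fin N), (∀ k, k ≠ i → s k = s' k) → Φ s ≤ Φ s' + b / N := by
    intro s s' i hk
    refine ciSup_le fun j => ?_
    refine le_trans ?_ (add_le_add_left
      (le_iSup_of_finite (fun j => cdfDeviation μ y W (φ j) (τ j) s') j) _)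
    unfold cdfDeviation
    set m := ∫ z, W (φ j) z * indLE (τ j) (y z) ∂μ
    set g := fun z => W (φ j) z * indLE (τ j) (y z) with hg
    have g0 : ∀ z, 0 ≤ g z := fun z => mul_nonneg (hW0 _ (hφ j) z) (indLE_nonneg _ _)
    have gb : ∀ z, g z ≤ b := fun z =>
      (mul_le_of_le_one_right (hW0 _ (hφ j) z) (indLE_le_one _ _)).trans (hWb _ (hφ j) z)
    have hdiff : ∑ k, g (s k) - ∑ k, g (s' k) = g (s i) - g (s' i) := by
      rw [← Finset.sum_sub_distrib]
      refine Finset.sum_eq_single i (fun k _ hki => ?_) (by simp)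
      rw [hk k hki, sub_self]
    have hab : |g (s i) - g (s' i)| ≤ b := abs_le.2
      ⟨by linarith [g0 (s i), gb (s' i)], by linarith [g0 (s' i), gb (s i)]⟩
    have e : 1 / (N : ℝ) * ∑ k, g (s k) - m
        = (1 / (N : ℝ) * ∑ k, g (s' k) - m) + (g (s i) - g (s' i)) / N := by
      rw [← hdiff]; ring
    rw [e]
    refine (abs_add_le _ _).trans (add_le_add_right ?_ _)
    rw [abs_div, abs_of_pos hN']
    gcongr
  have hd : ∀ s i z, |Φ (Function.update s i z) - Φ s| ≤ b / N := by
    intro s i z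
    have h1 := one (Function.update s i z) s i fun k hk => Function.update_of_ne hk _ _
    have h2 := one s (Function.update s i z) i fun k hk => (Function.update_of_ne hk _ _).symm
    exact abs_le.2 ⟨by linarith, by linarith⟩
  have hlog : 0 ≤ Real.log (1 / δ) := Real.log_nonneg (by rw [le_div_iff₀ hδ]; linarith)
  have hmc := measureReal_ge_le_of_bounded_differences μ mΦ hd
    (t := b * √(2 * Real.log (1 / δ) / N)) (by positivity)
  have hexp : Real.exp (-(b * √(2 * Real.log (1 / δ) / N)) ^ 2 / (2 * (N * (b / N) ^ 2))) = δ := by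
    rw [mul_pow, Real.sq_sqrt (by positivity)]
    have : -(b ^ 2 * (2 * Real.log (1 / δ) / N)) / (2 * (N * (b / N) ^ 2)) = Real.log δ := by
      rw [one_div, Real.log_inv]
      field_simp
    rw [this, Real.exp_log hδ]
  rw [hexp] at hmc
  have hE := integral_iSup_cdfDeviation_le hy hb hL hWm hW0 hWb hWL hN hκ0 hκ φ hφ τ
  refine (measure_mono (t := {s | ∫ s, Φ s ∂(Measure.pi fun _ => μ)
    + b * √(2 * Real.log (1 / δ) / N) ≤ Φ s}) fun s hs => ?_).trans ?_
  · have hs' : _ < Φ s := hs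
    exact le_of_lt (lt_of_le_of_lt (by linarith) hs')
  · rw [← ofReal_measureReal]
    exact ENNReal.ofReal_le_ofReal hmc

lemma tendsto_indLE {q : ℕ → ℝ} {t : ℝ} (hq : Tendsto q atTop (𝓝 t)) (hqt : ∀ n, t ≤ q n) (y : ℝ) :
    Tendsto (fun n => indLE (q n) y) atTop (𝓝 (indLE t y)) := by
  refine tendsto_const_nhds.congr' ?_
  by_cases h : y ≤ t
  · exact Eventually.of_forall fun n => by simp [indLE, h, h.trans (hqt n)]
  · filter_upwards [hq.eventually_lt_const (not_le.1 h)] with n hn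
    simp [indLE, h, hn]

/-- **Uniform deviation bound**: with probability at least `1 - δ`, the weighted empirical
distribution functions of all members of a pointwise separable class are uniformly close to their
population versions. -/
theorem measure_not_forall_cdfDeviation_le (hy : Measurable y) (hb : 0 < b) (hL : 0 < L)
    (hWm : ∀ f ∈ F, Measurable (W f)) (hW0 : ∀ f ∈ F, ∀ z, 0 ≤ W f z)
    (hWb : ∀ f ∈ F, ∀ z, W f z ≤ b)
    (hWL : ∀ f ∈ F, ∀ g ∈ F, ∀ z, |W f z - W g z| ≤ L * |f (ξ z) - g (ξ z)|)
    (hsep : ∃ F₀ ⊆ F, F₀.Countable ∧ ∀ f ∈ F, ∃ u : ℕ → 𝒳 → ℝ,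
      (∀ n, u n ∈ F₀) ∧ ∀ x, Tendsto (fun n => u n x) atTop (𝓝 (f x)))
    {N : ℕ} (hN : 0 < N) {κ : ℝ} (hκ0 : 0 ≤ κ)
    (hκ : ∫⁻ s : Fin N → Z, (∫⁻ t in Ioc 0 (2 * b / L),
      sqrtLog (coveringNumberL2 t F fun i => ξ (s i))) ∂(Measure.pi fun _ => μ)
        ≤ ENNReal.ofReal κ) {δ : ℝ} (hδ : 0 < δ) (hδ1 : δ ≤ 1) :
    (Measure.pi fun _ => μ) {s : Fin N → Z | ¬ ∀ f ∈ F, ∀ t, cdfDeviation μ y W f t s ≤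
      2 * (9 * L * κ + 31 * b) / √N + b * √(2 * Real.log (1 / δ) / N)} ≤ ENNReal.ofReal δ := by
  set β := 2 * (9 * L * κ + 31 * b) / √N + b * √(2 * Real.log (1 / δ) / N) with hβ
  obtain ⟨F₀, hF₀, hcount, hdense⟩ := hsep
  -- it suffices to control `F₀` and rational thresholds
  have hext : ∀ s : Fin N → Z, (∀ f ∈ F₀, ∀ q : ℚ, cdfDeviation μ y W f q s ≤ β) →
      ∀ f ∈ F, ∀ t, cdfDeviation μ y W f t s ≤ β := by
    intro s hs f hf t
    obtain ⟨u, hu, hlim⟩ := hdense f hf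
    have hq : ∀ n : ℕ, ∃ q : ℚ, t < q ∧ (q : ℝ) < t + 1 / (n + 1) := fun n =>
      exists_rat_btwn (lt_add_of_pos_right _ (by positivity))
    choose q hq1 hq2 using hq
    have hqt : Tendsto (fun n => (q n : ℝ)) atTop (𝓝 t) := by
      refine tendsto_of_tendsto_of_tendsto_of_le_of_le tendsto_const_nhds ?_
        (fun n => (hq1 n).le) (fun n => (hq2 n).le)
      simpa using tendsto_const_nhds.add (tendsto_one_div_add_atTop_nhds_zero_nat (𝕜 := ℝ))
    have huF : ∀ n, u n ∈ F := fun n => hF₀ (hu n)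
    have hz : ∀ z, Tendsto (fun n => W (u n) z * indLE (q n) (y z)) atTop
        (𝓝 (W f z * indLE t (y z))) := by
      intro z
      refine Tendsto.mul ?_ (tendsto_indLE hqt (fun n => (hq1 n).le) _)
      rw [tendsto_iff_norm_sub_tendsto_zero]
      refine squeeze_zero (fun _ => norm_nonneg _) (fun n => hWL _ (huF n) _ hf z) ?_
      have := ((hlim (ξ z)).sub_const (f (ξ z))).abs.const_mul L
      simpa using this
    have hlim2 : Tendsto (fun n => cdfDeviation μ y W (u n) (q n) s) atTop
        (𝓝 (cdfDeviation μ y W f t s)) := by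
      refine Tendsto.abs (Tendsto.sub (Tendsto.const_mul _ (tendsto_finsetSum _ fun i _ => hz _)) ?_)
      refine tendsto_integral_of_dominated_convergence (fun _ => b) (fun n =>
        ((hWm _ (huF n)).mul ((measurable_indLE _).comp hy)).aestronglyMeasurable)
        (integrable_const _) (fun n => ae_of_all _ fun z => ?_) (ae_of_all _ hz)
      rw [Real.norm_eq_abs, abs_of_nonneg (mul_nonneg (hW0 _ (huF n) z) (indLE_nonneg _ _))]
      exact (mul_le_of_le_one_right (hW0 _ (huF n) z) (indLE_le_one _ _)).trans (hWb _ (huF n) z)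
    exact le_of_tendsto' hlim2 fun n => hs _ (hu n) _
  rcases F₀.eq_empty_or_nonempty with h0 | h0
  · have : {s : Fin N → Z | ¬ ∀ f ∈ F, ∀ t, cdfDeviation μ y W f t s ≤ β} = ∅ := by
      ext s
      simp only [mem_ofPred_eq, mem_empty_iff_false, iff_false, not_not]
      exact hext s (by simp [h0])
    rw [this]; simp
  have := hcount.to_subtype
  have := h0.to_subtype
  obtain ⟨e, he⟩ := exists_surjective_nat (F₀ × ℚ)
  set A : ℕ → Set (Fin N → Z) := fun n =>
    {s | β < ⨆ j : Fin (n + 1), cdfDeviation μ y W (e j).1 (e j).2 s} with hA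
  have hAm : Monotone A := by
    intro n m hnm s hs
    refine lt_of_lt_of_le (show β < _ from hs) (ciSup_le fun j => ?_)
    exact le_iSup_of_finite (fun j : Fin (m + 1) => cdfDeviation μ y W (e j).1 (e j).2 s)
      ⟨j, by omega⟩
  have hAδ : ∀ n, (Measure.pi fun _ => μ) (A n) ≤ ENNReal.ofReal δ := fun n =>
    measure_iSup_cdfDeviation_gt_le hy hb hL hWm hW0 hWb hWL hN hκ0 hκ hδ hδ1
      (fun j : Fin (n + 1) => ((e j).1 : 𝒳 → ℝ)) (fun j => hF₀ (e j).1.2) fun j => ((e j).2 : ℝ)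
  refine (measure_mono (t := ⋃ n, A n) fun s hs => ?_).trans ?_
  · by_contra hcon
    refine hs (hext s fun f hf q => ?_)
    obtain ⟨n, hn⟩ := he (⟨f, hf⟩, q)
    by_contra hlt
    refine hcon (mem_iUnion.2 ⟨n, lt_of_lt_of_le (not_le.1 hlt) ?_⟩)
    have := le_iSup_of_finite
      (fun j : Fin (n + 1) => cdfDeviation μ y W (e j).1 (e j).2 s) ⟨n, by omega⟩
    simpa [hn] using this
  · rw [hAm.measure_iUnion]
    exact iSup_le hAδ

end UniformDeviation

/-! ### Duality for the Kullback-Leibler ball -/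

section Duality

lemma integral_tilted_neg_mul {Ω : Type*} [MeasurableSpace Ω] (P₀ : Measure Ω) (T : Ω → ℝ) (β : ℝ) :
    ∫ ω, T ω ∂(P₀.tilted fun ω => -β * T ω)
      = (∫ ω, T ω * Real.exp (-β * T ω) ∂P₀) / ∫ ω, Real.exp (-β * T ω) ∂P₀ := by
  rw [integral_tilted, ← integral_div]
  refine integral_congr_ae (ae_of_all _ fun ω => ?_)
  simp only [smul_eq_mul]
  ring

variable {Ω : Type*} [MeasurableSpace Ω] {P₀ : Measure Ω} [IsProbabilityMeasure P₀] {T : Ω → ℝ}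
  {M : ℝ}

lemma integrable_exp_neg_mul (hT : Measurable T) (hTM : ∀ ω, T ω ∈ Icc 0 M) {P : Measure Ω}
    [IsFiniteMeasure P] (β : ℝ) : Integrable (fun ω => Real.exp (-β * T ω)) P :=
  integrable_exp_mul_of_mem_Icc (a := 0) (b := M) hT.aemeasurable (ae_of_all _ hTM)

lemma integrable_of_mem_Icc (hT : Measurable T) (hTM : ∀ ω, T ω ∈ Icc 0 M) {P : Measure Ω}
    [IsFiniteMeasure P] : Integrable T P :=
  Integrable.of_mem_Icc 0 M hT.aemeasurable (ae_of_all _ hTM)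

/-- Weak duality, from the Donsker-Varadhan inequality. -/
lemma neg_mul_log_sub_le_integral (hT : Measurable T) (hTM : ∀ ω, T ω ∈ Icc 0 M) {P : Measure Ω}
    [IsProbabilityMeasure P] {η : ℝ} (hη : 0 ≤ η)
    (hP : InformationTheory.klDiv P P₀ ≤ ENNReal.ofReal η) {α : ℝ} (hα : 0 < α) :
    -α * Real.log (∫ ω, Real.exp (-T ω / α) ∂P₀) - α * η ≤ ∫ ω, T ω ∂P := by
  have hne : InformationTheory.klDiv P P₀ ≠ ⊤ := ne_top_of_le_ne_top ENNReal.ofReal_ne_top hP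
  obtain ⟨hac, hint⟩ := InformationTheory.klDiv_ne_top_iff.1 hne
  have hkl : ∫ ω, llr P P₀ ω ∂P ≤ η := by
    rw [← InformationTheory.toReal_klDiv_of_measure_eq hac (by simp)]
    exact ENNReal.toReal_le_of_le_ofReal hη hP
  set f : Ω → ℝ := fun ω => -T ω / α with hf
  have hfe : ∀ ω, f ω = -(1 / α) * T ω := fun ω => by simp only [hf]; ring
  have hexp : Integrable (fun ω => Real.exp (f ω)) P₀ := by
    simp_rw [hfe]; exact integrable_exp_neg_mul hT hTM _
  have hfP : Integrable f P := by
    rw [show f = fun ω => -(1 / α) * T ω from funext hfe]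
    exact (integrable_of_mem_Icc hT hTM).const_mul _
  have hpt := isProbabilityMeasure_tilted hexp
  have h0 := InformationTheory.integral_llr_add_sub_measure_univ_nonneg
    (hac.trans (absolutelyContinuous_tilted hexp)) (integrable_llr_tilted_right hac hfP hint hexp)
  rw [integral_llr_tilted_right hac hfP hexp hint] at h0
  simp only [probReal_univ] at h0
  have hfi : ∫ ω, f ω ∂P = -(1 / α) * ∫ ω, T ω ∂P := by
    simp_rw [hfe]; exact integral_const_mul _ _
  rw [hfi] at h0
  have h1 : 0 ≤ η + 1 / α * ∫ ω, T ω ∂P + Real.log (∫ ω, Real.exp (f ω) ∂P₀) := by linarith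
  have h2 := mul_nonneg hα.le h1
  have e : α * (η + 1 / α * ∫ ω, T ω ∂P + Real.log (∫ ω, Real.exp (f ω) ∂P₀))
      = α * η + ∫ ω, T ω ∂P + α * Real.log (∫ ω, Real.exp (f ω) ∂P₀) := by
    field_simp
  rw [e] at h2
  linarith

lemma integral_Icc_exp_neg (hM : 0 ≤ M) {β : ℝ} (hβ : 0 < β) :
    ∫ y in Icc 0 M, Real.exp (-β * y) = (1 - Real.exp (-β * M)) / β := by
  rw [integral_Icc_eq_integral_Ioc, ← intervalIntegral.integral_of_le hM]
  rw [intervalIntegral.integral_eq_sub_of_hasDerivAt (f := fun y => -(Real.exp (-β * y) / β))]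
  · simp; ring
  · intro y _
    have h : HasDerivAt (fun y : ℝ => -β * y) (-β) y := by
      simpa using (hasDerivAt_id y).const_mul (-β)
    refine ((h.exp.div_const β).neg).congr_deriv ?_
    field_simp
  · exact (by fun_prop : Continuous fun y => Real.exp (-β * y)).intervalIntegrable _ _

/-- The divergence of the exponentially tilted law `e ^ (-β T) dP₀ / Z` from `P₀`. -/
noncomputable def tiltDiv (P₀ : Measure Ω) (T : Ω → ℝ) (β : ℝ) : ℝ :=
  -Real.log (∫ ω, Real.exp (-β * T ω) ∂P₀)
    - β * ((∫ ω, T ω * Real.exp (-β * T ω) ∂P₀) / ∫ ω, Real.exp (-β * T ω) ∂P₀)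

lemma klDiv_tilted (hT : Measurable T) (hTM : ∀ ω, T ω ∈ Icc 0 M) (β : ℝ) :
    InformationTheory.klDiv (P₀.tilted fun ω => -β * T ω) P₀ = ENNReal.ofReal (tiltDiv P₀ T β) := by
  have hexp := integrable_exp_neg_mul hT hTM (P := P₀) β
  have hpt := isProbabilityMeasure_tilted hexp
  set P := P₀.tilted fun ω => -β * T ω with hP
  have hac : P ≪ P₀ := tilted_absolutelyContinuous _ _
  have hTP : Integrable T P := integrable_of_mem_Icc hT hTM
  have hllr : llr P P₀ =ᵐ[P] fun ω => -β * T ω - Real.log (∫ ω, Real.exp (-β * T ω) ∂P₀) :=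
    hac.ae_le (log_rnDeriv_tilted_left_self hexp)
  have hint : Integrable (llr P P₀) P :=
    (integrable_congr hllr).2 ((hTP.const_mul _).sub (integrable_const _))
  rw [← ENNReal.ofReal_toReal (InformationTheory.klDiv_ne_top hac hint),
    InformationTheory.toReal_klDiv_of_measure_eq hac (by simp), integral_congr_ae hllr,
    integral_sub (hTP.const_mul _) (integrable_const _), integral_const_mul, hP,
    integral_tilted_neg_mul]
  congr 1
  rw [integral_const, ← hP, probReal_univ]
  unfold tiltDiv
  simp only [smul_eq_mul]
  ring

lemma continuousOn_tiltDiv (hT : Measurable T) (hTM : ∀ ω, T ω ∈ Icc 0 M) :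
    ContinuousOn (tiltDiv P₀ T) (Ici 0) := by
  have hle : ∀ β ∈ Ici (0 : ℝ), ∀ ω, Real.exp (-β * T ω) ≤ 1 := fun β hβ ω =>
    Real.exp_le_one_iff.2 (by nlinarith [(hTM ω).1, mem_Ici.1 hβ])
  have hZ : ContinuousOn (fun β => ∫ ω, Real.exp (-β * T ω) ∂P₀) (Ici 0) := by
    refine continuousOn_of_dominated (bound := fun _ => 1) (fun β _ => by fun_prop)
      (fun β hβ => ae_of_all _ fun ω => ?_) (integrable_const _) (ae_of_all _ fun ω => by fun_prop)
    rw [Real.norm_eq_abs, Real.abs_exp]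
    exact hle β hβ ω
  have hY : ContinuousOn (fun β => ∫ ω, T ω * Real.exp (-β * T ω) ∂P₀) (Ici 0) := by
    refine continuousOn_of_dominated (bound := fun _ => M) (fun β _ => by fun_prop)
      (fun β hβ => ae_of_all _ fun ω => ?_) (integrable_const _) (ae_of_all _ fun ω => by fun_prop)
    rw [Real.norm_eq_abs, abs_mul, Real.abs_exp, abs_of_nonneg (hTM ω).1]
    exact (mul_le_of_le_one_right (hTM ω).1 (hle β hβ ω)).trans (hTM ω).2
  have hne : ∀ β, ∫ ω, Real.exp (-β * T ω) ∂P₀ ≠ 0 := fun β =>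
    (integral_exp_pos (integrable_exp_neg_mul hT hTM β)).ne'
  exact ((hZ.log fun β _ => hne β).neg).sub
    (continuousOn_id.mul (hY.div hZ fun β _ => hne β))

/-- The divergence of the tilted laws is unbounded when the law of `T` has a density that is bounded
and bounded away from zero. -/
lemma exists_le_tiltDiv (hM : 0 < M) (hT : Measurable T) (hTM : ∀ ω, T ω ∈ Icc 0 M) {ε B : ℝ}
    (hε : 0 < ε) (hB : 0 < B)
    (hlow : ENNReal.ofReal ε • volume.restrict (Icc 0 M) ≤ P₀.map T)
    (hupp : P₀.map T ≤ ENNReal.ofReal B • volume.restrict (Icc 0 M)) (η : ℝ) :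
    ∃ β, 0 < β ∧ η ≤ tiltDiv P₀ T β := by
  have hmap : ∀ β, ∫ ω, Real.exp (-β * T ω) ∂P₀ = ∫ y, Real.exp (-β * y) ∂(P₀.map T) := fun β =>
    (integral_map hT.aemeasurable
      (by fun_prop : Continuous fun y => Real.exp (-β * y)).aestronglyMeasurable).symm
  have hi : ∀ β, IntegrableOn (fun y => Real.exp (-β * y)) (Icc 0 M) := fun β =>
    (by fun_prop : Continuous fun y => Real.exp (-β * y)).continuousOn.integrableOn_Icc
  have hZu : ∀ β, 0 < β → ∫ ω, Real.exp (-β * T ω) ∂P₀ ≤ B / β := by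
    intro β hβ
    rw [hmap]
    refine (integral_mono_measure hupp (ae_of_all _ fun y => (Real.exp_nonneg _))
      ((hi β).smul_measure ENNReal.ofReal_ne_top)).trans ?_
    rw [integral_smul_measure, integral_Icc_exp_neg hM.le hβ, ENNReal.toReal_ofReal hB.le,
      smul_eq_mul, ← mul_div_assoc]
    gcongr
    have := Real.exp_pos (-β * M)
    nlinarith
  have hZl : ∀ β, 0 < β → ε * ((1 - Real.exp (-β * M)) / β) ≤ ∫ ω, Real.exp (-β * T ω) ∂P₀ := by
    intro β hβ
    rw [hmap, ← integral_Icc_exp_neg hM.le hβ]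
    have : IsProbabilityMeasure (P₀.map T) := Measure.isProbabilityMeasure_map hT.aemeasurable
    have hint : Integrable (fun y => Real.exp (-β * y)) (P₀.map T) :=
      (integrable_map_measure (by fun_prop) hT.aemeasurable).2 (integrable_exp_neg_mul hT hTM β)
    have := integral_mono_measure hlow (ae_of_all _ fun y => (Real.exp_nonneg _)) hint
    rwa [integral_smul_measure, ENNReal.toReal_ofReal hε.le, smul_eq_mul] at this
  set β := max (1 / M) (B * Real.exp (η + 4 * B / ε)) with hβdef
  have hβ : 0 < β := lt_max_of_lt_left (by positivity)
  refine ⟨β, hβ, ?_⟩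
  set Z := ∫ ω, Real.exp (-β * T ω) ∂P₀ with hZ
  have hZ0 : 0 < Z := integral_exp_pos (integrable_exp_neg_mul hT hTM β)
  have hhalf : Real.exp (-β * M) ≤ 1 / 2 := by
    have h1 : 1 ≤ β * M := by
      rw [← div_le_iff₀ hM]
      exact le_max_left _ _
    have h2 := Real.add_one_le_exp (β * M)
    rw [neg_mul, Real.exp_neg, one_div]
    exact inv_anti₀ (by norm_num) (by linarith)
  have hZlow : ε / (2 * β) ≤ Z := by
    refine le_trans ?_ (hZl β hβ)
    rw [← mul_div_assoc, div_le_div_iff₀ (by positivity) hβ]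
    have h3 := mul_le_mul_of_nonneg_left hhalf (mul_nonneg hε.le hβ.le)
    nlinarith
  have hlog : η + 4 * B / ε ≤ -Real.log Z := by
    have h1 : Z ≤ Real.exp (-(η + 4 * B / ε)) := by
      refine (hZu β hβ).trans ?_
      rw [Real.exp_neg, div_le_iff₀ hβ, inv_mul_eq_div, le_div_iff₀ (Real.exp_pos _)]
      exact le_max_right _ _
    have h2 := Real.log_le_log hZ0 h1
    rw [Real.log_exp] at h2
    linarith
  have hmean : β * ((∫ ω, T ω * Real.exp (-β * T ω) ∂P₀) / Z) ≤ 4 * B / ε := by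
    have h1 : β * ∫ ω, T ω * Real.exp (-β * T ω) ∂P₀ ≤ B / (β / 2) := by
      refine le_trans ?_ (hZu (β / 2) (by positivity))
      rw [← integral_const_mul]
      refine integral_mono_of_nonneg (ae_of_all _ fun ω => ?_)
        (integrable_exp_neg_mul hT hTM _) (ae_of_all _ fun ω => ?_)
      · have := (hTM ω).1
        simp only [Pi.zero_apply]
        positivity
      · -- `u * exp (-u) ≤ exp (-u / 2)`
        set u := β * T ω with hu
        have h2 : u ≤ Real.exp (u / 2) := by
          have := Real.quadratic_le_exp_of_nonneg (x := u / 2)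
            (by have := (hTM ω).1; positivity)
          nlinarith [sq_nonneg (u / 2 - 1)]
        have e : Real.exp (-(β / 2) * T ω) = Real.exp (u / 2) * Real.exp (-β * T ω) := by
          rw [← Real.exp_add, hu]; ring_nf
        simp only [e, ← mul_assoc]
        gcongr
    rw [← mul_div_assoc, div_le_iff₀ hZ0]
    refine h1.trans ?_
    calc B / (β / 2) = 4 * B / ε * (ε / (2 * β)) := by field_simp; ring
      _ ≤ 4 * B / ε * Z := by gcongr
  have : tiltDiv P₀ T β = -Real.log Z - β * ((∫ ω, T ω * Real.exp (-β * T ω) ∂P₀) / Z) := rfl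
  rw [this]
  linarith

/-- Strong duality, up to an arbitrarily small error: for `η > 0` the exponential tilt whose
divergence is exactly `η` is optimal, and for `η = 0` the dual objective tends to the mean as
`α → ∞`. -/
lemma exists_integral_le_dual (hM : 0 < M) (hT : Measurable T) (hTM : ∀ ω, T ω ∈ Icc 0 M)
    {ε B : ℝ} (hε : 0 < ε) (hB : 0 < B)
    (hlow : ENNReal.ofReal ε • volume.restrict (Icc 0 M) ≤ P₀.map T)
    (hupp : P₀.map T ≤ ENNReal.ofReal B • volume.restrict (Icc 0 M)) {η : ℝ} (hη : 0 ≤ η)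
    {e : ℝ} (he : 0 < e) :
    ∃ α, 0 < α ∧ ∃ P : Measure Ω, IsProbabilityMeasure P ∧
      InformationTheory.klDiv P P₀ ≤ ENNReal.ofReal η ∧
      ∫ ω, T ω ∂P ≤ -α * Real.log (∫ ω, Real.exp (-T ω / α) ∂P₀) - α * η + e := by
  rcases hη.eq_or_lt with h0 | hpos
  · refine ⟨M ^ 2 / e, by positivity, P₀, inferInstance, by simp, ?_⟩
    rw [← h0]
    set α := M ^ 2 / e with hα
    have hα0 : 0 < α := by positivity
    have hfe : ∀ ω, Real.exp (-T ω / α) = Real.exp (-(1 / α) * T ω) := fun ω => by ring_nf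
    have hint : Integrable (fun ω => Real.exp (-T ω / α)) P₀ := by
      simp_rw [hfe]; exact integrable_exp_neg_mul hT hTM _
    have hTi : Integrable T P₀ := integrable_of_mem_Icc hT hTM
    have h1 : ∫ ω, Real.exp (-T ω / α) ∂P₀ ≤ 1 - (∫ ω, T ω ∂P₀) / α + (M / α) ^ 2 := by
      calc ∫ ω, Real.exp (-T ω / α) ∂P₀ ≤ ∫ ω, (1 - T ω / α + (M / α) ^ 2) ∂P₀ := by
            refine integral_mono hint (((integrable_const _).sub (hTi.div_const _)).add
              (integrable_const _)) fun ω => ?_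
            simp only
            have hu0 : 0 ≤ T ω / α := div_nonneg (hTM ω).1 hα0.le
            have hu1 : (T ω / α) ^ 2 ≤ (M / α) ^ 2 := by
              have := (hTM ω).2
              gcongr
            have h2 : Real.exp (-T ω / α) ≤ 1 - T ω / α + (T ω / α) ^ 2 := by
              -- from `1 + u ≤ exp u`
              have h3 := Real.add_one_le_exp (T ω / α)
              rw [neg_div, Real.exp_neg, inv_le_iff_one_le_mul₀ (Real.exp_pos _)]
              set u := T ω / α
              nlinarith [mul_nonneg hu0 (sq_nonneg u), sq_nonneg (u - 1),
                mul_le_mul_of_nonneg_left h3 (by nlinarith [sq_nonneg (u - 1)] :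
                  0 ≤ 1 - u + u ^ 2)]
            linarith
        _ = _ := by
            rw [integral_add (f := fun ω => 1 - T ω / α)
                ((integrable_const _).sub (hTi.div_const _)) (integrable_const _),
              integral_sub (integrable_const _) (hTi.div_const _), integral_div]
            simp
    have h2 := Real.log_le_sub_one_of_pos (integral_exp_pos hint)
    have h3 : Real.log (∫ ω, Real.exp (-T ω / α) ∂P₀) ≤ -(∫ ω, T ω ∂P₀) / α + (M / α) ^ 2 := by
      rw [neg_div]; linarith
    have h4 := mul_le_mul_of_nonneg_left h3 hα0.le
    have e1 : α * (-(∫ ω, T ω ∂P₀) / α + (M / α) ^ 2) = -(∫ ω, T ω ∂P₀) + e := by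
      rw [hα]; field_simp
    rw [e1] at h4
    linarith
  · obtain ⟨β₁, hβ₁, hle⟩ := exists_le_tiltDiv hM hT hTM hε hB hlow hupp η
    have h00 : tiltDiv P₀ T 0 = 0 := by simp [tiltDiv]
    obtain ⟨β, hβ, hβη⟩ := intermediate_value_Icc hβ₁.le
      ((continuousOn_tiltDiv (P₀ := P₀) hT hTM).mono Icc_subset_Ici_self)
      (show η ∈ Icc (tiltDiv P₀ T 0) (tiltDiv P₀ T β₁) from ⟨by rw [h00]; exact hη, hle⟩)
    have hβ0 : 0 < β := by
      rcases hβ.1.eq_or_lt with h | h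
      · rw [← h, h00] at hβη; exact absurd hβη hpos.ne
      · exact h
    refine ⟨1 / β, by positivity, P₀.tilted fun ω => -β * T ω,
      isProbabilityMeasure_tilted (integrable_exp_neg_mul hT hTM β), ?_, ?_⟩
    · rw [klDiv_tilted hT hTM, hβη]
    · rw [integral_tilted_neg_mul]
      have hfe : ∀ ω, Real.exp (-T ω / (1 / β)) = Real.exp (-β * T ω) := fun ω => by
        congr 1; field_simp
      simp_rw [hfe]
      rw [← hβη]
      unfold tiltDiv
      refine le_add_of_le_of_nonneg (le_of_eq ?_) he.le
      field_simp
      ring_nf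

end Duality

/-! ### Stability of the robust value under perturbations of the distribution function -/

/-- If `μ` is stochastically at least `ν` shifted by `-d`, the Laplace transforms compare with the
factor `exp (d / α)`. -/
lemma lintegral_exp_le_of_Iic_le {μ ν : Measure ℝ} {d α : ℝ} (hα : 0 < α)
    (h : ∀ s, μ (Iic s) ≤ ν (Iic (s + d))) :
    ∫⁻ y, ENNReal.ofReal (Real.exp (-y / α)) ∂μ
      ≤ ∫⁻ y, ENNReal.ofReal (Real.exp (d / α) * Real.exp (-y / α)) ∂ν := by
  rw [lintegral_eq_lintegral_meas_le _ (ae_of_all _ fun y => (Real.exp_nonneg _)) (by fun_prop),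
    lintegral_eq_lintegral_meas_le _ (ae_of_all _ fun y => by positivity) (by fun_prop)]
  refine setLIntegral_mono' measurableSet_Ioi fun t ht => ?_
  have ht' : 0 < t := ht
  have e1 : {y : ℝ | t ≤ Real.exp (-y / α)} = Iic (-α * Real.log t) := by
    ext y
    rw [mem_ofPred_eq, ← Real.log_le_iff_le_exp ht', le_div_iff₀ hα, mem_Iic]
    constructor <;> intro <;> linarith
  have e2 : {y : ℝ | t ≤ Real.exp (d / α) * Real.exp (-y / α)} = Iic (-α * Real.log t + d) := by
    ext y
    rw [mem_ofPred_eq, ← Real.exp_add, ← add_div, ← Real.log_le_iff_le_exp ht', le_div_iff₀ hα,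
      mem_Iic]
    constructor <;> intro <;> linarith
  rw [e1, e2]
  exact h _

/-- A stochastic order up to a shift by `d` moves the dual objective by at most `d`, uniformly in
`α`. -/
lemma neg_mul_log_le_of_Iic_le {μ ν : Measure ℝ} [IsProbabilityMeasure μ] [IsProbabilityMeasure ν]
    {M : ℝ} (hμ : ∀ᵐ y ∂μ, y ∈ Icc 0 M) (hν : ∀ᵐ y ∂ν, y ∈ Icc 0 M) {d α : ℝ} (hα : 0 < α)
    (h : ∀ s, μ (Iic s) ≤ ν (Iic (s + d))) :
    -α * Real.log (∫ y, Real.exp (-y / α) ∂ν) ≤ -α * Real.log (∫ y, Real.exp (-y / α) ∂μ) + d := by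
  have hint : ∀ (ρ : Measure ℝ) [IsProbabilityMeasure ρ], (∀ᵐ y ∂ρ, y ∈ Icc 0 M) →
      Integrable (fun y => Real.exp (-y / α)) ρ := by
    intro ρ _ hρ
    have := integrable_exp_mul_of_mem_Icc (t := -(1 / α)) (X := id) (a := 0) (b := M)
      aemeasurable_id hρ
    refine this.congr (ae_of_all _ fun y => ?_)
    simp only [id]
    ring_nf
  have key : ∫ y, Real.exp (-y / α) ∂μ ≤ Real.exp (d / α) * ∫ y, Real.exp (-y / α) ∂ν := by
    rw [← integral_const_mul,
      integral_eq_lintegral_of_nonneg_ae (ae_of_all _ fun y => (Real.exp_nonneg _))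
        (hint μ hμ).aestronglyMeasurable,
      integral_eq_lintegral_of_nonneg_ae (ae_of_all _ fun y => by positivity)
        ((hint ν hν).const_mul _).aestronglyMeasurable]
    refine ENNReal.toReal_mono ?_ (lintegral_exp_le_of_Iic_le hα h)
    exact ((hint ν hν).const_mul _).lintegral_lt_top.ne
  have h1 := Real.log_le_log (integral_exp_pos (hint μ hμ)) key
  rw [Real.log_mul (Real.exp_pos _).ne' (integral_exp_pos (hint ν hν)).ne', Real.log_exp] at h1
  have h2 := mul_le_mul_of_nonneg_left h1 hα.le
  rw [mul_add, mul_div_cancel₀ _ hα.ne'] at h2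
  linarith

lemma measure_Iic_eq_zero_of_neg {μ : Measure ℝ} {M : ℝ} (hμ : ∀ᵐ y ∂μ, y ∈ Icc 0 M) {s : ℝ}
    (hs : s < 0) : μ (Iic s) = 0 :=
  measure_mono_null (fun y (hy : y ≤ s) => by
    rw [mem_compl_iff, mem_ofPred_eq]; exact fun hy' => by linarith [hy'.1]) hμ

lemma measure_Iic_eq_one {μ : Measure ℝ} [IsProbabilityMeasure μ] {M : ℝ}
    (hμ : ∀ᵐ y ∂μ, y ∈ Icc 0 M) {s : ℝ} (hs : M ≤ s) : μ (Iic s) = 1 := by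
  rw [← prob_compl_eq_zero_iff measurableSet_Iic]
  refine measure_mono_null (fun y hy => ?_) hμ
  rw [mem_compl_iff, mem_ofPred_eq]
  exact fun hy' => hy (hy'.2.trans hs)

/-- A uniform bound `D` on the difference of the distribution functions becomes a bound `D / ε` on
the difference of the quantile functions if one of the laws has density at least `ε`. -/
lemma Iic_le_Iic_add_of_cdf_close {μ ν : Measure ℝ} [IsProbabilityMeasure μ]
    [IsProbabilityMeasure ν] {M ε D : ℝ} (hμ : ∀ᵐ y ∂μ, y ∈ Icc 0 M) (hν : ∀ᵐ y ∂ν, y ∈ Icc 0 M)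
    (hε : 0 < ε) (hlow : ENNReal.ofReal ε • volume.restrict (Icc 0 M) ≤ ν)
    (hD : ∀ t, |μ.real (Iic t) - ν.real (Iic t)| ≤ D) (s : ℝ) :
    μ (Iic s) ≤ ν (Iic (s + D / ε)) ∧ ν (Iic s) ≤ μ (Iic (s + D / ε)) := by
  have hD0 : 0 ≤ D := (abs_nonneg _).trans (hD 0)
  have hd0 : 0 ≤ D / ε := by positivity
  rcases lt_or_ge s 0 with hs | hs
  · simp [measure_Iic_eq_zero_of_neg hμ hs, measure_Iic_eq_zero_of_neg hν hs]
  rcases lt_or_ge M (s + D / ε) with hsM | hsM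
  · rw [measure_Iic_eq_one hμ hsM.le, measure_Iic_eq_one hν hsM.le]
    exact ⟨prob_le_one, prob_le_one⟩
  have hgrow : ν.real (Iic s) + D ≤ ν.real (Iic (s + D / ε)) := by
    have h1 : D ≤ ν.real (Ioc s (s + D / ε)) := by
      have h2 := hlow (Ioc s (s + D / ε))
      have hsub : Ioc s (s + D / ε) ⊆ Icc 0 M := fun y hy =>
        ⟨hs.trans hy.1.le, hy.2.trans hsM⟩
      rw [Measure.smul_apply, Measure.restrict_apply measurableSet_Ioc,
        inter_eq_left.2 hsub, Real.volume_Ioc, smul_eq_mul,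
        ← ENNReal.ofReal_mul hε.le] at h2
      have h3 := (ENNReal.ofReal_le_iff_le_toReal (measure_ne_top _ _)).1 h2
      rwa [add_sub_cancel_left, mul_div_cancel₀ _ hε.ne'] at h3
    have h4 : ν.real (Iic s ∪ Ioc s (s + D / ε)) = ν.real (Iic s) + ν.real (Ioc s (s + D / ε)) :=
      measureReal_union (Iic_disjoint_Ioc le_rfl) measurableSet_Ioc
    rw [Iic_union_Ioc_eq_Iic (by linarith)] at h4
    linarith
  have h1 := abs_le.1 (hD s)
  have h2 := abs_le.1 (hD (s + D / ε))
  constructor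
  · refine (ENNReal.toReal_le_toReal (measure_ne_top _ _) (measure_ne_top _ _)).1 ?_
    change μ.real _ ≤ ν.real _
    linarith
  · refine (ENNReal.toReal_le_toReal (measure_ne_top _ _) (measure_ne_top _ _)).1 ?_
    change ν.real _ ≤ μ.real _
    linarith

/-! ### Kernel smoothing bias -/

/-- Second differences of a twice differentiable function; the constant is not optimal, and needs no
integrability of the second derivative. -/
lemma abs_second_difference_le {ψ : ℝ → ℝ} {p ρ B : ℝ}
    (h0 : ∀ a ∈ Ioo (p - ρ) (p + ρ), DifferentiableAt ℝ ψ a)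
    (h1 : ∀ a ∈ Ioo (p - ρ) (p + ρ), DifferentiableAt ℝ (deriv ψ) a)
    (h2 : ∀ a ∈ Ioo (p - ρ) (p + ρ), |deriv (deriv ψ) a| ≤ B) {v : ℝ} (hv : |v| < ρ) :
    |ψ (p + v) + ψ (p - v) - 2 * ψ p| ≤ 2 * B * v ^ 2 := by
  have hρ : 0 < ρ := (abs_nonneg v).trans_lt hv
  have hB : 0 ≤ B := (abs_nonneg _).trans (h2 p ⟨by linarith, by linarith⟩)
  have hmem : ∀ u ∈ Icc (-|v|) |v|, p + u ∈ Ioo (p - ρ) (p + ρ) ∧ p - u ∈ Ioo (p - ρ) (p + ρ) :=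
    fun u hu => ⟨⟨by linarith [hu.1], by linarith [hu.2]⟩, ⟨by linarith [hu.2], by linarith [hu.1]⟩⟩
  have hd : ∀ u ∈ Icc (-|v|) |v|, HasDerivAt (fun u => ψ (p + u) + ψ (p - u))
      (deriv ψ (p + u) - deriv ψ (p - u)) u := by
    intro u hu
    have e1 := ((h0 _ (hmem u hu).1).hasDerivAt).comp_const_add p u
    have e2 := ((h0 _ (hmem u hu).2).hasDerivAt).comp_const_sub p u
    exact (e1.add e2).congr_deriv (by ring)
  have hbound : ∀ u ∈ Icc (-|v|) |v|, ‖deriv (fun u => ψ (p + u) + ψ (p - u)) u‖ ≤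
      2 * B * |v| := by
    intro u hu
    rw [(hd u hu).deriv]
    have := Convex.norm_image_sub_le_of_norm_deriv_le (f := deriv ψ) h1 h2 (convex_Ioo _ _)
      (hmem u hu).2 (hmem u hu).1
    refine this.trans ?_
    have e : p + u - (p - u) = 2 * u := by ring
    rw [e, Real.norm_eq_abs, abs_mul, abs_two]
    have : |u| ≤ |v| := abs_le.2 hu
    nlinarith
  have := Convex.norm_image_sub_le_of_norm_deriv_le (x := 0) (y := v)
    (fun u hu => (hd u hu).differentiableAt) hbound (convex_Icc _ _)
    ⟨by linarith [abs_nonneg v], abs_nonneg v⟩ ⟨neg_abs_le v, le_abs_self v⟩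
  simp only [add_zero, sub_zero, Real.norm_eq_abs] at this
  calc |ψ (p + v) + ψ (p - v) - 2 * ψ p| = |ψ (p + v) + ψ (p - v) - (ψ p + ψ p)| := by ring_nf
    _ ≤ 2 * B * |v| * |v| := this
    _ = 2 * B * v ^ 2 := by rw [mul_assoc, ← abs_mul, abs_mul_self]; ring

lemma IsLipschitzKernel.continuous {K : ℝ → ℝ} {MK LK : ℝ} (hK : IsLipschitzKernel K MK LK) :
    Continuous K :=
  (LipschitzWith.of_dist_le_mul (K := ⟨LK, hK.lipschitz_pos.le⟩) fun u v => by
    rw [Real.dist_eq, Real.dist_eq]; exact hK.lipschitz u v).continuous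

lemma IsLipschitzKernel.bound_pos {K : ℝ → ℝ} {MK LK : ℝ} (hK : IsLipschitzKernel K MK LK) :
    0 < MK := by
  by_contra h
  have : ∀ u, K u = 0 := fun u =>
    abs_nonpos_iff.1 ((hK.bounded u).trans (not_lt.1 h))
  have h1 := hK.integral_eq_one
  simp [this] at h1

/-- Smoothing with a symmetric kernel has a bias of order `h ^ 2` at a point around which the second
differences are quadratic; far from the point, the second moment of the kernel takes over. -/
lemma abs_kernel_smoothing_sub_le {K : ℝ → ℝ} {MK LK : ℝ} (hK : IsLipschitzKernel K MK LK)
    {H : ℝ → ℝ} (hH : Measurable H) (hH0 : ∀ a, 0 ≤ H a) (hH1 : ∀ a, H a ≤ 1) {p ρ c h : ℝ}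
    (hρ : 0 < ρ) (hc : 0 ≤ c) (hh : 0 < h)
    (hsd : ∀ v, |v| < ρ → |H (p + v) + H (p - v) - 2 * H p| ≤ c * v ^ 2) :
    Integrable (fun a => 1 / h * K ((p - a) / h) * H a) ∧
    |(∫ a, 1 / h * K ((p - a) / h) * H a) - H p| ≤
      (c + 2 / ρ ^ 2) * (∫ u, u ^ 2 * K u) * h ^ 2 := by
  have hKm : Measurable K := hK.continuous.measurable
  have bnd : ∀ (g : ℝ → ℝ), Measurable g → (∀ a, 0 ≤ g a) → (∀ a, g a ≤ 1) →
      Integrable fun v => K v * g v := by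
    intro g hg g0 g1
    refine hK.integrable.mono (hKm.mul hg).aestronglyMeasurable (ae_of_all _ fun v => ?_)
    rw [norm_mul, Real.norm_eq_abs (g v), abs_of_nonneg (g0 v)]
    exact mul_le_of_le_one_right (norm_nonneg _) (g1 v)
  have i1 : Integrable fun v => K v * H (p - h * v) :=
    bnd _ (by fun_prop) (fun _ => hH0 _) fun _ => hH1 _
  have i2 : Integrable fun v => K v * H (p + h * v) :=
    bnd _ (by fun_prop) (fun _ => hH0 _) fun _ => hH1 _
  have hint : Integrable (fun a => 1 / h * K ((p - a) / h) * H a) := by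
    have := ((i1.comp_div hh.ne').comp_sub_left p).const_mul (1 / h)
    refine this.congr (ae_of_all _ fun a => ?_)
    simp only
    rw [mul_div_cancel₀ _ hh.ne', sub_sub_cancel, mul_assoc]
  refine ⟨hint, ?_⟩
  have e1 : ∫ a, 1 / h * K ((p - a) / h) * H a = ∫ v, K v * H (p - h * v) := by
    have s1 := integral_sub_left_eq_self (fun a => 1 / h * K (a / h) * H (p - a)) volume p
    simp only [sub_sub_cancel] at s1
    rw [s1]
    have s2 := Measure.integral_comp_div (fun v => 1 / h * (K v * H (p - h * v))) h
    rw [abs_of_pos hh, smul_eq_mul, integral_const_mul (1 / h) fun v => K v * H (p - h * v),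
      ← mul_assoc, mul_one_div_cancel hh.ne', one_mul] at s2
    rw [← s2]
    refine integral_congr_ae (ae_of_all _ fun a => ?_)
    simp only
    rw [mul_div_cancel₀ _ hh.ne', mul_assoc]
  have e2 : ∫ v, K v * H (p - h * v) = ∫ v, K v * H (p + h * v) := by
    rw [← integral_neg_eq_self]
    refine integral_congr_ae (ae_of_all _ fun v => ?_)
    simp only [hK.symmetric, mul_neg, sub_neg_eq_add]
  have e3 : 2 * ((∫ v, K v * H (p - h * v)) - H p)
      = ∫ v, K v * (H (p + h * v) + H (p - h * v) - 2 * H p) := by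
    have : ∀ v, K v * (H (p + h * v) + H (p - h * v) - 2 * H p)
        = K v * H (p + h * v) + K v * H (p - h * v) - 2 * H p * K v := fun v => by ring
    simp_rw [this]
    rw [integral_sub (f := fun v => K v * H (p + h * v) + K v * H (p - h * v))
      (i2.add i1) (hK.integrable.const_mul _), integral_add i2 i1,
      integral_const_mul, hK.integral_eq_one, e2]
    ring
  set σ := ∫ u, u ^ 2 * K u with hσ
  have hσ0 : 0 ≤ σ := integral_nonneg fun u => mul_nonneg (sq_nonneg u) (hK.nonneg u)
  have key : |∫ v, K v * (H (p + h * v) + H (p - h * v) - 2 * H p)| ≤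
      (c + 2 / ρ ^ 2) * h ^ 2 * σ := by
    rw [hσ, ← integral_const_mul, ← Real.norm_eq_abs]
    refine norm_integral_le_of_norm_le (hK.integrable_sq_mul.const_mul _) (ae_of_all _ fun v => ?_)
    rw [norm_mul, Real.norm_eq_abs, Real.norm_eq_abs, abs_of_nonneg (hK.nonneg v)]
    have : |H (p + h * v) + H (p - h * v) - 2 * H p| ≤ (c + 2 / ρ ^ 2) * (h * v) ^ 2 := by
      rw [add_mul]
      rcases lt_or_ge |h * v| ρ with hlt | hge
      · exact (hsd _ hlt).trans (le_add_of_nonneg_right (by positivity))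
      · have h2 : |H (p + h * v) + H (p - h * v) - 2 * H p| ≤ 2 := by
          rw [abs_le]
          constructor <;>
            linarith [hH0 (p + h * v), hH0 (p - h * v), hH0 p, hH1 (p + h * v), hH1 (p - h * v),
              hH1 p]
        refine h2.trans (le_add_of_nonneg_of_le (by positivity) ?_)
        have h3 : ρ ^ 2 ≤ (h * v) ^ 2 := by
          rw [← sq_abs (h * v)]; gcongr
        rw [div_mul_eq_mul_div, le_div_iff₀ (by positivity)]
        linarith
    calc K v * |H (p + h * v) + H (p - h * v) - 2 * H p|
        ≤ K v * ((c + 2 / ρ ^ 2) * (h * v) ^ 2) := mul_le_mul_of_nonneg_left this (hK.nonneg v)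
      _ = (c + 2 / ρ ^ 2) * h ^ 2 * (v ^ 2 * K v) := by ring
  rw [← e3, abs_mul, abs_two, ← e1] at key
  have : 0 ≤ (c + 2 / ρ ^ 2) * h ^ 2 * σ := by positivity
  nlinarith [abs_nonneg ((∫ a, 1 / h * K ((p - a) / h) * H a) - H p)]

namespace CausalModel

variable {Ω 𝒳 𝒰 : Type*} [MeasurableSpace Ω] [MeasurableSpace 𝒳] [MeasurableSpace 𝒰]
  {m : CausalModel Ω 𝒳 𝒰} {ε B : ℝ} {K : ℝ → ℝ} {MK LK h : ℝ}

/-! ### Truncated weights -/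

/-- The weight with the density in the denominator truncated from below at `ε`.  It agrees almost
surely with `weight` and is bounded everywhere. -/
noncomputable def truncWeight (m : CausalModel Ω 𝒳 𝒰) (ε : ℝ) (K : ℝ → ℝ) (h : ℝ) (π : 𝒳 → ℝ)
    (z : 𝒳 × ℝ × ℝ) : ℝ :=
  (1 / h * K ((π z.1 - z.2.1) / h)) / max (m.fA z.2.1 z.1) ε

lemma weight_eq_truncWeight {π : 𝒳 → ℝ} {z : 𝒳 × ℝ × ℝ} (hz : ε ≤ m.fA z.2.1 z.1) :
    m.weight K h π z = m.truncWeight ε K h π z := by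
  rw [weight, truncWeight, max_eq_left hz]

lemma truncWeight_nonneg (hε : 0 < ε) (hK : IsLipschitzKernel K MK LK) (hh : 0 < h) (π : 𝒳 → ℝ)
    (z : 𝒳 × ℝ × ℝ) : 0 ≤ m.truncWeight ε K h π z :=
  div_nonneg (mul_nonneg (by positivity) (hK.nonneg _)) (hε.le.trans (le_max_right _ _))

lemma truncWeight_le (hε : 0 < ε) (hK : IsLipschitzKernel K MK LK) (hh : 0 < h) (π : 𝒳 → ℝ)
    (z : 𝒳 × ℝ × ℝ) : m.truncWeight ε K h π z ≤ MK / (h * ε) := by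
  have h1 : K ((π z.1 - z.2.1) / h) ≤ MK := (le_abs_self _).trans (hK.bounded _)
  calc m.truncWeight ε K h π z ≤ (1 / h * MK) / ε :=
        div_le_div₀ (mul_nonneg (by positivity) hK.bound_pos.le) (by gcongr) hε (le_max_right _ _)
    _ = MK / (h * ε) := by field_simp

lemma abs_truncWeight_sub_le (hε : 0 < ε) (hK : IsLipschitzKernel K MK LK) (hh : 0 < h)
    (π π' : 𝒳 → ℝ) (z : 𝒳 × ℝ × ℝ) :
    |m.truncWeight ε K h π z - m.truncWeight ε K h π' z| ≤
      LK / (h ^ 2 * ε) * |π z.1 - π' z.1| := by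
  have hmax : 0 < max (m.fA z.2.1 z.1) ε := hε.trans_le (le_max_right _ _)
  unfold truncWeight
  rw [← sub_div, ← mul_sub, abs_div, abs_mul, abs_of_pos hmax, abs_of_pos (by positivity : 0 < 1 / h)]
  have h1 := hK.lipschitz ((π z.1 - z.2.1) / h) ((π' z.1 - z.2.1) / h)
  have e : (π z.1 - z.2.1) / h - (π' z.1 - z.2.1) / h = (π z.1 - π' z.1) / h := by ring
  rw [e, abs_div, abs_of_pos hh] at h1
  have hLK := hK.lipschitz_pos
  calc _ ≤ (1 / h * (LK * (|π z.1 - π' z.1| / h))) / ε :=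
        div_le_div₀ (by positivity) (by gcongr) hε (le_max_right _ _)
    _ = _ := by field_simp

lemma interior_of_margin {π : 𝒳 → ℝ} {ρ : ℝ} (hπ : ∀ x, Icc (π x - ρ) (π x + ρ) ⊆ m.actions)
    (x : 𝒳) : Ioo (π x - ρ) (π x + ρ) ⊆ interior m.actions :=
  interior_maximal (Ioo_subset_Icc_self.trans (hπ x)) isOpen_Ioo

lemma mem_actions_of_margin {π : 𝒳 → ℝ} {ρ : ℝ} (hρ : 0 < ρ)
    (hπ : ∀ x, Icc (π x - ρ) (π x + ρ) ⊆ m.actions) (x : 𝒳) : π x ∈ m.actions :=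
  hπ x ⟨by linarith, by linarith⟩

variable [StandardBorelSpace 𝒰] [Nonempty 𝒰]

/-- The conditional distribution function of the potential outcome `Y(a)` given `X = x`, at `t`;
it is set to `0` for `a` outside the treatment set. -/
noncomputable def condCdf (m : CausalModel Ω 𝒳 𝒰) (t : ℝ) (x : 𝒳) (a : ℝ) : ℝ :=
  m.actions.indicator (fun a => (condDistrib m.U m.X m.P0 x).real {u | m.outcome a u ≤ t}) a

lemma condCdf_nonneg (t : ℝ) (x : 𝒳) (a : ℝ) : 0 ≤ m.condCdf t x a :=
  indicator_nonneg (fun _ _ => measureReal_nonneg) _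

lemma condCdf_le_one (t : ℝ) (x : 𝒳) (a : ℝ) : m.condCdf t x a ≤ 1 :=
  indicator_le' (fun _ _ => measureReal_le_one) (fun _ _ => zero_le_one) _

variable [StandardBorelSpace Ω]

/-! ### The observed law -/

namespace Assumptions

lemma measurable_Y (hm : m.Assumptions ε B) : Measurable m.Y :=
  hm.measurable_outcome.comp (hm.measurable_A.prodMk hm.measurable_U)

lemma measurable_Ypolicy (hm : m.Assumptions ε B) {π : 𝒳 → ℝ} (hπ : Measurable π) :
    Measurable (m.Ypolicy π) :=
  hm.measurable_outcome.comp ((hπ.comp hm.measurable_X).prodMk hm.measurable_U)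

lemma isProbabilityMeasure_map_X (hm : m.Assumptions ε B) :
    IsProbabilityMeasure (m.P0.map m.X) :=
  Measure.isProbabilityMeasure_map hm.measurable_X.aemeasurable

/-- Under unconfoundedness, `(X, A, U)` has the law `P_X(dx) f₀(a | x) da P_{U | X = x}(du)`. -/
lemma lintegral_eq (hm : m.Assumptions ε B) {φ : (𝒳 × ℝ) × 𝒰 → ENNReal} (hφ : Measurable φ) :
    ∫⁻ ω, φ ((m.X ω, m.A ω), m.U ω) ∂m.P0 = ∫⁻ x, (∫⁻ a, ENNReal.ofReal (m.fA a x) *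
      ∫⁻ u, φ ((x, a), u) ∂(condDistrib m.U m.X m.P0 x)) ∂(m.P0.map m.X) := by
  have := hm.isProbabilityMeasure_map_X
  have hXA : Measurable fun ω => (m.X ω, m.A ω) := hm.measurable_X.prodMk hm.measurable_A
  have h1 := (condIndepFun_iff_condDistrib_prod_ae_eq_prodMkRight hm.measurable_U hm.measurable_A
    hm.measurable_X).1 hm.unconfounded.symm
  have h2 := (condDistrib_ae_eq_iff_measure_eq_compProd (μ := m.P0) (fun ω => (m.X ω, m.A ω))
    hm.measurable_U.aemeasurable _).1 h1
  have hm1 : Measurable fun q : 𝒳 × ℝ =>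
      ∫⁻ u, φ (q, u) ∂((condDistrib m.U m.X m.P0).prodMkRight ℝ q) := hφ.lintegral_kernel_prod_right'
  have hfA : Measurable fun q : 𝒳 × ℝ => ENNReal.ofReal (m.fA q.2 q.1) :=
    (hm.measurable_fA.comp measurable_swap).ennreal_ofReal
  calc ∫⁻ ω, φ ((m.X ω, m.A ω), m.U ω) ∂m.P0
      = ∫⁻ q, φ q ∂(m.P0.map fun ω => ((m.X ω, m.A ω), m.U ω)) :=
        (lintegral_map hφ (hXA.prodMk hm.measurable_U)).symm
    _ = ∫⁻ q, ∫⁻ u, φ (q, u) ∂((condDistrib m.U m.X m.P0).prodMkRight ℝ q)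
          ∂(m.P0.map fun ω => (m.X ω, m.A ω)) := by
        rw [h2, Measure.lintegral_compProd hφ]
    _ = ∫⁻ q, ((fun q : 𝒳 × ℝ => ENNReal.ofReal (m.fA q.2 q.1)) * fun q : 𝒳 × ℝ =>
          ∫⁻ u, φ (q, u) ∂((condDistrib m.U m.X m.P0).prodMkRight ℝ q)) q
          ∂((m.P0.map m.X).prod volume) := by
        rw [hm.fA_density, lintegral_withDensity_eq_lintegral_mul _ hfA hm1]
    _ = _ := by
        rw [lintegral_prod _ (hfA.mul hm1).aemeasurable]
        rfl

lemma lintegral_policy_eq (hm : m.Assumptions ε B) {φ : 𝒳 × 𝒰 → ENNReal} (hφ : Measurable φ) :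
    ∫⁻ ω, φ (m.X ω, m.U ω) ∂m.P0 =
      ∫⁻ x, ∫⁻ u, φ (x, u) ∂(condDistrib m.U m.X m.P0 x) ∂(m.P0.map m.X) := by
  have := hm.isProbabilityMeasure_map_X
  rw [← Measure.lintegral_compProd hφ, compProd_map_condDistrib hm.measurable_U.aemeasurable,
    lintegral_map hφ (hm.measurable_X.prodMk hm.measurable_U)]

/-- The density of the treatment vanishes off the treatment set and is at least `ε` on it. -/
lemma ae_fA (hm : m.Assumptions ε B) : ∀ᵐ q ∂((m.P0.map m.X).prod volume),
    (q.2 ∈ m.actions → ε ≤ m.fA q.2 q.1) ∧ (q.2 ∉ m.actions → m.fA q.2 q.1 = 0) := by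
  have := hm.isProbabilityMeasure_map_X
  have hfA : Measurable fun q : 𝒳 × ℝ => m.fA q.2 q.1 := hm.measurable_fA.comp measurable_swap
  have hset : MeasurableSet {q : 𝒳 × ℝ | q.2 ∈ m.actions → ε ≤ m.fA q.2 q.1} := by
    have : {q : 𝒳 × ℝ | q.2 ∈ m.actions → ε ≤ m.fA q.2 q.1}
        = (Prod.snd ⁻¹' m.actions)ᶜ ∪ {q | ε ≤ m.fA q.2 q.1} := by
      ext q
      simp only [mem_ofPred_eq, mem_union, mem_compl_iff, mem_preimage]
      exact imp_iff_not_or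
    rw [this]
    exact (measurable_snd hm.measurableSet_actions).compl.union
      (measurableSet_le measurable_const hfA)
  have h1 : ∀ᵐ q ∂((m.P0.map m.X).prod volume), q.2 ∈ m.actions → ε ≤ m.fA q.2 q.1 := by
    rw [Measure.ae_prod_iff_ae_ae hset, Measure.ae_ae_comm hset]
    refine ae_of_all _ fun a => ?_
    by_cases ha : a ∈ m.actions
    · filter_upwards [hm.positivity a ha] with x hx _ using hx
    · exact ae_of_all _ fun x hx => absurd hx ha
  have h2 : ∀ᵐ q ∂(m.P0.map fun ω => (m.X ω, m.A ω)), q.2 ∈ m.actions := by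
    rw [ae_map_iff (hm.measurable_X.prodMk hm.measurable_A).aemeasurable
      (measurable_snd hm.measurableSet_actions)]
    exact hm.A_mem
  rw [hm.fA_density, ae_withDensity_iff hfA.ennreal_ofReal] at h2
  filter_upwards [h1, h2] with q hq1 hq2
  refine ⟨hq1, fun hq => ?_⟩
  by_contra hne
  exact hq (hq2 (by simpa using lt_of_le_of_ne (hm.fA_nonneg _ _) (Ne.symm hne)))

lemma ae_le_fA (hm : m.Assumptions ε B) : ∀ᵐ ω ∂m.P0, ε ≤ m.fA (m.A ω) (m.X ω) := by
  have hfA : Measurable fun q : 𝒳 × ℝ => m.fA q.2 q.1 := hm.measurable_fA.comp measurable_swap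
  have h : ∀ᵐ q ∂(m.P0.map fun ω => (m.X ω, m.A ω)), ε ≤ m.fA q.2 q.1 := by
    rw [hm.fA_density, ae_withDensity_iff hfA.ennreal_ofReal]
    filter_upwards [hm.ae_fA] with q hq hne
    by_cases ha : q.2 ∈ m.actions
    · exact hq.1 ha
    · exact absurd (by rw [hq.2 ha, ENNReal.ofReal_zero]) hne
  rwa [ae_map_iff (hm.measurable_X.prodMk hm.measurable_A).aemeasurable
    (measurableSet_le measurable_const hfA)] at h

end Assumptions

/-! ### The bias of the weighted distribution function -/

lemma Assumptions.measurable_condCdf (hm : m.Assumptions ε B) (t : ℝ) :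
    Measurable fun q : 𝒳 × ℝ => m.condCdf t q.1 q.2 := by
  have hS : MeasurableSet {r : (𝒳 × ℝ) × 𝒰 | m.outcome r.1.2 r.2 ≤ t} :=
    measurableSet_le (hm.measurable_outcome.comp
      ((measurable_snd.comp measurable_fst).prodMk measurable_snd)) measurable_const
  have h := Kernel.measurable_kernel_prodMk_left
    (κ := (condDistrib m.U m.X m.P0).prodMkRight ℝ) hS
  exact (h.ennreal_toReal).indicator (measurable_snd hm.measurableSet_actions)

lemma Assumptions.measurable_fY_left (hm : m.Assumptions ε B) (a : ℝ) (x : 𝒳) :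
    Measurable fun y => m.fY y a x :=
  hm.measurable_fY.comp
    (measurable_id.prodMk measurable_const : Measurable fun y : ℝ => (y, (a, x)))

/-- Second differences of the conditional distribution function, from the bound on the second
derivative of the conditional density. -/
lemma Assumptions.ae_second_difference_condCdf (hm : m.Assumptions ε B) (t : ℝ) {π : 𝒳 → ℝ}
    {ρ : ℝ} (hπ : ∀ x, Icc (π x - ρ) (π x + ρ) ⊆ m.actions) :
    ∀ᵐ x ∂(m.P0.map m.X), ∀ v, |v| < ρ →
      |m.condCdf t x (π x + v) + m.condCdf t x (π x - v) - 2 * m.condCdf t x (π x)| ≤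
        2 * |B| * m.M * v ^ 2 := by
  filter_upwards [hm.fY_density, hm.fY_diff, hm.fY_bound] with x hdens hdiff hbound v hv
  have hint := interior_of_margin hπ x
  have hρ : 0 < ρ := (abs_nonneg v).trans_lt hv
  have hv' := abs_lt.1 hv
  set S : Set ℝ := Iic t ∩ Icc 0 m.M with hS
  have hSm : MeasurableSet S := measurableSet_Iic.inter measurableSet_Icc
  have hSfin : volume S ≠ ⊤ := ne_top_of_le_ne_top (by simp) (measure_mono inter_subset_right)
  have hSvol : volume.real S ≤ m.M := by
    refine (measureReal_mono inter_subset_right (by simp)).trans ?_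
    rw [Real.volume_real_Icc_of_le hm.M_pos.le, sub_zero]
  have hfYint : ∀ a ∈ interior m.actions, IntegrableOn (fun y => m.fY y a x) S := by
    intro a ha
    refine Integrable.mono' (g := fun _ => B) (integrableOn_const hSfin)
      (hm.measurable_fY_left a x).aestronglyMeasurable ?_
    rw [ae_restrict_iff' hSm]
    exact ae_of_all _ fun y hy => by simpa using hbound y hy.2 a ha 0 (by norm_num)
  have hcdf : ∀ a ∈ interior m.actions, m.condCdf t x a = ∫ y in S, m.fY y a x := by
    intro a ha
    have haA : a ∈ m.actions := interior_subset ha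
    have hout : Measurable (m.outcome a) :=
      hm.measurable_outcome.comp (measurable_const.prodMk measurable_id)
    rw [condCdf, indicator_of_mem haA, integral_eq_lintegral_of_nonneg_ae
      (ae_of_all _ fun y => hm.fY_nonneg _ _ _) (hfYint a ha).aestronglyMeasurable]
    have h1 : condDistrib m.U m.X m.P0 x {u | m.outcome a u ≤ t}
        = (condDistrib m.U m.X m.P0 x).map (m.outcome a) (Iic t) :=
      (Measure.map_apply hout measurableSet_Iic).symm
    rw [measureReal_def, h1, hdens a haA, withDensity_apply _ measurableSet_Iic,
      Measure.restrict_restrict measurableSet_Iic]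
  have m1 : π x + v ∈ interior m.actions := hint ⟨by linarith, by linarith⟩
  have m2 : π x - v ∈ interior m.actions := hint ⟨by linarith, by linarith⟩
  have m3 : π x ∈ interior m.actions := hint ⟨by linarith, by linarith⟩
  rw [hcdf _ m1, hcdf _ m2, hcdf _ m3, ← integral_add (hfYint _ m1) (hfYint _ m2),
    ← integral_const_mul, ← integral_sub
      (f := fun y => m.fY y (π x + v) x + m.fY y (π x - v) x) ((hfYint _ m1).add (hfYint _ m2))
      ((hfYint _ m3).const_mul 2)]
  have hsd : ∀ y ∈ S, ‖m.fY y (π x + v) x + m.fY y (π x - v) x - 2 * m.fY y (π x) x‖ ≤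
      2 * |B| * v ^ 2 := by
    intro y hy
    have hop : ∀ a ∈ interior m.actions, interior m.actions ∈ 𝓝 a := fun a ha =>
      isOpen_interior.mem_nhds ha
    refine abs_second_difference_le (ψ := fun a => m.fY y a x) (p := π x) (ρ := ρ)
      (fun a ha => ?_) (fun a ha => ?_) (fun a ha => ?_) hv
    · have := hdiff y hy.2 0 (by norm_num)
      rw [iteratedDeriv_zero] at this
      exact this.differentiableAt (hop a (hint ha))
    · have := hdiff y hy.2 1 (by norm_num)
      rw [iteratedDeriv_one] at this
      exact this.differentiableAt (hop a (hint ha))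
    · have := hbound y hy.2 a (hint ha) 2 (by norm_num)
      rw [iteratedDeriv_succ, iteratedDeriv_one] at this
      exact this.trans (le_abs_self B)
  refine (norm_setIntegral_le_of_norm_le_const hSfin.lt_top hsd).trans ?_
  calc 2 * |B| * v ^ 2 * volume.real S ≤ 2 * |B| * v ^ 2 * m.M := by gcongr
    _ = 2 * |B| * m.M * v ^ 2 := by ring

lemma Assumptions.map_Ypolicy_Iic (hm : m.Assumptions ε B) {π : 𝒳 → ℝ} (hπm : Measurable π)
    {ρ : ℝ} (hρ : 0 < ρ) (hπ : ∀ x, Icc (π x - ρ) (π x + ρ) ⊆ m.actions) (t : ℝ) :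
    m.P0.map (m.Ypolicy π) (Iic t)
      = ∫⁻ x, ENNReal.ofReal (m.condCdf t x (π x)) ∂(m.P0.map m.X) := by
  have hout : Measurable fun r : 𝒳 × 𝒰 => m.outcome (π r.1) r.2 :=
    hm.measurable_outcome.comp ((hπm.comp measurable_fst).prodMk measurable_snd)
  have hset : MeasurableSet {r : 𝒳 × 𝒰 | m.outcome (π r.1) r.2 ≤ t} :=
    measurableSet_le hout measurable_const
  rw [Measure.map_apply (hm.measurable_Ypolicy hπm) measurableSet_Iic,
    ← lintegral_indicator_one (hm.measurable_Ypolicy hπm measurableSet_Iic)]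
  have h := hm.lintegral_policy_eq (φ := {r : 𝒳 × 𝒰 | m.outcome (π r.1) r.2 ≤ t}.indicator 1)
    (measurable_one.indicator hset)
  refine Eq.trans ?_ (h.trans ?_)
  · rfl
  · refine lintegral_congr fun x => ?_
    have hx : MeasurableSet {u | m.outcome (π x) u ≤ t} := measurable_prodMk_left hset
    have e : ∀ u, {r : 𝒳 × 𝒰 | m.outcome (π r.1) r.2 ≤ t}.indicator (1 : 𝒳 × 𝒰 → ENNReal) (x, u)
        = {u | m.outcome (π x) u ≤ t}.indicator 1 u := fun u => rfl
    simp_rw [e]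
    rw [lintegral_indicator_one hx, condCdf, indicator_of_mem (mem_actions_of_margin hρ hπ x),
      ofReal_measureReal]

/-- Bounded conditional densities give the law of `Y(π(X))` a bounded density. -/
lemma Assumptions.map_Ypolicy_le (hm : m.Assumptions ε B) {π : 𝒳 → ℝ} (hπm : Measurable π)
    {ρ : ℝ} (hρ : 0 < ρ) (hπ : ∀ x, Icc (π x - ρ) (π x + ρ) ⊆ m.actions) :
    m.P0.map (m.Ypolicy π) ≤ ENNReal.ofReal B • volume.restrict (Icc 0 m.M) := by
  have := hm.isProbabilityMeasure_map_X
  have hout : Measurable fun r : 𝒳 × 𝒰 => m.outcome (π r.1) r.2 :=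
    hm.measurable_outcome.comp ((hπm.comp measurable_fst).prodMk measurable_snd)
  refine Measure.le_iff.2 fun s hs => ?_
  have hset : MeasurableSet {r : 𝒳 × 𝒰 | m.outcome (π r.1) r.2 ∈ s} := hout hs
  rw [Measure.map_apply (hm.measurable_Ypolicy hπm) hs,
    ← lintegral_indicator_one (hm.measurable_Ypolicy hπm hs)]
  have h := hm.lintegral_policy_eq (φ := {r : 𝒳 × 𝒰 | m.outcome (π r.1) r.2 ∈ s}.indicator 1)
    (measurable_one.indicator hset)
  refine le_trans (le_of_eq (Eq.trans (by rfl) h)) ?_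
  calc _ ≤ ∫⁻ _, (ENNReal.ofReal B • volume.restrict (Icc 0 m.M)) s ∂(m.P0.map m.X) := by
        refine lintegral_mono_ae ?_
        filter_upwards [hm.fY_density, hm.fY_bound] with x hdens hbound
        have hx : MeasurableSet {u | m.outcome (π x) u ∈ s} := measurable_prodMk_left hset
        have e : ∀ u, {r : 𝒳 × 𝒰 | m.outcome (π r.1) r.2 ∈ s}.indicator
            (1 : 𝒳 × 𝒰 → ENNReal) (x, u) = {u | m.outcome (π x) u ∈ s}.indicator 1 u :=
          fun u => rfl
        simp_rw [e]
        have hout' : Measurable (m.outcome (π x)) :=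
          hm.measurable_outcome.comp (measurable_const.prodMk measurable_id)
        have e2 : condDistrib m.U m.X m.P0 x {u | m.outcome (π x) u ∈ s}
            = (condDistrib m.U m.X m.P0 x).map (m.outcome (π x)) s :=
          (Measure.map_apply hout' hs).symm
        have hint : π x ∈ interior m.actions :=
          interior_of_margin hπ x ⟨by linarith, by linarith⟩
        rw [lintegral_indicator_one hx, e2, hdens _ (mem_actions_of_margin hρ hπ x),
          withDensity_apply _ hs, Measure.restrict_restrict hs, Measure.smul_apply,
          Measure.restrict_apply hs, smul_eq_mul, ← setLIntegral_const]
        refine setLIntegral_mono' (hs.inter measurableSet_Icc) fun y hy => ?_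
        have := hbound y hy.2 _ hint 0 (by norm_num)
        rw [iteratedDeriv_zero] at this
        exact ENNReal.ofReal_le_ofReal ((le_abs_self _).trans this)
    _ = _ := by simp

lemma Assumptions.measurable_truncWeight (hm : m.Assumptions ε B)
    (hK : IsLipschitzKernel K MK LK) {π : 𝒳 → ℝ} (hπ : Measurable π) :
    Measurable (m.truncWeight ε K h π) := by
  have hKm : Measurable K := hK.continuous.measurable
  have hfA : Measurable fun z : 𝒳 × ℝ × ℝ => m.fA z.2.1 z.1 :=
    hm.measurable_fA.comp ((measurable_fst.comp measurable_snd).prodMk measurable_fst)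
  exact Measurable.div (by fun_prop) (hfA.max measurable_const)

/-- The bias of the weighted distribution function is of order `h ^ 2`, uniformly over policies and
thresholds. -/
lemma Assumptions.abs_integral_truncWeight_sub_le (hm : m.Assumptions ε B)
    (hK : IsLipschitzKernel K MK LK) (hh : 0 < h) {π : 𝒳 → ℝ} (hπm : Measurable π) {ρ : ℝ}
    (hρ : 0 < ρ) (hπ : ∀ x, Icc (π x - ρ) (π x + ρ) ⊆ m.actions) (t : ℝ) :
    |(∫ z, m.truncWeight ε K h π z * indLE t z.2.2
        ∂(m.P0.map fun ω => (m.X ω, m.A ω, m.Y ω))) - (m.P0.map (m.Ypolicy π)).real (Iic t)| ≤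
      (2 * |B| * m.M + 2 / ρ ^ 2) * (∫ u, u ^ 2 * K u) * h ^ 2 := by
  have hPX := hm.isProbabilityMeasure_map_X
  have hXAY : Measurable fun ω => (m.X ω, m.A ω, m.Y ω) :=
    hm.measurable_X.prodMk (hm.measurable_A.prodMk hm.measurable_Y)
  have hPZ : IsProbabilityMeasure (m.P0.map fun ω => (m.X ω, m.A ω, m.Y ω)) :=
    Measure.isProbabilityMeasure_map hXAY.aemeasurable
  have hPY : IsProbabilityMeasure (m.P0.map (m.Ypolicy π)) :=
    Measure.isProbabilityMeasure_map (hm.measurable_Ypolicy hπm).aemeasurable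
  have hKm : Measurable K := hK.continuous.measurable
  set c := (2 * |B| * m.M + 2 / ρ ^ 2) * (∫ u, u ^ 2 * K u) * h ^ 2 with hc
  have hMp := hm.M_pos
  have hσ0 : 0 ≤ ∫ u, u ^ 2 * K u :=
    integral_nonneg fun u => mul_nonneg (sq_nonneg u) (hK.nonneg u)
  have hc0 : 0 ≤ c := by positivity
  have hwm := hm.measurable_truncWeight (h := h) hK hπm
  have hw0 := truncWeight_nonneg (m := m) hm.ε_pos hK hh π
  have hind : Measurable fun z : 𝒳 × ℝ × ℝ => indLE t z.2.2 :=
    (measurable_indLE t).comp (measurable_snd.comp measurable_snd)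
  have hg0 : ∀ z, 0 ≤ m.truncWeight ε K h π z * indLE t z.2.2 := fun z =>
    mul_nonneg (hw0 z) (indLE_nonneg _ _)
  -- the population mean of the estimator as an iterated integral
  have hlin : ENNReal.ofReal (∫ z, m.truncWeight ε K h π z * indLE t z.2.2
        ∂(m.P0.map fun ω => (m.X ω, m.A ω, m.Y ω)))
      = ∫⁻ x, (∫⁻ a, ENNReal.ofReal (1 / h * K ((π x - a) / h) * m.condCdf t x a))
          ∂(m.P0.map m.X) := by
    have hint : Integrable (fun z => m.truncWeight ε K h π z * indLE t z.2.2)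
        (m.P0.map fun ω => (m.X ω, m.A ω, m.Y ω)) := by
      refine Integrable.of_bound (hwm.mul hind).aestronglyMeasurable (MK / (h * ε))
        (ae_of_all _ fun z => ?_)
      rw [Real.norm_eq_abs, abs_of_nonneg (hg0 z)]
      exact (mul_le_of_le_one_right (hw0 z) (indLE_le_one _ _)).trans
        (truncWeight_le hm.ε_pos hK hh π z)
    rw [ofReal_integral_eq_lintegral_ofReal hint (ae_of_all _ hg0),
      lintegral_map (f := fun z => ENNReal.ofReal (m.truncWeight ε K h π z * indLE t z.2.2))
        (hwm.mul hind).ennreal_ofReal hXAY]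
    have hout : Measurable fun r : (𝒳 × ℝ) × 𝒰 => m.outcome r.1.2 r.2 :=
      hm.measurable_outcome.comp ((measurable_snd.comp measurable_fst).prodMk measurable_snd)
    have hφ : Measurable fun r : (𝒳 × ℝ) × 𝒰 =>
        ENNReal.ofReal (m.truncWeight ε K h π (r.1.1, r.1.2, m.outcome r.1.2 r.2)
          * indLE t (m.outcome r.1.2 r.2)) := by
      refine ((hwm.comp ?_).mul ((measurable_indLE t).comp hout)).ennreal_ofReal
      exact (measurable_fst.comp measurable_fst).prodMk
        ((measurable_snd.comp measurable_fst).prodMk hout)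
    refine Eq.trans ?_ ((hm.lintegral_eq hφ).trans ?_)
    · rfl
    refine lintegral_congr_ae ?_
    filter_upwards [Measure.ae_ae_of_ae_prod hm.ae_fA] with x hx
    refine lintegral_congr_ae ?_
    filter_upwards [hx] with a ha
    have hset : MeasurableSet {u | m.outcome a u ≤ t} :=
      measurableSet_le (hm.measurable_outcome.comp (measurable_const.prodMk measurable_id))
        measurable_const
    set w := (1 / h * K ((π x - a) / h)) / max (m.fA a x) ε with hw
    have hw0' : 0 ≤ w := hw0 (x, a, 0)
    have e1 : ∀ u, ENNReal.ofReal (m.truncWeight ε K h π (x, a, m.outcome a u)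
        * indLE t (m.outcome a u))
        = ENNReal.ofReal w * {u | m.outcome a u ≤ t}.indicator 1 u := by
      intro u
      change ENNReal.ofReal (w * indLE t (m.outcome a u)) = _
      rw [ENNReal.ofReal_mul hw0']
      by_cases hu : m.outcome a u ≤ t <;> simp [indLE, hu]
    simp_rw [e1]
    rw [lintegral_const_mul _ (measurable_one.indicator hset), lintegral_indicator_one hset,
      ← ofReal_measureReal, ← ENNReal.ofReal_mul hw0', ← ENNReal.ofReal_mul (hm.fA_nonneg _ _)]
    congr 1
    by_cases haA : a ∈ m.actions
    · have h1 := ha.1 haA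
      have hpos : 0 < m.fA a x := hm.ε_pos.trans_le h1
      rw [condCdf, indicator_of_mem haA, hw, max_eq_left h1]
      field_simp
    · rw [condCdf, indicator_of_notMem haA, ha.2 haA]
      simp
  have hF : ENNReal.ofReal ((m.P0.map (m.Ypolicy π)).real (Iic t))
      = ∫⁻ x, ENNReal.ofReal (m.condCdf t x (π x)) ∂(m.P0.map m.X) := by
    rw [ofReal_measureReal, hm.map_Ypolicy_Iic hπm hρ hπ]
  have hpt : ∀ᵐ x ∂(m.P0.map m.X),
      (∫⁻ a, ENNReal.ofReal (1 / h * K ((π x - a) / h) * m.condCdf t x a)) ≤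
        ENNReal.ofReal (m.condCdf t x (π x)) + ENNReal.ofReal c ∧
      ENNReal.ofReal (m.condCdf t x (π x)) ≤
        (∫⁻ a, ENNReal.ofReal (1 / h * K ((π x - a) / h) * m.condCdf t x a))
          + ENNReal.ofReal c := by
    filter_upwards [hm.ae_second_difference_condCdf t hπ] with x hx
    obtain ⟨hi, hle⟩ := abs_kernel_smoothing_sub_le hK
      (H := m.condCdf t x) ((hm.measurable_condCdf t).comp measurable_prodMk_left :
        Measurable fun a => m.condCdf t x a)
      (condCdf_nonneg t x) (condCdf_le_one t x) hρ (by positivity) hh hx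
    have hnn : ∀ a, 0 ≤ 1 / h * K ((π x - a) / h) * m.condCdf t x a := fun a =>
      mul_nonneg (mul_nonneg (by positivity) (hK.nonneg _)) (condCdf_nonneg _ _ _)
    rw [← ofReal_integral_eq_lintegral_ofReal hi (ae_of_all _ hnn),
      ← ENNReal.ofReal_add (condCdf_nonneg _ _ _) hc0,
      ← ENNReal.ofReal_add (integral_nonneg hnn) hc0]
    have := abs_le.1 hle
    exact ⟨ENNReal.ofReal_le_ofReal (by linarith), ENNReal.ofReal_le_ofReal (by linarith)⟩
  have hc' : ∫⁻ _, ENNReal.ofReal c ∂(m.P0.map m.X) = ENNReal.ofReal c := by simp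
  have u1 := lintegral_mono_ae (hpt.mono fun x hx => hx.1)
  have u2 := lintegral_mono_ae (hpt.mono fun x hx => hx.2)
  have hE0 := integral_nonneg
    (f := fun z => m.truncWeight ε K h π z * indLE t z.2.2)
    (μ := m.P0.map fun ω => (m.X ω, m.A ω, m.Y ω)) hg0
  rw [lintegral_add_right _ measurable_const, hc', ← hlin, ← hF,
    ← ENNReal.ofReal_add measureReal_nonneg hc0,
    ENNReal.ofReal_le_ofReal_iff (add_nonneg measureReal_nonneg hc0)] at u1
  rw [lintegral_add_right _ measurable_const, hc', ← hlin, ← hF,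
    ← ENNReal.ofReal_add hE0 hc0, ENNReal.ofReal_le_ofReal_iff (add_nonneg hE0 hc0)] at u2
  exact abs_le.2 ⟨by linarith, by linarith⟩

end CausalModel

/-! ### The estimated robust value -/

/-- The law on `ℝ` that puts mass proportional to `w i` at `y i`. -/
noncomputable def weightedLaw {N : ℕ} (w y : Fin N → ℝ) : Measure ℝ :=
  ∑ i, ENNReal.ofReal (w i / ∑ j, w j) • Measure.dirac (y i)

section WeightedLaw

variable {N : ℕ} {w y : Fin N → ℝ}

lemma isProbabilityMeasure_weightedLaw (hw : ∀ i, 0 ≤ w i) (hS : 0 < ∑ i, w i) :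
    IsProbabilityMeasure (weightedLaw w y) := by
  constructor
  simp only [weightedLaw, Measure.coe_finsetSum, Finset.sum_apply, Measure.smul_apply,
    measure_univ, smul_eq_mul, mul_one]
  rw [← ENNReal.ofReal_sum_of_nonneg fun i _ => div_nonneg (hw i) hS.le, ← Finset.sum_div,
    div_self hS.ne', ENNReal.ofReal_one]

lemma ae_weightedLaw {p : ℝ → Prop} (hp : MeasurableSet {y | p y}) (h : ∀ i, p (y i)) :
    ∀ᵐ t ∂(weightedLaw w y), p t := by
  rw [ae_iff, weightedLaw]
  simp only [Measure.coe_finsetSum, Finset.sum_apply, Measure.smul_apply, smul_eq_mul]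
  refine Finset.sum_eq_zero fun i _ => ?_
  have hs : MeasurableSet {a | ¬p a} := hp.compl
  rw [Measure.dirac_apply' _ hs]
  simp [h i]

lemma integral_weightedLaw (hw : ∀ i, 0 ≤ w i) (f : ℝ → ℝ) :
    ∫ t, f t ∂(weightedLaw w y) = (∑ i, w i * f (y i)) / ∑ i, w i := by
  rw [weightedLaw, integral_finsetSum_measure fun i _ =>
    (integrable_dirac (by simp)).smul_measure ENNReal.ofReal_ne_top, Finset.sum_div]
  refine Finset.sum_congr rfl fun i _ => ?_
  rw [integral_smul_measure, integral_dirac, ENNReal.toReal_ofReal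
    (div_nonneg (hw i) (Finset.sum_nonneg fun j _ => hw j)), smul_eq_mul]
  ring

lemma weightedLaw_real_Iic (hw : ∀ i, 0 ≤ w i) (t : ℝ) :
    (weightedLaw w y).real (Iic t) = (∑ i, w i * indLE t (y i)) / ∑ i, w i := by
  rw [← integral_weightedLaw hw, ← integral_indicator_one measurableSet_Iic]
  refine integral_congr_ae (ae_of_all _ fun s => ?_)
  simp [indLE, indicator, mem_Iic]

/-- A uniform bound on the error of the unnormalized distribution function controls, up to a factor
`2`, the normalized one, because the normalizing factor is its total mass. -/
lemma abs_weightedLaw_sub_le (hw : ∀ i, 0 ≤ w i) (hS : 0 < ∑ i, w i) {F : ℝ → ℝ} {Δ M : ℝ}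
    (hy : ∀ i, y i ∈ Icc 0 M) (hFM : F M = 1)
    (hΔ : ∀ t, |1 / (N : ℝ) * ∑ i, w i * indLE t (y i) - F t| ≤ Δ) (t : ℝ) :
    |(weightedLaw w y).real (Iic t) - F t| ≤ 2 * Δ := by
  have := isProbabilityMeasure_weightedLaw (y := y) hw hS
  set p := (weightedLaw w y).real (Iic t) with hp
  have hp0 : 0 ≤ p := measureReal_nonneg
  have hp1 : p ≤ 1 := measureReal_le_one
  have h1 := hΔ M
  have e1 : ∑ i, w i * indLE M (y i) = ∑ i, w i :=
    Finset.sum_congr rfl fun i _ => by simp [indLE, (hy i).2]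
  rw [e1, hFM] at h1
  have h2 := hΔ t
  have e2 : ∑ i, w i * indLE t (y i) = p * ∑ i, w i := by
    rw [hp, weightedLaw_real_Iic hw, div_mul_cancel₀ _ hS.ne']
  rw [e2] at h2
  set S := ∑ i, w i
  have e3 : p - F t = (1 / (N : ℝ) * (p * S) - F t) - p * (1 / (N : ℝ) * S - 1) := by ring
  rw [e3]
  refine (abs_sub _ _).trans ?_
  rw [abs_mul, abs_of_nonneg hp0]
  have h3 : p * |1 / (N : ℝ) * S - 1| ≤ |1 / (N : ℝ) * S - 1| :=
    mul_le_of_le_one_left (abs_nonneg _) hp1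
  linarith

end WeightedLaw

namespace CausalModel

variable {Ω 𝒳 𝒰 : Type*} [MeasurableSpace Ω] [MeasurableSpace 𝒳] [MeasurableSpace 𝒰]
  {m : CausalModel Ω 𝒳 𝒰} {ε B : ℝ} {K : ℝ → ℝ} {MK LK h : ℝ}

lemma bddBelow_QDRO (η : ℝ) {π : 𝒳 → ℝ} (hY : ∀ ω, m.Ypolicy π ω ∈ Icc 0 m.M) :
    BddBelow ((fun P : Measure Ω => ∫ ω, m.Ypolicy π ω ∂P) ''
      {P | IsProbabilityMeasure P ∧ InformationTheory.klDiv P m.P0 ≤ ENNReal.ofReal η}) :=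
  ⟨0, by rintro _ ⟨P, _, rfl⟩; exact integral_nonneg fun ω => (hY ω).1⟩

lemma le_QDRO {η : ℝ} {π : 𝒳 → ℝ} {c : ℝ}
    (h : ∀ P : Measure Ω, IsProbabilityMeasure P →
      InformationTheory.klDiv P m.P0 ≤ ENNReal.ofReal η → c ≤ ∫ ω, m.Ypolicy π ω ∂P) :
    c ≤ m.QDRO η π := by
  refine le_csInf ⟨_, m.P0, ⟨inferInstance, ?_⟩, rfl⟩ ?_
  · simp
  · rintro _ ⟨P, ⟨hP, hkl⟩, rfl⟩
    exact h P hP hkl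

lemma QDRO_le {η : ℝ} {π : 𝒳 → ℝ} (hY : ∀ ω, m.Ypolicy π ω ∈ Icc 0 m.M) {P : Measure Ω}
    (hP : IsProbabilityMeasure P)
    (hkl : InformationTheory.klDiv P m.P0 ≤ ENNReal.ofReal η) :
    m.QDRO η π ≤ ∫ ω, m.Ypolicy π ω ∂P :=
  csInf_le (bddBelow_QDRO η hY) ⟨P, ⟨hP, hkl⟩, rfl⟩

variable [StandardBorelSpace 𝒰] [Nonempty 𝒰] [StandardBorelSpace Ω]

lemma Assumptions.Ypolicy_mem (hm : m.Assumptions ε B) {π : 𝒳 → ℝ} {ρ : ℝ} (hρ : 0 < ρ)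
    (hπ : ∀ x, Icc (π x - ρ) (π x + ρ) ⊆ m.actions) (ω : Ω) : m.Ypolicy π ω ∈ Icc 0 m.M :=
  hm.outcome_mem _ (mem_actions_of_margin hρ hπ _) _

/-- A law on `[0, M]` with density at least `ε` forces `M ≤ 1 / ε`. -/
lemma Assumptions.mul_M_le_one (hm : m.Assumptions ε B) {π : 𝒳 → ℝ} (hπm : Measurable π)
    (hlow : ENNReal.ofReal ε • volume.restrict (Icc 0 m.M) ≤ m.P0.map (m.Ypolicy π)) :
    ε * m.M ≤ 1 := by
  have : IsProbabilityMeasure (m.P0.map (m.Ypolicy π)) :=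
    Measure.isProbabilityMeasure_map (hm.measurable_Ypolicy hπm).aemeasurable
  have h := hlow univ
  rw [Measure.smul_apply, Measure.restrict_apply_univ, Real.volume_Icc, measure_univ, sub_zero,
    smul_eq_mul, ← ENNReal.ofReal_mul hm.ε_pos.le, ENNReal.ofReal_le_one] at h
  exact h

/-- On a sample on which the unnormalized weighted distribution function of a policy is uniformly
within `Δ` of the true one, the estimated robust value is within `2 Δ / ε` of the true one. -/
theorem Assumptions.abs_Qhat_sub_QDRO_le (hm : m.Assumptions ε B) {π : 𝒳 → ℝ}
    (hπm : Measurable π) {ρ : ℝ} (hρ : 0 < ρ) (hπ : ∀ x, Icc (π x - ρ) (π x + ρ) ⊆ m.actions)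
    (hlow : ENNReal.ofReal ε • volume.restrict (Icc 0 m.M) ≤ m.P0.map (m.Ypolicy π))
    {η : ℝ} (hη : 0 ≤ η) {N : ℕ} (hN : 0 < N) {s : Fin N → 𝒳 × ℝ × ℝ}
    (hw : ∀ i, 0 ≤ m.weight K h π (s i)) (hy : ∀ i, (s i).2.2 ∈ Icc 0 m.M) {Δ : ℝ}
    (hΔ : ∀ t, |1 / (N : ℝ) * ∑ i, m.weight K h π (s i) * indLE t (s i).2.2
      - (m.P0.map (m.Ypolicy π)).real (Iic t)| ≤ Δ) :
    |m.Qhat K h η s π - m.QDRO η π| ≤ 2 * Δ / ε := by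
  have hε := hm.ε_pos
  have hN' : (0 : ℝ) < N := by exact_mod_cast hN
  have hYm := hm.measurable_Ypolicy hπm
  have hY := hm.Ypolicy_mem hρ hπ
  have hPY : IsProbabilityMeasure (m.P0.map (m.Ypolicy π)) :=
    Measure.isProbabilityMeasure_map hYm.aemeasurable
  have hν : ∀ᵐ y ∂(m.P0.map (m.Ypolicy π)), y ∈ Icc 0 m.M :=
    (ae_map_iff hYm.aemeasurable measurableSet_Icc).2 (ae_of_all _ hY)
  have hFM : (m.P0.map (m.Ypolicy π)).real (Iic m.M) = 1 := by
    rw [measureReal_def, measure_Iic_eq_one hν le_rfl, ENNReal.toReal_one]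
  have hQM : m.QDRO η π ≤ m.M := by
    refine (QDRO_le hY (P := m.P0) inferInstance (by simp)).trans ?_
    calc ∫ ω, m.Ypolicy π ω ∂m.P0 ≤ ∫ _, m.M ∂m.P0 :=
          integral_mono (integrable_of_mem_Icc hYm hY) (integrable_const _) fun ω => (hY ω).2
      _ = m.M := by simp
  have hQ0 : 0 ≤ m.QDRO η π := le_QDRO fun P _ _ => integral_nonneg fun ω => (hY ω).1
  set w : Fin N → ℝ := fun i => m.weight K h π (s i) with hwdef
  set y : Fin N → ℝ := fun i => (s i).2.2 with hydef
  rcases (Finset.sum_nonneg fun i _ => hw i : 0 ≤ ∑ i, w i).eq_or_lt with hS | hS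
  · -- all weights vanish: the bound is trivial, since `Δ ≥ 1` and `M ≤ 1 / ε`
    have hΔ1 : 1 ≤ Δ := by
      have h1 := hΔ m.M
      have e1 : ∑ i, w i * indLE m.M (y i) = ∑ i, w i :=
        Finset.sum_congr rfl fun i _ => by simp [indLE, show y i ≤ m.M from (hy i).2]
      have e2 : ∑ i, m.weight K h π (s i) * indLE m.M (s i).2.2 = 0 := e1.trans hS.symm
      rw [e2, hFM] at h1
      simpa using h1
    have hSN : m.SN K h s π = 0 := by
      change 1 / (N : ℝ) * ∑ i, w i = 0
      rw [← hS, mul_zero]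
    have hW : ∀ α, m.What K h s π α = 0 := fun α => by rw [What, hSN, div_zero]
    have hQhat : m.Qhat K h η s π = sSup ((fun α : ℝ => -α * η) '' Ioi 0) := by
      unfold Qhat
      congr 1
      refine image_congr fun α _ => ?_
      rw [hW, Real.log_zero]; ring
    have hle0 : m.Qhat K h η s π ≤ 0 := by
      rw [hQhat]
      refine csSup_le ((nonempty_Ioi (a := (0 : ℝ))).image _) ?_
      rintro _ ⟨α, hα, rfl⟩
      have : 0 < α := hα
      nlinarith
    have hge : -(1 / ε) ≤ m.Qhat K h η s π := by
      rw [hQhat]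
      have hmem : -(1 / (ε * (η + 1))) * η ∈ (fun α : ℝ => -α * η) '' Ioi 0 :=
        ⟨1 / (ε * (η + 1)), by simp only [mem_Ioi]; positivity, rfl⟩
      refine le_trans ?_ (le_csSup ⟨0, ?_⟩ hmem)
      · rw [neg_mul, neg_le_neg_iff, one_div_mul_eq_div, div_le_div_iff₀ (by positivity) hε]
        nlinarith
      · rintro _ ⟨α, hα, rfl⟩
        have : 0 < α := hα
        simp only
        nlinarith
    have hM1 : m.M ≤ 1 / ε := by
      rw [le_div_iff₀ hε, mul_comm]; exact hm.mul_M_le_one hπm hlow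
    have h2 : 2 * (1 / ε) ≤ 2 * Δ / ε := by
      rw [mul_div_assoc]
      gcongr
    rw [abs_le]
    constructor <;> linarith
  · have hprob := isProbabilityMeasure_weightedLaw (y := y) hw hS
    have hμ : ∀ᵐ t ∂(weightedLaw w y), t ∈ Icc 0 m.M := ae_weightedLaw measurableSet_Icc hy
    have hclose := Iic_le_Iic_add_of_cdf_close hμ hν hε hlow
      (abs_weightedLaw_sub_le hw hS hy hFM hΔ)
    have hWhat : ∀ α, m.What K h s π α = ∫ t, Real.exp (-t / α) ∂(weightedLaw w y) := by
      intro α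
      rw [integral_weightedLaw hw]
      change (1 / (N : ℝ) * ∑ i, w i * Real.exp (-y i / α)) / (1 / (N : ℝ) * ∑ i, w i) = _
      rw [mul_div_mul_left _ _ (by positivity)]
    have hexp : ∀ α, ∫ t, Real.exp (-t / α) ∂(m.P0.map (m.Ypolicy π))
        = ∫ ω, Real.exp (-m.Ypolicy π ω / α) ∂m.P0 := fun α =>
      integral_map hYm.aemeasurable
        (by fun_prop : Continuous fun t : ℝ => Real.exp (-t / α)).aestronglyMeasurable
    set d := 2 * Δ / ε with hd
    have up : ∀ α, 0 < α → -α * Real.log (m.What K h s π α) - α * η ≤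
        -α * Real.log (∫ ω, Real.exp (-m.Ypolicy π ω / α) ∂m.P0) - α * η + d := by
      intro α hα
      have := neg_mul_log_le_of_Iic_le hν hμ hα fun t => (hclose t).2
      rw [hWhat, ← hexp]
      linarith
    have down : ∀ α, 0 < α → -α * Real.log (∫ ω, Real.exp (-m.Ypolicy π ω / α) ∂m.P0) - α * η ≤
        -α * Real.log (m.What K h s π α) - α * η + d := by
      intro α hα
      have := neg_mul_log_le_of_Iic_le hμ hν hα fun t => (hclose t).1
      rw [hWhat, ← hexp]
      linarith
    have hbdd : BddAbove ((fun α : ℝ => -α * Real.log (m.What K h s π α) - α * η) '' Ioi 0) := by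
      refine ⟨(∫ ω, m.Ypolicy π ω ∂m.P0) + d, ?_⟩
      rintro _ ⟨α, hα, rfl⟩
      have := neg_mul_log_sub_le_integral hYm hY hη (P := m.P0) (P₀ := m.P0) (by simp) hα
      exact (up α hα).trans (by linarith)
    rw [abs_le]
    constructor
    · have hB : 0 < |B| + 1 := by positivity
      have hupp : m.P0.map (m.Ypolicy π) ≤
          ENNReal.ofReal (|B| + 1) • volume.restrict (Icc 0 m.M) := by
        refine (hm.map_Ypolicy_le hπm hρ hπ).trans ?_
        refine Measure.le_iff.2 fun S _ => ?_
        rw [Measure.smul_apply, Measure.smul_apply, smul_eq_mul, smul_eq_mul]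
        gcongr
        linarith [le_abs_self B]
      suffices m.QDRO η π ≤ m.Qhat K h η s π + d by linarith
      refine le_of_forall_pos_le_add fun e he => ?_
      obtain ⟨α, hα, P, hP, hkl, hle⟩ :=
        exists_integral_le_dual hm.M_pos hYm hY hε hB hlow hupp hη he
      have h1 := QDRO_le hY hP hkl
      have h2 := down α hα
      have h3 : -α * Real.log (m.What K h s π α) - α * η ≤ m.Qhat K h η s π :=
        le_csSup hbdd ⟨α, hα, rfl⟩
      linarith
    · suffices m.Qhat K h η s π ≤ m.QDRO η π + d by linarith
      refine csSup_le ((nonempty_Ioi (a := (0 : ℝ))).image _) ?_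
      rintro _ ⟨α, hα, rfl⟩
      have h1 : -α * Real.log (∫ ω, Real.exp (-m.Ypolicy π ω / α) ∂m.P0) - α * η ≤ m.QDRO η π :=
        le_QDRO fun P hP hkl => neg_mul_log_sub_le_integral hYm hY hη hkl hα
      have h2 := up α hα
      simp only
      linarith

/-! ### The regret bound -/

lemma Assumptions.measurable_obs (hm : m.Assumptions ε B) :
    Measurable fun ω => (m.X ω, m.A ω, m.Y ω) :=
  hm.measurable_X.prodMk (hm.measurable_A.prodMk hm.measurable_Y)

lemma Assumptions.isProbabilityMeasure_sampleLaw (hm : m.Assumptions ε B) (N : ℕ) :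
    IsProbabilityMeasure (m.sampleLaw N) := by
  have := Measure.isProbabilityMeasure_map (μ := m.P0) hm.measurable_obs.aemeasurable
  unfold sampleLaw
  infer_instance

lemma Assumptions.ae_sampleLaw (hm : m.Assumptions ε B) (N : ℕ) :
    ∀ᵐ s ∂(m.sampleLaw N), ∀ i, ε ≤ m.fA (s i).2.1 (s i).1 ∧ (s i).2.2 ∈ Icc 0 m.M := by
  have := Measure.isProbabilityMeasure_map (μ := m.P0) hm.measurable_obs.aemeasurable
  have hfA : Measurable fun z : 𝒳 × ℝ × ℝ => m.fA z.2.1 z.1 :=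
    hm.measurable_fA.comp ((measurable_fst.comp measurable_snd).prodMk measurable_fst)
  have h : ∀ᵐ z ∂(m.P0.map fun ω => (m.X ω, m.A ω, m.Y ω)),
      ε ≤ m.fA z.2.1 z.1 ∧ z.2.2 ∈ Icc 0 m.M := by
    have hset : MeasurableSet {z : 𝒳 × ℝ × ℝ | ε ≤ m.fA z.2.1 z.1 ∧ z.2.2 ∈ Icc 0 m.M} :=
      (measurableSet_le measurable_const hfA).inter
        ((measurable_snd.comp measurable_snd) measurableSet_Icc)
    rw [ae_map_iff hm.measurable_obs.aemeasurable hset]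
    filter_upwards [hm.ae_le_fA, hm.A_mem] with ω h1 h2
    exact ⟨h1, hm.outcome_mem _ h2 _⟩
  rw [eventually_all]
  intro i
  exact (Measure.tendsto_eval_ae_ae (μ := fun _ : Fin N => m.P0.map fun ω =>
    (m.X ω, m.A ω, m.Y ω)) (i := i)).eventually h

/-- The finite-sample regret bound.  The regret is at most twice the uniform error of the estimated
robust values. -/
theorem Assumptions.measure_regret_gt_le (hm : m.Assumptions ε B)
    (hK : IsLipschitzKernel K MK LK) {ρ : ℝ} (hρ : 0 < ρ) {η : ℝ} (hη : 0 ≤ η)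
    {Pol : Set (𝒳 → ℝ)} (hPol : m.IsPolicyClass ε ρ Pol) {N : ℕ} (hN : 0 < N) (hh : 0 < h)
    {δ : ℝ} (hδ : 0 < δ) {κ : ℝ} (hκ0 : 0 ≤ κ)
    (hκ : m.entropyIntegral Pol N (2 * MK * h / LK) ≤ ENNReal.ofReal κ)
    {πhat : (Fin N → 𝒳 × ℝ × ℝ) → 𝒳 → ℝ} (hπhat : m.IsLearnedPolicy K h η Pol πhat) :
    m.sampleLaw N {s | 288 * LK * κ / (√N * h ^ 2 * ε ^ 2)
        + 192 * MK * (√(Real.log 1) + 2 * √2) / (√N * h * ε ^ 2)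
        + 4 * MK * √(2 * Real.log (2 / δ)) / (√N * h * ε ^ 2)
        + 4 * ((2 * |B| * m.M + 2 / ρ ^ 2) * ∫ u, u ^ 2 * K u) / ε * h ^ 2
          < m.regret η Pol (πhat s)} ≤ ENNReal.ofReal δ := by
  have hprob := hm.isProbabilityMeasure_sampleLaw N
  have hPZ := Measure.isProbabilityMeasure_map (μ := m.P0) hm.measurable_obs.aemeasurable
  rcases lt_or_ge 1 δ with hδ1 | hδ1
  · refine prob_le_one.trans ?_
    rw [← ENNReal.ofReal_one]
    exact ENNReal.ofReal_le_ofReal hδ1.le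
  have hε := hm.ε_pos
  have hMK := hK.bound_pos
  have hLK := hK.lipschitz_pos
  have hN' : (0 : ℝ) < N := by exact_mod_cast hN
  have hsN : 0 < √(N : ℝ) := Real.sqrt_pos.2 hN'
  set b := MK / (h * ε) with hb
  set L := LK / (h ^ 2 * ε) with hL
  have hb0 : 0 < b := by positivity
  have hL0 : 0 < L := by positivity
  have hr : 2 * b / L = 2 * MK * h / LK := by
    rw [hb, hL]; field_simp
  set β := 2 * (9 * L * κ + 31 * b) / √N + b * √(2 * Real.log (1 / δ) / N) with hβ
  set c := (2 * |B| * m.M + 2 / ρ ^ 2) * ∫ u, u ^ 2 * K u with hc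
  have hdev := measure_not_forall_cdfDeviation_le
    (μ := m.P0.map fun ω => (m.X ω, m.A ω, m.Y ω)) (ξ := Prod.fst) (y := fun z => z.2.2)
    (F := Pol) (W := m.truncWeight ε K h) (measurable_snd.comp measurable_snd) hb0 hL0
    (fun π hπ => hm.measurable_truncWeight hK (hPol.measurable π hπ))
    (fun π _ => truncWeight_nonneg hε hK hh π) (fun π _ => truncWeight_le hε hK hh π)
    (fun π _ π' _ => abs_truncWeight_sub_le hε hK hh π π') hPol.separable hN hκ0
    (by rw [hr]; exact hκ) hδ hδ1
  rw [← hβ] at hdev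
  have hgood : ∀ᵐ s ∂(m.sampleLaw N), 288 * LK * κ / (√N * h ^ 2 * ε ^ 2)
        + 192 * MK * (√(Real.log 1) + 2 * √2) / (√N * h * ε ^ 2)
        + 4 * MK * √(2 * Real.log (2 / δ)) / (√N * h * ε ^ 2)
        + 4 * c / ε * h ^ 2 < m.regret η Pol (πhat s) →
      ¬ ∀ π ∈ Pol, ∀ t, cdfDeviation (m.P0.map fun ω => (m.X ω, m.A ω, m.Y ω))
        (fun z => z.2.2) (m.truncWeight ε K h) π t s ≤ β := by
    filter_upwards [hπhat, hm.ae_sampleLaw N] with s hopt hs hlt hall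
    obtain ⟨hmem, hmax⟩ := hopt
    have hQ : ∀ π ∈ Pol, |m.Qhat K h η s π - m.QDRO η π| ≤ 2 * (β + c * h ^ 2) / ε := by
      intro π hπ
      have hwt : ∀ i, m.weight K h π (s i) = m.truncWeight ε K h π (s i) := fun i =>
        weight_eq_truncWeight (hs i).1
      refine hm.abs_Qhat_sub_QDRO_le (hPol.measurable π hπ) hρ (hPol.margin π hπ)
        (hPol.density_ge π hπ) hη hN (fun i => ?_) (fun i => (hs i).2) fun t => ?_
      · rw [hwt]; exact truncWeight_nonneg hε hK hh _ _
      · simp_rw [hwt]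
        have h1 := hall π hπ t
        have h2 := hm.abs_integral_truncWeight_sub_le hK hh (hPol.measurable π hπ) hρ
          (hPol.margin π hπ) t
        exact (abs_sub_le _ _ _).trans (add_le_add h1 h2)
    have hreg : m.regret η Pol (πhat s) ≤ 4 * (β + c * h ^ 2) / ε := by
      have h1 : sSup (m.QDRO η '' Pol) ≤ m.Qhat K h η s (πhat s) + 2 * (β + c * h ^ 2) / ε := by
        refine csSup_le ⟨_, mem_image_of_mem _ hmem⟩ ?_
        rintro _ ⟨π, hπ, rfl⟩
        have h2 := (abs_le.1 (hQ π hπ)).1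
        have h3 := hmax π hπ
        linarith
      have h2 := (abs_le.1 (hQ _ hmem)).2
      have e : 4 * (β + c * h ^ 2) / ε
          = 2 * (β + c * h ^ 2) / ε + 2 * (β + c * h ^ 2) / ε := by ring
      unfold regret
      linarith
    refine absurd (hlt.trans_le hreg) (not_lt.2 ?_)
    have t1 : 4 * (2 * (9 * L * κ) / √N) / ε ≤ 288 * LK * κ / (√N * h ^ 2 * ε ^ 2) := by
      have e : 4 * (2 * (9 * L * κ) / √N) / ε = 72 * LK * κ / (√N * h ^ 2 * ε ^ 2) := by
        rw [hL]; field_simp; ring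
      rw [e]
      gcongr
      norm_num
    have t2 : 4 * (2 * (31 * b) / √N) / ε ≤
        192 * MK * (√(Real.log 1) + 2 * √2) / (√N * h * ε ^ 2) := by
      have e : 4 * (2 * (31 * b) / √N) / ε = MK * 248 / (√N * h * ε ^ 2) := by
        rw [hb]; field_simp; ring
      have h2 : 1 ≤ √2 := Real.one_le_sqrt.2 (by norm_num)
      rw [e, Real.log_one, Real.sqrt_zero, zero_add, mul_comm 192 MK, mul_assoc MK]
      gcongr
      linarith
    have t3 : 4 * (b * √(2 * Real.log (1 / δ) / N)) / ε ≤
        4 * MK * √(2 * Real.log (2 / δ)) / (√N * h * ε ^ 2) := by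
      have e : 4 * (b * √(2 * Real.log (1 / δ) / N)) / ε
          = 4 * MK * √(2 * Real.log (1 / δ)) / (√N * h * ε ^ 2) := by
        rw [Real.sqrt_div' _ hN'.le, hb]; field_simp
      rw [e]
      gcongr
      norm_num
    have e : 4 * (β + c * h ^ 2) / ε = 4 * (2 * (9 * L * κ) / √N) / ε
        + 4 * (2 * (31 * b) / √N) / ε + 4 * (b * √(2 * Real.log (1 / δ) / N)) / ε
        + 4 * c / ε * h ^ 2 := by
      rw [hβ]; ring
    rw [e]
    linarith
  exact (measure_mono_ae hgood).trans hdev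

/-- Bandwidths of exact order `N ^ (-1 / 5)` make all terms of the regret bound vanish. -/
lemma tendsto_regret_bound {h : ℕ → ℝ} (hpos : ∀ N, 0 < h N)
    (hΘ : h =Θ[atTop] fun N : ℕ => (N : ℝ) ^ (-(1 / 5) : ℝ)) (a₁ a₂ a₃ C : ℝ) {ε : ℝ}
    (hε : 0 < ε) :
    Tendsto (fun N : ℕ => a₁ / (√N * h N ^ 2 * ε ^ 2) + a₂ / (√N * h N * ε ^ 2)
      + a₃ / (√N * h N * ε ^ 2) + C * h N ^ 2) atTop (𝓝 0) := by
  have hcast : Tendsto (fun N : ℕ => (N : ℝ)) atTop atTop := tendsto_natCast_atTop_atTop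
  have hh0 : Tendsto h atTop (𝓝 0) := hΘ.1.trans_tendsto
    ((tendsto_rpow_neg_atTop (by norm_num : (0 : ℝ) < 1 / 5)).comp hcast)
  have hinv : Tendsto (fun N : ℕ => √(N : ℝ) * h N ^ 2) atTop atTop := by
    obtain ⟨c, hc0, hc⟩ := hΘ.2.exists_pos
    have hlow : ∀ᶠ N : ℕ in atTop, (1 / c ^ 2) * (N : ℝ) ^ (1 / 10 : ℝ) ≤ √(N : ℝ) * h N ^ 2 := by
      filter_upwards [hc.bound, eventually_gt_atTop 0] with N hN hNpos
      have hN0 : (0 : ℝ) < N := by exact_mod_cast hNpos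
      rw [Real.norm_of_nonneg (by positivity), Real.norm_of_nonneg (hpos N).le] at hN
      have e : (N : ℝ) ^ (1 / 10 : ℝ) = √N * ((N : ℝ) ^ (-(1 / 5) : ℝ)) ^ 2 := by
        rw [Real.sqrt_eq_rpow, ← Real.rpow_natCast, ← Real.rpow_mul hN0.le, ← Real.rpow_add hN0]
        norm_num
      rw [e]
      calc 1 / c ^ 2 * (√N * ((N : ℝ) ^ (-(1 / 5) : ℝ)) ^ 2)
          ≤ 1 / c ^ 2 * (√N * (c * h N) ^ 2) := by gcongr
        _ = √N * h N ^ 2 := by field_simp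
    refine tendsto_atTop_mono' _ hlow ?_
    exact ((tendsto_rpow_atTop (by norm_num : (0 : ℝ) < 1 / 10)).comp hcast).const_mul_atTop
      (by positivity)
  have t1 : ∀ a : ℝ, Tendsto (fun N : ℕ => a / (√N * h N ^ 2 * ε ^ 2)) atTop (𝓝 0) := fun a =>
    (hinv.atTop_mul_const (by positivity)).const_div_atTop a
  have t2 : ∀ a : ℝ, Tendsto (fun N : ℕ => a / (√N * h N * ε ^ 2)) atTop (𝓝 0) := fun a => by
    have := (t1 a).mul hh0
    rw [mul_zero] at this
    refine this.congr fun N => ?_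
    have := hpos N
    field_simp
  have t3 : Tendsto (fun N => C * h N ^ 2) atTop (𝓝 0) := by
    simpa using (hh0.pow 2).const_mul C
  simpa using (((t1 a₁).add (t2 a₂)).add (t2 a₃)).add t3

end CausalModel

theorem corollary1 :
    ∃ 𝒦 : ℝ, 1 ≤ 𝒦 ∧
    ∀ (Ω 𝒳 𝒰 : Type*) [MeasurableSpace Ω] [StandardBorelSpace Ω] [MeasurableSpace 𝒳]
      [MeasurableSpace 𝒰] [StandardBorelSpace 𝒰] [Nonempty 𝒰]
      (m : CausalModel Ω 𝒳 𝒰) (ε B : ℝ) (_ : m.Assumptions ε B)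
      (K : ℝ → ℝ) (MK LK : ℝ) (_ : IsLipschitzKernel K MK LK) (ρ : ℝ) (_ : 0 < ρ),
      -- the finite-sample bound; `C` is the constant of the `O(h²)` term
      (∃ C : ℝ, ∀ (η : ℝ) (_ : 0 ≤ η) (Pol : Set (𝒳 → ℝ)) (_ : m.IsPolicyClass ε ρ Pol)
        (N : ℕ) (_ : 0 < N) (h : ℝ) (_ : 0 < h) (δ : ℝ) (_ : 0 < δ) (κ : ℝ)
        (_ : 0 ≤ κ) (_ : m.entropyIntegral Pol N (2 * MK * h / LK) = ENNReal.ofReal κ)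
        (πhat : (Fin N → 𝒳 × ℝ × ℝ) → 𝒳 → ℝ) (_ : m.IsLearnedPolicy K h η Pol πhat),
        m.sampleLaw N {s |
            288 * LK * κ / (√N * h ^ 2 * ε ^ 2)
              + 192 * MK * (√(Real.log 𝒦) + 2 * √2) / (√N * h * ε ^ 2)
              + 4 * MK * √(2 * Real.log (2 / δ)) / (√N * h * ε ^ 2)
              + C * h ^ 2 < m.regret η Pol (πhat s)} ≤ ENNReal.ofReal δ) ∧
      -- consistency for bandwidths of order `N^(-1/5)`
      (∀ (η : ℝ) (_ : 0 ≤ η) (Pol : Set (𝒳 → ℝ)) (_ : m.IsPolicyClass ε ρ Pol)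
        (h : ℕ → ℝ) (_ : ∀ N, 0 < h N)
        (_ : h =Θ[atTop] fun N : ℕ => (N : ℝ) ^ (-(1 / 5) : ℝ))
        (κ : ℝ) (_ : ∀ N, 0 < N →
          m.entropyIntegral Pol N (2 * MK * h N / LK) ≤ ENNReal.ofReal κ)
        (πhat : (N : ℕ) → (Fin N → 𝒳 × ℝ × ℝ) → 𝒳 → ℝ)
        (_ : ∀ N, 0 < N → m.IsLearnedPolicy K (h N) η Pol (πhat N)) (τ : ℝ) (_ : 0 < τ),
        Tendsto (fun N => m.sampleLaw N {s | τ < m.regret η Pol (πhat N s)}) atTop (𝓝 0)) := by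
  refine ⟨1, le_rfl, ?_⟩
  intro Ω 𝒳 𝒰 _ _ _ _ _ _ m ε B hm K MK LK hK ρ hρ
  refine ⟨⟨4 * ((2 * |B| * m.M + 2 / ρ ^ 2) * ∫ u, u ^ 2 * K u) / ε, ?_⟩, ?_⟩
  · intro η hη Pol hPol N hN h hh δ hδ κ hκ0 hκ πhat hπhat
    exact hm.measure_regret_gt_le hK hρ hη hPol hN hh hδ hκ0 hκ.le hπhat
  · intro η hη Pol hPol h hh hΘ κ hκ πhat hπhat τ hτ
    rw [ENNReal.tendsto_nhds_zero]
    intro δ' hδ'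
    obtain ⟨δ, hδ, hδle⟩ : ∃ δ : ℝ, 0 < δ ∧ ENNReal.ofReal δ ≤ δ' := by
      have hne : min δ' 1 ≠ ⊤ := ne_top_of_le_ne_top ENNReal.one_ne_top (min_le_right _ _)
      refine ⟨(min δ' 1).toReal, ENNReal.toReal_pos (lt_min hδ' one_pos).ne' hne, ?_⟩
      rw [ENNReal.ofReal_toReal hne]
      exact min_le_left _ _
    have hlim := CausalModel.tendsto_regret_bound hh hΘ (288 * LK * max κ 0)
      (192 * MK * (√(Real.log 1) + 2 * √2)) (4 * MK * √(2 * Real.log (2 / δ)))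
      (4 * ((2 * |B| * m.M + 2 / ρ ^ 2) * ∫ u, u ^ 2 * K u) / ε) hm.ε_pos
    filter_upwards [hlim.eventually_lt_const hτ, eventually_gt_atTop 0] with N hNτ hN
    refine le_trans (measure_mono fun s hs => ?_) ((hm.measure_regret_gt_le hK hρ hη hPol hN
      (hh N) hδ (le_max_right κ 0) ((hκ N hN).trans
        (ENNReal.ofReal_le_ofReal (le_max_left _ _))) (hπhat N hN)).trans hδle)
    exact hNτ.trans hs
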